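/- Let $\Bbbk$ be a field and let $A=\bigoplus_{j\ge 0}A_j$ be a connected $\Bbbk$-algebra, i.e. an $\mathbb{N}$-graded $\Bbbk$-algebra with every $A_j$ finite-dimensional and such that the structure map induces an isomorphism $\Bbbk\cong A_0$. Let $\varphi:\mathrm{T}(A_1)\to A$ be the canonical algebra map from the tensor algebra. For $F\subseteq A_1\otimes A_1$, write $A=\langle A_1\mid F\rangle$ if $\varphi$ is surjective and $\ker\varphi$ is the two-sided ideal generated by $F$. The following are equivalent: 1. $A$ is quadratic, Gorenstein, and of global dimension $2$. 2. $A$ is quadratic, and its quadratic dual $A^!$ is Frobenius with $\sup A^!=2$. 3. $\dim_\Bbbk A_1\ge 2$ and $A=\langle A_1\mid f\rangle$ for a single element $f\in A_1\otimes_\Bbbk A_1$ of maximal rank. Here: - $A$ is *quadratic* if $A=\langle A_1\mid \ker\varphi\cap(A_1\otimes A_1)\rangle$. - If $A$ is quadratic, its *quadratic dual* is $A^!=\langle A_1^\vee\mid \operatorname{im}\mu^\vee\rangle$, the quotient of $\mathrm{T}(A_1^\vee)$ by the two-sided ideal generated by $\operatorname{im}\mu^\vee$, with $A_1^\vee$ in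 degree $1$. Here $\mu:A_1\otimes A_1\to A_2$ is the multiplication map, ${}^\vee$ is the $\Bbbk$-linear dual, and $(A_1\otimes A_1)^\vee$ is identified with $A_1^\vee\otimes A_1^\vee$ through $(\alpha\otimes\beta)(x\otimes y)=\alpha(x)\beta(y)$. - For a graded algebra $B$, $\sup B$ is the supremum of the degrees $j$ with $B_j\ne 0$. The algebra $B$ is *Frobenius* if it is finite-dimensional and, with $n=\sup B$, there is an isomorphism $B_B\cong D({}_BB)(-n)$ of graded right $B$-modules, where $D$ is the graded $\Bbbk$-linear dual and $M(-n)_j=M_{j-n}$. - $A$ is *Gorenstein* if the bigraded $\Bbbk$-space $\bigoplus_{i,j}\operatorname{Ext}^i_A(\Bbbk_A,A_A)_j$ is one-dimensional. Here $\Bbbk_A=A/A_+$, and $\operatorname{Ext}^i_A(M,N)_j$ is the degree-$i$ cohomology of the complex of $A$-linear morphisms of internal degree $j$ from a graded projective resolution of the graded right module $M$ to $N$. - The *global dimension* of $A$ is the supremum of the projective dimensions of the right $A$-modules. - The *rank* of $f=\sum_{i,j}\ell_{ij}\,x_i\otimes x_j$, with $\{x_i\}$ a basis of $A_1$, is the rank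 of the matrix $[\ell_{ij}]$; $f$ has *maximal rank* if its rank is $\dim_\Bbbk A_1$. -/

import Mathlib

open scoped TensorProduct DirectSum

namespace GradedGor

universe v u w

noncomputable section

/-! ### Connected algebras -/

/-- An `ℕ`-graded `k`-algebra `A = ⨁ A_j` is *connected* if every `A_j` is finite-dimensional and
the structure map induces an isomorphism of `k` with `A_0`. -/
structure IsConnected {k : Type v} {A : Type u} [Field k] [Ring A] [Algebra k A]
    (𝒜 : ℕ → Submodule k A) [GradedAlgebra 𝒜] : Prop where
  finite : ∀ n, Module.Finite k (𝒜 n)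
  bijective : Function.Bijective (algebraMap k (𝒜 0))

/-- The supremum of the degrees in which a graded space is nonzero. -/
def gradedSup {k : Type v} {A : Type u} [Field k] [AddCommGroup A] [Module k A]
    (𝒜 : ℕ → Submodule k A) : WithBot ℕ∞ :=
  sSup ((fun n : ℕ => ((n : ℕ∞) : WithBot ℕ∞)) '' {n | 𝒜 n ≠ ⊥})

/-! ### Presentations by degree-two relations -/

/-- The inclusion of `X ⊗ X` into the tensor algebra, `x ⊗ y ↦ x * y`. -/
def tensorSquare (k : Type v) (X : Type w) [Field k] [AddCommGroup X] [Module k X] :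
    X ⊗[k] X →ₗ[k] TensorAlgebra k X :=
  TensorProduct.lift
    ((LinearMap.mul k (TensorAlgebra k X)).compl₁₂ (TensorAlgebra.ι k) (TensorAlgebra.ι k))

/-- The algebra `⟨X ∣ F⟩` with generating space `X` and relation space `F ⊆ X ⊗ X`. -/
abbrev QuadAlg {k : Type v} {X : Type w} [Field k] [AddCommGroup X] [Module k X]
    (F : Submodule k (X ⊗[k] X)) : Type (max v w) :=
  RingQuot (fun a b : TensorAlgebra k X => a ∈ F.map (tensorSquare k X) ∧ b = 0)

namespace QuadAlg

variable {k : Type v} {X : Type w} [Field k] [AddCommGroup X] [Module k X]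
  (F : Submodule k (X ⊗[k] X))

/-- The canonical surjection from the tensor algebra. -/
def mk : TensorAlgebra k X →ₐ[k] QuadAlg F :=
  RingQuot.mkAlgHom k _

/-- The canonical map from the generating space. -/
def gen : X →ₗ[k] QuadAlg F :=
  (mk F).toLinearMap ∘ₗ TensorAlgebra.ι k

/-- The grading of `⟨X ∣ F⟩` in which `X` has degree one: degree `n` is spanned by the products of
`n` generators. -/
def grading (n : ℕ) : Submodule k (QuadAlg F) :=
  LinearMap.range (gen F) ^ n

instance : SetLike.GradedMonoid (grading F) :=
  Submodule.nat_power_gradedMonoid (LinearMap.range (gen F))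

/-- Generators, mapped to the external direct sum. -/
def genSum : X →ₗ[k] ⨁ n, grading F n :=
  DirectSum.lof k ℕ (fun n => grading F n) 1 ∘ₗ
    (gen F).codRestrict _ fun m => by
      simpa only [grading, pow_one] using LinearMap.mem_range_self _ m

theorem coe_lift_genSum :
    (DirectSum.coeAlgHom (grading F)).comp (TensorAlgebra.lift k (genSum F)) = mk F := by
  ext m
  simp only [LinearMap.comp_apply, AlgHom.toLinearMap_apply, AlgHom.comp_apply,
    TensorAlgebra.lift_ι_apply, genSum, DirectSum.lof_eq_of, DirectSum.coeAlgHom_of]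
  rfl

theorem lift_genSum_relation {t : TensorAlgebra k X} (ht : t ∈ F.map (tensorSquare k X)) :
    TensorAlgebra.lift k (genSum F) t = 0 := by
  obtain ⟨f, hf, rfl⟩ := ht
  have key : ∀ g : X ⊗[k] X, ∃ y : grading F 2,
      TensorAlgebra.lift k (genSum F) (tensorSquare k X g)
        = DirectSum.of (fun n => grading F n) 2 y := by
    intro g
    induction g using TensorProduct.induction_on with
    | zero => exact ⟨0, by simp⟩
    | tmul a b =>
      have hmem : ∀ c : X, gen F c ∈ grading F 1 := fun c => by
        simpa only [grading, pow_one] using LinearMap.mem_range_self _ c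
      refine ⟨⟨gen F a * gen F b, SetLike.mul_mem_graded (hmem a) (hmem b)⟩, ?_⟩
      have hgen : ∀ c : X, genSum F c = DirectSum.of (fun n => grading F n) 1 ⟨gen F c, hmem c⟩ :=
        fun _ => rfl
      simp only [tensorSquare, TensorProduct.lift.tmul, LinearMap.compl₁₂_apply,
        LinearMap.mul_apply', map_mul, TensorAlgebra.lift_ι_apply]
      rw [hgen, hgen, DirectSum.of_mul_of]
      rfl
    | add a b ha hb =>
      obtain ⟨y, hy⟩ := ha
      obtain ⟨z, hz⟩ := hb
      exact ⟨y + z, by rw [map_add, map_add, hy, hz, map_add]⟩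
  obtain ⟨y, hy⟩ := key f
  have h0 : mk F (tensorSquare k X f) = 0 := by
    rw [← map_zero (mk F)]
    exact RingQuot.mkAlgHom_rel k ⟨⟨f, hf, rfl⟩, rfl⟩
  have h1 : (y : QuadAlg F) = 0 := by
    rw [← h0, ← coe_lift_genSum, AlgHom.comp_apply, hy, DirectSum.coeAlgHom_of]
  rw [hy, show y = 0 from Subtype.ext h1, map_zero]

/-- The decomposition map of the grading. -/
def decomp : QuadAlg F →ₐ[k] ⨁ n, grading F n :=
  RingQuot.liftAlgHom k ⟨TensorAlgebra.lift k (genSum F), fun a b h => by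
    rw [lift_genSum_relation F h.1, h.2, map_zero]⟩

theorem decomp_mk (t : TensorAlgebra k X) :
    decomp F (mk F t) = TensorAlgebra.lift k (genSum F) t :=
  RingQuot.liftAlgHom_mkAlgHom_apply _ _ _ _

theorem decomp_coe (n : ℕ) (x : grading F n) :
    decomp F x = DirectSum.of (fun n => grading F n) n x := by
  obtain ⟨x, hx⟩ := x
  dsimp only
  unfold grading at hx
  induction hx using Submodule.pow_induction_on_left' with
  | algebraMap r =>
    rw [AlgHom.commutes, DirectSum.algebraMap_apply]; rfl
  | add x y i hx hy ihx ihy =>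
    rw [map_add, ihx, ihy, ← map_add]
    rfl
  | mem_mul m hm i x hx ih =>
    obtain ⟨m, rfl⟩ := hm
    rw [map_mul, ih]
    have : decomp F (gen F m) = genSum F m := by
      rw [gen, LinearMap.comp_apply, AlgHom.toLinearMap_apply, decomp_mk,
        TensorAlgebra.lift_ι_apply]
    rw [this, genSum, LinearMap.comp_apply, DirectSum.lof_eq_of, DirectSum.of_mul_of]
    exact DirectSum.of_eq_of_gradedMonoid_eq (Sigma.subtype_ext (add_comm _ _) rfl)

instance gradedAlgebra : GradedAlgebra (grading F) :=
  GradedAlgebra.ofAlgHom _ (decomp F)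
    (by
      refine RingQuot.ringQuot_ext' k _ _ ?_
      ext t
      change DirectSum.coeAlgHom (grading F) (decomp F (mk F (TensorAlgebra.ι k t)))
        = mk F (TensorAlgebra.ι k t)
      rw [decomp_mk, ← AlgHom.comp_apply, coe_lift_genSum])
    (decomp_coe F)

end QuadAlg

/-- The coefficients `ℓ_{ij}` in the expansion `f = ∑ ℓ_{ij} (x_i ⊗ x_j)` in a basis `x`. -/
def coeffMatrix {k : Type v} {X : Type w} [Field k] [AddCommGroup X] [Module k X]
    {ι : Type*} (b : Module.Basis ι k X) (f : X ⊗[k] X) : Matrix ι ι k :=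
  Matrix.of fun i j => (b.tensorProduct b).repr f (i, j)

/-- The rank of an element of `X ⊗ X`, for `X` finite-dimensional: the rank of its coefficient
matrix (independent of the basis, see `tensorRank_eq`). -/
def tensorRank {k : Type v} {X : Type w} [Field k] [AddCommGroup X] [Module k X]
    [Module.Finite k X] (f : X ⊗[k] X) : ℕ :=
  (coeffMatrix (Module.finBasis k X) f).rank

theorem coeffMatrix_change {k : Type v} {X : Type w} [Field k] [AddCommGroup X] [Module k X]
    {ι κ : Type*} [Fintype ι] [Fintype κ] (b : Module.Basis ι k X) (c : Module.Basis κ k X)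
    (f : X ⊗[k] X) :
    coeffMatrix c f = c.toMatrix b * coeffMatrix b f * (c.toMatrix b).transpose := by
  classical
  induction f using TensorProduct.induction_on with
  | zero => ext i j; simp [coeffMatrix, Matrix.mul_apply]
  | tmul x y =>
    ext i j
    have hx := congrFun (Module.Basis.toMatrix_mulVec_repr (b := b) (b' := c) x) i
    have hy := congrFun (Module.Basis.toMatrix_mulVec_repr (b := b) (b' := c) y) j
    simp only [coeffMatrix, Matrix.of_apply, Module.Basis.tensorProduct_repr_tmul_apply,
      Matrix.mul_apply, Matrix.transpose_apply, smul_eq_mul]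
    simp only [← hx, ← hy, Matrix.mulVec, dotProduct]
    rw [mul_comm, Finset.sum_mul_sum, Finset.sum_comm]
    simp only [Finset.sum_mul]
    refine Finset.sum_congr rfl fun a _ => Finset.sum_congr rfl fun d _ => ?_
    ring
  | add x y hx hy =>
    have e1 : coeffMatrix b (x + y) = coeffMatrix b x + coeffMatrix b y := by
      ext i j; simp [coeffMatrix]
    have e2 : coeffMatrix c (x + y) = coeffMatrix c x + coeffMatrix c y := by
      ext i j; simp [coeffMatrix]
    rw [e2, e1, hx, hy, Matrix.mul_add, Matrix.add_mul]

theorem tensorRank_eq {k : Type v} {X : Type w} [Field k] [AddCommGroup X] [Module k X]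
    [Module.Finite k X] {ι : Type*} [Fintype ι] (b : Module.Basis ι k X) (f : X ⊗[k] X) :
    tensorRank f = (coeffMatrix b f).rank := by
  apply le_antisymm
  · rw [tensorRank, coeffMatrix_change b]
    exact (Matrix.rank_mul_le_left _ _).trans (Matrix.rank_mul_le_right _ _)
  · rw [tensorRank, coeffMatrix_change (Module.finBasis k X) b]
    exact (Matrix.rank_mul_le_left _ _).trans (Matrix.rank_mul_le_right _ _)

section Quadratic

variable {k : Type v} {A : Type u} [Field k] [Ring A] [Algebra k A] (𝒜 : ℕ → Submodule k A)

/-- The canonical map `T(A_1) → A`. -/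
def canonicalMap : TensorAlgebra k (𝒜 1) →ₐ[k] A :=
  TensorAlgebra.lift k (𝒜 1).subtype

/-- `A = ⟨A_1 ∣ F⟩` for a set `F` of degree-two relations: the canonical map `T(A_1) → A` is
surjective and its kernel is the two-sided ideal generated by `F`. -/
def HasPresentation (F : Set (𝒜 1 ⊗[k] 𝒜 1)) : Prop :=
  Function.Surjective (canonicalMap 𝒜) ∧
    TwoSidedIdeal.ker (canonicalMap 𝒜) = TwoSidedIdeal.span (tensorSquare k (𝒜 1) '' F)

/-- `A` is *quadratic*: `T(A_1) → A` is surjective, with kernel generated by the elements of the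
kernel that lie in `A_1 ⊗ A_1`. -/
def IsQuadratic : Prop :=
  HasPresentation 𝒜 {f | canonicalMap 𝒜 (tensorSquare k (𝒜 1) f) = 0}

variable [GradedAlgebra 𝒜]

/-- The multiplication map `μ : A_1 ⊗ A_1 → A_2`. -/
def mulMap : 𝒜 1 ⊗[k] 𝒜 1 →ₗ[k] 𝒜 2 :=
  TensorProduct.lift <| LinearMap.mk₂ k
    (fun a b => (⟨(a : A) * b, SetLike.mul_mem_graded a.2 b.2⟩ : 𝒜 2))
    (fun a b c => Subtype.ext (add_mul (a : A) b c))
    (fun c a b => Subtype.ext (smul_mul_assoc c (a : A) (b : A)))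
    (fun a b c => Subtype.ext (mul_add (a : A) b c))
    (fun c a b => Subtype.ext (mul_smul_comm c (a : A) (b : A)))

/-- The image of `μ^∨ : A_2^∨ → (A_1 ⊗ A_1)^∨`, seen in `A_1^∨ ⊗ A_1^∨` through
`(φ ⊗ ψ)(x ⊗ y) = φ(x) ψ(y)`. -/
def dualRelations : Submodule k (Module.Dual k (𝒜 1) ⊗[k] Module.Dual k (𝒜 1)) :=
  (LinearMap.range (mulMap 𝒜).dualMap).comap (TensorProduct.dualDistrib k (𝒜 1) (𝒜 1))

/-- The quadratic dual `A^! = ⟨A_1^∨ ∣ im μ^∨⟩`. -/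
abbrev QuadraticDual : Type _ := QuadAlg (dualRelations 𝒜)

/-- The grading of `A^!`, with the generators `A_1^∨` in degree one. -/
abbrev quadraticDualGrading : ℕ → Submodule k (QuadraticDual 𝒜) :=
  QuadAlg.grading (dualRelations 𝒜)

end Quadratic

/-! ### Frobenius algebras -/

/-- `A` is *Frobenius*: it is finite-dimensional and, with `n = sup A`, there is an isomorphism
`φ : A_A ≅ D(A)(-n)` of graded right modules. As `A` is finite-dimensional, `D(A)` is the full dual
space, with right action `(g · b)(x) = g(b x)`; its part of degree `i` in the shifted grading
consists of the functionals that vanish on `A_j` for all `j ≠ n - i`. -/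
def IsFrobenius {k : Type v} {A : Type u} [Field k] [Ring A] [Algebra k A]
    (𝒜 : ℕ → Submodule k A) [GradedAlgebra 𝒜] : Prop :=
  Module.Finite k A ∧ ∃ n : ℕ, gradedSup 𝒜 = ((n : ℕ∞) : WithBot ℕ∞) ∧
    ∃ φ : A ≃ₗ[k] Module.Dual k A,
      (∀ a b x : A, φ (a * b) x = φ a (b * x)) ∧
      (∀ i j : ℕ, i + j ≠ n → ∀ a ∈ 𝒜 i, ∀ x ∈ 𝒜 j, φ a x = 0)

/-! ### Graded right modules and graded Ext -/

section Ext

variable {k : Type v} {A : Type u} [Field k] [Ring A] [Algebra k A]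

/-- `ℳ` makes the right `A`-module `M` a `ℤ`-graded right `A`-module. -/
structure IsGradedModule (𝒜 : ℕ → Submodule k A) {M : Type w} [AddCommGroup M] [Module Aᵐᵒᵖ M]
    (ℳ : ℤ → AddSubgroup M) : Prop where
  internal : DirectSum.IsInternal ℳ
  smul_mem : ∀ (i : ℕ) (j : ℤ), ∀ a ∈ 𝒜 i, ∀ m ∈ ℳ j, MulOpposite.op a • m ∈ ℳ (j + i)

/-- A resolution `⋯ → X 1 → X 0 → M → 0` of a graded right module `M` by graded projective right
modules, with maps of degree zero. (A graded module is projective in the category of graded modules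
exactly when it is projective as a module.) -/
structure GradedProjectiveResolution (𝒜 : ℕ → Submodule k A) {M : Type u} [AddCommGroup M]
    [Module Aᵐᵒᵖ M] (ℳ : ℤ → AddSubgroup M) where
  X : ℕ → Type u
  [addCommGroup : ∀ n, AddCommGroup (X n)]
  [module : ∀ n, Module Aᵐᵒᵖ (X n)]
  deg : ∀ n, ℤ → AddSubgroup (X n)
  isGradedModule : ∀ n, IsGradedModule 𝒜 (deg n)
  projective : ∀ n, Module.Projective Aᵐᵒᵖ (X n)
  d : ∀ n, X (n + 1) →ₗ[Aᵐᵒᵖ] X n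
  d_mem : ∀ n j, ∀ x ∈ deg (n + 1) j, d n x ∈ deg n j
  ε : X 0 →ₗ[Aᵐᵒᵖ] M
  ε_mem : ∀ j, ∀ x ∈ deg 0 j, ε x ∈ ℳ j
  ε_surjective : Function.Surjective ε
  exact_zero : Function.Exact (d 0) ε
  exact_succ : ∀ n, Function.Exact (d (n + 1)) (d n)

attribute [instance] GradedProjectiveResolution.addCommGroup GradedProjectiveResolution.module

variable {N : Type u} [AddCommGroup N] [Module Aᵐᵒᵖ N] [Module k N] [SMulCommClass Aᵐᵒᵖ k N]

/-- The `k`-space of `A`-linear morphisms `M → N` of degree `j`. -/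
def gradedHom {M : Type u} [AddCommGroup M] [Module Aᵐᵒᵖ M] (ℳ : ℤ → AddSubgroup M)
    (𝒩 : ℤ → Submodule k N) (j : ℤ) : Submodule k (M →ₗ[Aᵐᵒᵖ] N) where
  carrier := {φ | ∀ i, ∀ m ∈ ℳ i, φ m ∈ 𝒩 (i + j)}
  add_mem' hφ hψ i m hm := (𝒩 (i + j)).add_mem (hφ i m hm) (hψ i m hm)
  zero_mem' i _ _ := (𝒩 (i + j)).zero_mem
  smul_mem' c _ hφ i m hm := (𝒩 (i + j)).smul_mem c (hφ i m hm)

/-- Precomposition with an `A`-linear map. -/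
def precomp (k : Type v) {A : Type u} [Field k] [Ring A] [Algebra k A] {L M : Type u}
    (N : Type u) [AddCommGroup L] [Module Aᵐᵒᵖ L] [AddCommGroup M] [Module Aᵐᵒᵖ M]
    [AddCommGroup N] [Module Aᵐᵒᵖ N] [Module k N] [SMulCommClass Aᵐᵒᵖ k N]
    (d : L →ₗ[Aᵐᵒᵖ] M) : (M →ₗ[Aᵐᵒᵖ] N) →ₗ[k] (L →ₗ[Aᵐᵒᵖ] N) where
  toFun φ := φ ∘ₗ d
  map_add' _ _ := rfl
  map_smul' _ _ := rfl

namespace GradedProjectiveResolution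

variable {𝒜 : ℕ → Submodule k A} {M : Type u} [AddCommGroup M] [Module Aᵐᵒᵖ M]
  {ℳ : ℤ → AddSubgroup M} (P : GradedProjectiveResolution 𝒜 ℳ)

/-- The cocycles of cohomological degree `i` and internal degree `j` in `Hom(P, N)`. -/
def cocycles (𝒩 : ℤ → Submodule k N) (i : ℕ) (j : ℤ) : Submodule k (P.X i →ₗ[Aᵐᵒᵖ] N) :=
  gradedHom (P.deg i) 𝒩 j ⊓ LinearMap.ker (precomp k N (P.d i))

/-- The coboundaries of cohomological degree `i` and internal degree `j` in `Hom(P, N)`. -/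
def coboundaries (𝒩 : ℤ → Submodule k N) :
    (i : ℕ) → ℤ → Submodule k (P.X i →ₗ[Aᵐᵒᵖ] N)
  | 0, _ => ⊥
  | i + 1, j => (gradedHom (P.deg i) 𝒩 j).map (precomp k N (P.d i))

/-- `Ext^i(M, N)_j`, computed from the graded projective resolution `P` of `M`. -/
def ext (𝒩 : ℤ → Submodule k N) (i : ℕ) (j : ℤ) : Type u :=
  P.cocycles 𝒩 i j ⧸ (P.coboundaries 𝒩 i j).submoduleOf (P.cocycles 𝒩 i j)

instance (𝒩 : ℤ → Submodule k N) (i : ℕ) (j : ℤ) : AddCommGroup (P.ext 𝒩 i j) :=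
  inferInstanceAs (AddCommGroup
    (P.cocycles 𝒩 i j ⧸ (P.coboundaries 𝒩 i j).submoduleOf (P.cocycles 𝒩 i j)))

instance (𝒩 : ℤ → Submodule k N) (i : ℕ) (j : ℤ) : Module k (P.ext 𝒩 i j) :=
  inferInstanceAs (Module k
    (P.cocycles 𝒩 i j ⧸ (P.coboundaries 𝒩 i j).submoduleOf (P.cocycles 𝒩 i j)))

end GradedProjectiveResolution

end Ext

/-! ### Gorenstein algebras and global dimension -/

section Gorenstein

variable {k : Type v} {A : Type u} [Field k] [Ring A] [Algebra k A]
  (𝒜 : ℕ → Submodule k A)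

/-- The right module `A_A` as a `ℤ`-graded module: zero in negative degrees. -/
def intGrading : ℤ → Submodule k A
  | Int.ofNat n => 𝒜 n
  | Int.negSucc _ => ⊥

variable [GradedAlgebra 𝒜]

/-- `A_+`, the elements whose component of degree zero vanishes, as a right submodule of `A`. -/
def plusPart : Submodule Aᵐᵒᵖ A where
  carrier := {a | GradedRing.projZeroRingHom 𝒜 a = 0}
  add_mem' {a b} ha hb := by
    simp only [Set.mem_ofPred_eq] at ha hb ⊢
    rw [map_add, ha, hb, add_zero]
  zero_mem' := map_zero _
  smul_mem' b a ha := by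
    simp only [Set.mem_ofPred_eq] at ha ⊢
    rw [← MulOpposite.op_unop b, op_smul_eq_mul, map_mul, ha, zero_mul]

/-- The right module `k_A`, that is `A / A_+`. -/
abbrev residue : Type u := A ⧸ plusPart 𝒜

/-- The grading of `k_A`: everything is in degree zero. -/
def residueGrading (n : ℤ) : AddSubgroup (residue 𝒜) :=
  if n = 0 then ⊤ else ⊥


/-- `A` is *Gorenstein*: the bigraded `k`-space `Ext_A(k_A, A_A)`, computed from a graded projective
resolution of `k_A`, is one-dimensional. -/
def IsGorenstein : Prop :=
  ∃ P : GradedProjectiveResolution 𝒜 (residueGrading 𝒜),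
    Module.finrank k (⨁ p : ℕ × ℤ, P.ext (intGrading 𝒜) p.1 p.2) = 1

end Gorenstein

/-- The (right) global dimension of a ring: the supremum of the projective dimensions of its right
modules. -/
def globalDimension (A : Type u) [Ring A] : WithBot ℕ∞ :=
  ⨆ M : ModuleCat.{u} Aᵐᵒᵖ, CategoryTheory.projectiveDimension M

end

end GradedGor

namespace GradedGor

universe v u w

noncomputable section

/-! ### Presentations -/

/-! Conditions 1 and 2 are each compared with condition 3.

For 2 and 3: the relations of the quadratic dual are the annihilator of the relations of A. If A has
a single nonzero relation f, the degree-two part of the dual is a line, and f is the bilinear form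
that describes the product of two generators. Maximal rank is nondegeneracy of this form
(`tensorRank_eq_iff_forall`). In dimension at least two, associativity then kills degree three
(`mul_eq_zero_of_form`), and the coefficient of the top class is a Frobenius functional
(`exists_frobeniusForm`). Conversely, a Frobenius functional of degree two is evaluation at some f;
its nondegeneracy says that f spans the relations and has maximal rank
(`exists_relation_of_isFrobenius`). The representation `squareRep` on k × X × k guarantees that the
ideal of relations contains nothing unexpected in degrees one and two.

For 3 → 1: over an algebra S with quadratic relations every left module M has a standard complex S^σ
⊗ M → S^ι ⊗ M → S ⊗ M → M, exact except possibly at its left end, because of the universal property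
of the presentation (`exists_stdD₂_eq`). For one relation of maximal rank in at least two
generators, nonzero linear forms are not zero divisors (`eq_zero_of_mul_linear_eq_zero`), which
makes the left end exact too (`stdD₂_injective`). Transposing the coefficient matrix presents the
opposite algebra, so right modules are covered and the global dimension is at most two. The module k
has the resolution 0 → A(-2) → A(-1)^n → A, which is minimal, so two is attained. Its dual is, up to
the invertible coefficient matrix, the same kind of complex on the other side, so only Ext² in
internal degree -2 survives, and it is k.

For 1 → 3: in global dimension two the kernel of A^n → A is projective, and a graded Nakayama
argument shows that minimal relations are independent (`LinPres.linSyz`). Hence k has a linear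
resolution 0 → A(-2)^t → A(-1)^n → A. In degree -2 its Ext² is k^t, so t = 1; in degree -1 it is the
cokernel of the map k^n → A_1 given by the coefficients of the relation, so its vanishing makes the
coefficient matrix invertible (`exists_of_isGorenstein`). The comparison `exists_gradedHom_to_ext`
transports this to whichever resolution witnesses the Gorenstein property. -/

theorem tensorSquare_tmul {k : Type v} {X : Type w} [Field k] [AddCommGroup X] [Module k X]
    (a b : X) : tensorSquare k X (a ⊗ₜ b) = TensorAlgebra.ι k a * TensorAlgebra.ι k b := rfl

/-- A quotient map of (noncommutative) algebras satisfies the expected universal property. -/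
theorem exists_algHom_of_surjective {k T A B : Type*} [Field k] [Ring T] [Ring A] [Ring B]
    [Algebra k T] [Algebra k A] [Algebra k B] (p : T →ₐ[k] A) (hp : Function.Surjective p)
    (g : T →ₐ[k] B) (h : ∀ t, p t = 0 → g t = 0) : ∃ q : A →ₐ[k] B, ∀ t, q (p t) = g t := by
  let q₀ : A →+* B := RingHom.liftOfSurjective (p : T →+* A) hp ⟨(g : T →+* B), fun t ht => h t ht⟩
  have hq : ∀ t, q₀ (p t) = g t := fun t =>
    RingHom.liftOfRightInverse_comp_apply (p : T →+* A) _ _ ⟨(g : T →+* B), fun t ht => h t ht⟩ t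
  refine ⟨{ q₀ with commutes' := fun r => ?_ }, hq⟩
  have := hq (algebraMap k T r)
  rwa [AlgHom.commutes, AlgHom.commutes] at this

section Presentations

variable {k : Type v} {A : Type u} [Field k] [Ring A] [Algebra k A] {𝒜 : ℕ → Submodule k A}

theorem HasPresentation.apply_eq_zero {F : Set (𝒜 1 ⊗[k] 𝒜 1)} (hF : HasPresentation 𝒜 F)
    {f : 𝒜 1 ⊗[k] 𝒜 1} (hf : f ∈ F) : canonicalMap 𝒜 (tensorSquare k (𝒜 1) f) = 0 := by
  rw [← TwoSidedIdeal.mem_ker, hF.2]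
  exact TwoSidedIdeal.subset_span ⟨f, hf, rfl⟩

theorem HasPresentation.exists_lift {F : Set (𝒜 1 ⊗[k] 𝒜 1)} (hF : HasPresentation 𝒜 F)
    {B : Type*} [Ring B] [Algebra k B] (G : 𝒜 1 →ₗ[k] B)
    (hG : ∀ f ∈ F, TensorAlgebra.lift k G (tensorSquare k (𝒜 1) f) = 0) :
    ∃ h : A →ₐ[k] B, ∀ v : 𝒜 1, h v = G v := by
  obtain ⟨h, hh⟩ := exists_algHom_of_surjective (canonicalMap 𝒜) hF.1 (TensorAlgebra.lift k G)
    (fun t ht => by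
      have h1 : TwoSidedIdeal.span (tensorSquare k (𝒜 1) '' F)
          ≤ TwoSidedIdeal.ker (TensorAlgebra.lift k G) := by
        rw [TwoSidedIdeal.span_le]
        rintro _ ⟨f, hf, rfl⟩
        exact (TwoSidedIdeal.mem_ker _).2 (hG f hf)
      rw [← TwoSidedIdeal.mem_ker, hF.2] at ht
      exact (TwoSidedIdeal.mem_ker _).1 (h1 ht))
  refine ⟨h, fun v => ?_⟩
  have := hh (TensorAlgebra.ι k v)
  simpa [canonicalMap] using this

theorem HasPresentation.isQuadratic {F : Set (𝒜 1 ⊗[k] 𝒜 1)} (hF : HasPresentation 𝒜 F) :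
    IsQuadratic 𝒜 := by
  refine ⟨hF.1, le_antisymm ?_ ?_⟩
  · rw [hF.2]
    exact TwoSidedIdeal.span_mono (Set.image_mono fun f hf => hF.apply_eq_zero hf)
  · rw [TwoSidedIdeal.span_le]
    rintro _ ⟨f, hf, rfl⟩
    exact (TwoSidedIdeal.mem_ker _).2 hf

theorem IsQuadratic.hasPresentation (hA : IsQuadratic 𝒜) {F : Set (𝒜 1 ⊗[k] 𝒜 1)}
    (hF : ∀ f ∈ F, canonicalMap 𝒜 (tensorSquare k (𝒜 1) f) = 0)
    (hF' : ∀ f, canonicalMap 𝒜 (tensorSquare k (𝒜 1) f) = 0 → f ∈ Submodule.span k F) :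
    HasPresentation 𝒜 F := by
  refine ⟨hA.1, ?_⟩
  rw [hA.2]
  apply le_antisymm
  · rw [TwoSidedIdeal.span_le]
    rintro _ ⟨f, hf, rfl⟩
    have := hF' f hf
    clear hf
    induction this using Submodule.span_induction with
    | mem x hx => exact TwoSidedIdeal.subset_span ⟨x, hx, rfl⟩
    | zero => rw [map_zero]; exact TwoSidedIdeal.zero_mem _
    | add x y _ _ hx hy => rw [map_add]; exact TwoSidedIdeal.add_mem _ hx hy
    | smul c x _ hx =>
      rw [map_smul, Algebra.smul_def]
      exact TwoSidedIdeal.mul_mem_left _ _ _ hx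
  · exact TwoSidedIdeal.span_mono (Set.image_mono hF)

theorem canonicalMap_tensorSquare [GradedAlgebra 𝒜] (g : 𝒜 1 ⊗[k] 𝒜 1) :
    canonicalMap 𝒜 (tensorSquare k (𝒜 1) g) = (mulMap 𝒜 g : A) := by
  induction g using TensorProduct.induction_on with
  | zero => simp
  | tmul a b => simp [tensorSquare_tmul, canonicalMap, mulMap]
  | add a b ha hb => simp [ha, hb]

theorem canonicalMap_tensorSquare_eq_zero_iff [GradedAlgebra 𝒜] (g : 𝒜 1 ⊗[k] 𝒜 1) :
    canonicalMap 𝒜 (tensorSquare k (𝒜 1) g) = 0 ↔ mulMap 𝒜 g = 0 := by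
  rw [canonicalMap_tensorSquare, ZeroMemClass.coe_eq_zero]

end Presentations

/-! ### The representation attached to a bilinear form -/

section SquareRep

variable {k : Type v} {X : Type w} [Field k] [AddCommGroup X] [Module k X]
  (t : X ⊗[k] X →ₗ[k] k)

/-- The action of `X` on `k × X × k` given by `v (a, w, c) = (0, a v, t (v ⊗ w))`. -/
def squareAct : X →ₗ[k] Module.End k (k × X × k) :=
  LinearMap.mk₂ k (fun v p => (0, p.1 • v, t (v ⊗ₜ p.2.1)))
    (fun v v' p => by simp [TensorProduct.add_tmul])
    (fun c v p => by
      simp only [← TensorProduct.smul_tmul', map_smul, Prod.smul_mk, smul_zero, smul_comm c])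
    (fun v p q => by simp [TensorProduct.tmul_add, add_smul])
    (fun c v p => by simp [TensorProduct.tmul_smul, mul_smul])

theorem squareAct_apply (v : X) (p : k × X × k) :
    squareAct t v p = (0, p.1 • v, t (v ⊗ₜ p.2.1)) := rfl

/-- The representation of the tensor algebra extending `squareAct`. -/
def squareRep : TensorAlgebra k X →ₐ[k] Module.End k (k × X × k) :=
  TensorAlgebra.lift k (squareAct t)

theorem squareRep_ι (v : X) : squareRep t (TensorAlgebra.ι k v) = squareAct t v :=
  TensorAlgebra.lift_ι_apply _ _

/-- Quadratic elements act through `t` alone. So the representation descends to a quadratic algebra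
once `t` kills its relations, and the vector (1, 0, 0) recovers the value of `t`. -/
theorem squareRep_tensorSquare (g : X ⊗[k] X) (p : k × X × k) :
    squareRep t (tensorSquare k X g) p = (0, 0, t g * p.1) := by
  induction g using TensorProduct.induction_on with
  | zero => simp [Prod.zero_eq_mk]
  | tmul a b =>
    simp [tensorSquare_tmul, squareRep_ι, squareAct_apply, TensorProduct.tmul_smul, mul_comm]
  | add a b ha hb => simp [ha, hb, add_mul]

end SquareRep

/-- The two-sided ideal generated by f meets degree two only in the line of f. Otherwise a
functional separates g from that line, and the corresponding `squareRep` factors through A although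
it does not kill g. -/
theorem HasPresentation.mem_span_of_singleton {k : Type v} {A : Type u} [Field k] [Ring A]
    [Algebra k A] {𝒜 : ℕ → Submodule k A} {f : 𝒜 1 ⊗[k] 𝒜 1} (hf : HasPresentation 𝒜 {f})
    {g : 𝒜 1 ⊗[k] 𝒜 1} (hg : canonicalMap 𝒜 (tensorSquare k (𝒜 1) g) = 0) :
    g ∈ Submodule.span k {f} := by
  by_contra hn
  obtain ⟨t, ht, hle⟩ := Submodule.exists_le_ker_of_notMem (K := k)
    (V := 𝒜 1 ⊗[k] 𝒜 1) (p := Submodule.span k {f}) hn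
  obtain ⟨h, hh⟩ := hf.exists_lift (B := Module.End k (k × 𝒜 1 × k)) (squareAct t) (by
    intro f' hf'
    rw [Set.mem_singleton_iff.1 hf', ← squareRep]
    have h0 : t f = 0 := hle (Submodule.mem_span_singleton_self (R := k) f)
    refine LinearMap.ext fun p => ?_
    have h1 := squareRep_tensorSquare t f p
    rw [h0, zero_mul] at h1
    exact h1)
  have h2 : h.comp (canonicalMap 𝒜) = squareRep t := by
    ext v : 2
    simp [canonicalMap, hh, squareRep]
  have h3 := congrArg (fun q => q (tensorSquare k (𝒜 1) g) (1, 0, 0)) h2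
  simp only [AlgHom.comp_apply, hg, map_zero, squareRep_tensorSquare, mul_one,
    LinearMap.zero_apply] at h3
  exact ht (congrArg (fun q => q.2.2) h3).symm

/-! ### Rank and nondegeneracy -/

section Rank

variable {k : Type v} {X : Type w} [Field k] [AddCommGroup X] [Module k X]
  {ι : Type*}

theorem dualDistrib_coord (b : Module.Basis ι k X) (f : X ⊗[k] X) (i j : ι) :
    TensorProduct.dualDistrib k X X (b.coord i ⊗ₜ b.coord j) f = coeffMatrix b f i j := by
  induction f using TensorProduct.induction_on with
  | zero => simp [coeffMatrix]
  | tmul x y => simp [coeffMatrix, Module.Basis.tensorProduct_repr_tmul_apply, mul_comm]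
  | add x y hx hy =>
    rw [map_add, hx, hy]
    simp [coeffMatrix]

variable [Fintype ι]

theorem sum_coeffMatrix (b : Module.Basis ι k X) (f : X ⊗[k] X) :
    f = ∑ i, ∑ j, coeffMatrix b f i j • (b i ⊗ₜ[k] b j) := by
  conv_lhs => rw [← (b.tensorProduct b).sum_repr f]
  rw [Fintype.sum_prod_type]
  simp [coeffMatrix, Module.Basis.tensorProduct_apply]

theorem isUnit_of_rank_eq_card [DecidableEq ι] {L : Matrix ι ι k} (h : L.rank = Fintype.card ι) :
    IsUnit L := by
  rw [← Matrix.linearIndependent_rows_iff_isUnit, linearIndependent_iff_card_eq_finrank_span,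
    ← h, Matrix.rank_eq_finrank_span_row]
  rfl

theorem tensorRank_eq_iff_isUnit [DecidableEq ι] [Module.Finite k X] (b : Module.Basis ι k X)
    (f : X ⊗[k] X) : tensorRank f = Module.finrank k X ↔ IsUnit (coeffMatrix b f) := by
  rw [tensorRank_eq b, Module.finrank_eq_card_basis b]
  exact ⟨isUnit_of_rank_eq_card, fun h => Matrix.rank_of_isUnit _ h⟩

theorem dualDistrib_tmul_coord (b : Module.Basis ι k X) (f : X ⊗[k] X) (α : Module.Dual k X)
    (j : ι) : TensorProduct.dualDistrib k X X (α ⊗ₜ b.coord j) f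
      = Matrix.vecMul (fun i => α (b i)) (coeffMatrix b f) j := by
  have hα : α = ∑ i, α (b i) • b.coord i := by
    classical
    refine b.ext fun j => ?_
    simp
  conv_lhs => rw [hα]
  simp only [TensorProduct.sum_tmul, map_sum, LinearMap.sum_apply, ← TensorProduct.smul_tmul',
    map_smul, LinearMap.smul_apply, dualDistrib_coord, Matrix.vecMul, dotProduct, smul_eq_mul]

/-- An element has maximal rank exactly when the bilinear form it induces on the dual space is
nondegenerate. -/
theorem tensorRank_eq_iff_forall [Module.Finite k X] (f : X ⊗[k] X) :
    tensorRank f = Module.finrank k X ↔ ∀ α : Module.Dual k X,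
      (∀ γ : Module.Dual k X, TensorProduct.dualDistrib k X X (α ⊗ₜ γ) f = 0) → α = 0 := by
  classical
  let b := Module.finBasis k X
  rw [tensorRank_eq_iff_isUnit b, ← Matrix.vecMul_injective_iff_isUnit]
  constructor
  · intro h α hα
    have : (fun i => α (b i)) = 0 := h (by
      funext j
      refine (dualDistrib_tmul_coord b f α j).symm.trans ?_
      simp only [hα, Matrix.zero_vecMul, Pi.zero_apply])
    exact b.ext fun i => congrFun this i
  · intro h
    refine (injective_iff_map_eq_zero (Matrix.vecMulLinear (coeffMatrix b f))).2 fun a ha => ?_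
    -- A vector in the left kernel of the matrix is read as the values on the basis of a functional
    -- in the radical of the form.
    have h1 := h (b.constr k a) (fun γ => by
      have hγ : γ = ∑ j, γ (b j) • b.coord j := by
        refine b.ext fun j => ?_
        simp
      rw [hγ]
      simp only [TensorProduct.tmul_sum, map_sum, LinearMap.sum_apply, TensorProduct.tmul_smul,
        map_smul, LinearMap.smul_apply, dualDistrib_tmul_coord, Module.Basis.constr_basis]
      refine Finset.sum_eq_zero fun j _ => ?_
      have := congrFun ha j
      simp only [Matrix.vecMulLinear_apply, Pi.zero_apply] at this
      change _ • Matrix.vecMul a _ j = 0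
      rw [this, smul_zero])
    funext i
    have := congrArg (fun q => q (b i)) h1
    simpa using this

end Rank

/-! ### Algebras with quadratic relations -/

namespace QuadAlg

variable {k : Type v} {X : Type w} [Field k] [AddCommGroup X] [Module k X]
  {F : Submodule k (X ⊗[k] X)}

theorem mk_surjective : Function.Surjective (mk F) :=
  RingQuot.mkAlgHom_surjective k _

theorem mk_ι (x : X) : mk F (TensorAlgebra.ι k x) = gen F x := rfl

theorem mk_tensorSquare_of_mem {t : X ⊗[k] X} (ht : t ∈ F) : mk F (tensorSquare k X t) = 0 := by
  rw [← map_zero (mk F)]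
  exact RingQuot.mkAlgHom_rel k ⟨⟨t, ht, rfl⟩, rfl⟩

theorem exists_lift {B : Type*} [Semiring B] [Algebra k B] (g : TensorAlgebra k X →ₐ[k] B)
    (hg : ∀ t ∈ F, g (tensorSquare k X t) = 0) :
    ∃ h : QuadAlg F →ₐ[k] B, ∀ t, h (mk F t) = g t :=
  ⟨RingQuot.liftAlgHom k ⟨g, by
    rintro a b ⟨⟨t, ht, rfl⟩, rfl⟩
    rw [hg t ht, map_zero]⟩, fun _ => RingQuot.liftAlgHom_mkAlgHom_apply _ _ _ _⟩

theorem exists_mk_tensorSquare {a : QuadAlg F} (ha : a ∈ grading F 2) :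
    ∃ t, mk F (tensorSquare k X t) = a := by
  rw [grading, pow_two] at ha
  refine Submodule.mul_induction_on ha ?_ ?_
  · rintro _ ⟨x, rfl⟩ _ ⟨y, rfl⟩
    exact ⟨x ⊗ₜ y, by rw [tensorSquare_tmul, map_mul, mk_ι, mk_ι]⟩
  · rintro _ _ ⟨s, rfl⟩ ⟨t, rfl⟩
    exact ⟨s + t, by rw [map_add, map_add]⟩

theorem grading_eq_bot_of_le {m n : ℕ} (h : m ≤ n) (hm : grading F m = ⊥) :
    grading F n = ⊥ := by
  obtain ⟨j, rfl⟩ := Nat.exists_eq_add_of_le h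
  change LinearMap.range (gen F) ^ (m + j) = ⊥
  rw [pow_add, ← grading, hm, Submodule.bot_mul]

theorem mk_tensorSquare_mem (t : X ⊗[k] X) : mk F (tensorSquare k X t) ∈ grading F 2 := by
  rw [grading, pow_two]
  induction t using TensorProduct.induction_on with
  | zero => simp
  | tmul a b =>
    rw [tensorSquare_tmul, map_mul]
    exact Submodule.mul_mem_mul ⟨a, rfl⟩ ⟨b, rfl⟩
  | add a b ha hb =>
    rw [map_add, map_add]
    exact Submodule.add_mem _ ha hb

theorem grading_three_eq_bot (h : ∀ x, ∀ a ∈ grading F 2, gen F x * a = 0) :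
    grading F 3 = ⊥ := by
  rw [eq_bot_iff]
  change LinearMap.range (gen F) ^ (2 + 1) ≤ ⊥
  rw [pow_succ']
  refine Submodule.mul_le.2 ?_
  rintro _ ⟨α, rfl⟩ y hy
  exact h α y hy

theorem exists_algebraMap_of_mem {a : QuadAlg F} (ha : a ∈ grading F 0) :
    ∃ c, algebraMap k _ c = a := by
  rw [grading, pow_zero] at ha
  exact Submodule.mem_one.1 ha

theorem exists_gen_of_mem {a : QuadAlg F} (ha : a ∈ grading F 1) : ∃ x, gen F x = a := by
  rw [grading, pow_one] at ha
  exact ha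

theorem gen_mem (x : X) : gen F x ∈ grading F 1 := by
  rw [grading, pow_one]
  exact LinearMap.mem_range_self _ x

/-- A subspace that contains `1` and is stable under left multiplication by generators is
everything. -/
theorem eq_top_of_mul_mem {N : Submodule k (QuadAlg F)} (h1 : 1 ∈ N)
    (hN : ∀ x, ∀ a ∈ N, gen F x * a ∈ N) : N = ⊤ := by
  have key : ∀ t : TensorAlgebra k X, ∀ a ∈ N, mk F t * a ∈ N := by
    intro t
    induction t using TensorAlgebra.induction with
    | algebraMap r =>
      intro a ha
      rw [AlgHom.commutes, ← Algebra.smul_def]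
      exact N.smul_mem r ha
    | ι x => exact fun a ha => hN x a ha
    | mul s t hs ht =>
      intro a ha
      rw [map_mul, mul_assoc]
      exact hs _ (ht _ ha)
    | add s t hs ht =>
      intro a ha
      rw [map_add, add_mul]
      exact N.add_mem (hs _ ha) (ht _ ha)
  refine eq_top_iff.2 fun a _ => ?_
  obtain ⟨t, rfl⟩ := mk_surjective a
  simpa using key t 1 h1

end QuadAlg

/-! ### Degrees and the supremum of a grading -/

section GradedSup

variable {k : Type v} {A : Type u} [Field k] [AddCommGroup A] [Module k A]
  {𝒜 : ℕ → Submodule k A}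

theorem gradedSup_eq_natCast {n : ℕ} (hn : 𝒜 n ≠ ⊥) (h : ∀ m, n < m → 𝒜 m = ⊥) :
    gradedSup 𝒜 = ((n : ℕ∞) : WithBot ℕ∞) := by
  refine IsGreatest.csSup_eq ⟨⟨n, hn, rfl⟩, ?_⟩
  rintro _ ⟨m, hm, rfl⟩
  have : m ≤ n := by
    by_contra hlt
    exact hm (h m (not_le.1 hlt))
  exact WithBot.coe_le_coe.2 (Nat.cast_le.2 this)

theorem eq_bot_of_gradedSup_lt {n : ℕ} (hn : gradedSup 𝒜 < ((n : ℕ∞) : WithBot ℕ∞)) :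
    𝒜 n = ⊥ := by
  by_contra h
  have h' : ((n : ℕ∞) : WithBot ℕ∞) ≤ gradedSup 𝒜 := le_sSup ⟨n, h, rfl⟩
  exact absurd h' (not_le.2 hn)

theorem ne_bot_of_gradedSup_eq {n : ℕ} (hn : gradedSup 𝒜 = ((n : ℕ∞) : WithBot ℕ∞)) :
    𝒜 n ≠ ⊥ := by
  intro h
  rcases Nat.eq_zero_or_pos n with rfl | hpos
  · have : gradedSup 𝒜 ≤ ⊥ := by
      refine sSup_le ?_
      rintro _ ⟨m, hm, rfl⟩
      rcases Nat.eq_zero_or_pos m with rfl | hm'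
      · exact absurd h hm
      · exact absurd (eq_bot_of_gradedSup_lt (n := m) (by rw [hn]; exact_mod_cast hm')) hm
    rw [hn] at this
    simp at this
  · have : gradedSup 𝒜 ≤ (((n - 1 : ℕ) : ℕ∞) : WithBot ℕ∞) := by
      refine sSup_le ?_
      rintro _ ⟨m, hm, rfl⟩
      have h1 : m ≤ n := by
        by_contra hlt
        exact hm (eq_bot_of_gradedSup_lt (n := m)
          (by rw [hn]; exact_mod_cast (not_le.1 hlt)))
      have h2 : m ≠ n := by
        rintro rfl
        exact hm h
      exact WithBot.coe_le_coe.2 (Nat.cast_le.2 (show m ≤ n - 1 by omega))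
    rw [hn] at this
    have : n ≤ n - 1 := by exact_mod_cast this
    omega

end GradedSup

/-- Over a field the image of a transpose is the annihilator of the kernel. This is how the
relations of the quadratic dual are recognised throughout. -/
theorem mem_range_dualMap_iff {k X W : Type*} [Field k] [AddCommGroup X] [Module k X]
    [AddCommGroup W] [Module k W] (μ : X ⊗[k] X →ₗ[k] W) (ψ : Module.Dual k (X ⊗[k] X)) :
    ψ ∈ LinearMap.range μ.dualMap ↔ ∀ g, μ g = 0 → ψ g = 0 := by
  have h := LinearMap.range_dualMap_eq_dualAnnihilator_ker μ
  rw [h, Submodule.mem_dualAnnihilator]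
  rfl

/-! ### Relations of the quadratic dual as an annihilator -/

section Dual

variable {k : Type v} {A : Type u} [Field k] [Ring A] [Algebra k A] {𝒜 : ℕ → Submodule k A}
  [GradedAlgebra 𝒜]

theorem mem_dualRelations_iff (t : Module.Dual k (𝒜 1) ⊗[k] Module.Dual k (𝒜 1)) :
    t ∈ dualRelations 𝒜 ↔
      ∀ g, mulMap 𝒜 g = 0 → TensorProduct.dualDistrib k (𝒜 1) (𝒜 1) t g = 0 := by
  rw [dualRelations, Submodule.mem_comap]
  exact mem_range_dualMap_iff (mulMap 𝒜) (TensorProduct.dualDistrib k (𝒜 1) (𝒜 1) t)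

/-- Evaluation at an element of `A_1 ⊗ A_1`, as a functional on `A_1^∨ ⊗ A_1^∨`. -/
def evalAt {X : Type w} [AddCommGroup X] [Module k X] (f : X ⊗[k] X) :
    Module.Dual k X ⊗[k] Module.Dual k X →ₗ[k] k :=
  (LinearMap.applyₗ f) ∘ₗ TensorProduct.dualDistrib k X X

theorem evalAt_apply {X : Type w} [AddCommGroup X] [Module k X] (f : X ⊗[k] X)
    (t : Module.Dual k X ⊗[k] Module.Dual k X) :
    evalAt f t = TensorProduct.dualDistrib k X X t f := rfl

/-- A quadratic relation of `A` gives a representation of the quadratic dual. -/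
theorem exists_dualRep {f : 𝒜 1 ⊗[k] 𝒜 1} (hf : mulMap 𝒜 f = 0) :
    ∃ ρ : QuadraticDual 𝒜 →ₐ[k] Module.End k (k × Module.Dual k (𝒜 1) × k),
      ∀ t, ρ (QuadAlg.mk _ t) = squareRep (evalAt f) t :=
  QuadAlg.exists_lift (squareRep (evalAt f)) fun t ht => by
    refine LinearMap.ext fun p => ?_
    rw [squareRep_tensorSquare, evalAt_apply, (mem_dualRelations_iff t).1 ht f hf, zero_mul]
    rfl

/-- The bilinear form on generators of the quadratic dual determines a functional that detects
relations. -/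
theorem evalAt_eq_zero_of_mk_eq_zero {f : 𝒜 1 ⊗[k] 𝒜 1} (hf : mulMap 𝒜 f = 0)
    {t : Module.Dual k (𝒜 1) ⊗[k] Module.Dual k (𝒜 1)}
    (ht : QuadAlg.mk (dualRelations 𝒜) (tensorSquare k _ t) = 0) : evalAt f t = 0 := by
  obtain ⟨ρ, hρ⟩ := exists_dualRep hf
  have h := hρ (tensorSquare k _ t)
  rw [ht, map_zero] at h
  have h' := congrArg (fun q => q (1, 0, 0)) h
  simp only [squareRep_tensorSquare, mul_one, LinearMap.zero_apply] at h'
  exact (congrArg (fun q => q.2.2) h').symm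

end Dual

/-! ### One relation of maximal rank: the quadratic dual is Frobenius -/

section DualFrobenius

variable {k : Type v} {A : Type u} [Field k] [Ring A] [Algebra k A] {𝒜 : ℕ → Submodule k A}
  [GradedAlgebra 𝒜] {f : 𝒜 1 ⊗[k] 𝒜 1}

/-- The difference of the two sides comes from a tensor that pairs to zero with f, hence with every
relation of A; such a tensor is a relation of the dual. -/
theorem mk_tensorSquare_eq_smul (hker : ∀ g, mulMap 𝒜 g = 0 → g ∈ Submodule.span k {f})
    {t₀ : Module.Dual k (𝒜 1) ⊗[k] Module.Dual k (𝒜 1)} (ht₀ : evalAt f t₀ = 1)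
    (t : Module.Dual k (𝒜 1) ⊗[k] Module.Dual k (𝒜 1)) :
    QuadAlg.mk (dualRelations 𝒜) (tensorSquare k _ t)
      = evalAt f t • QuadAlg.mk (dualRelations 𝒜) (tensorSquare k _ t₀) := by
  rw [← sub_eq_zero, ← map_smul, ← map_smul, ← map_sub, ← map_sub]
  apply QuadAlg.mk_tensorSquare_of_mem
  rw [mem_dualRelations_iff]
  intro g hg
  obtain ⟨c, rfl⟩ := Submodule.mem_span_singleton.1 (hker g hg)
  rw [map_smul, ← evalAt_apply, map_sub, map_smul, ht₀, smul_eq_mul, smul_eq_mul, mul_one, sub_self,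
    mul_zero]

theorem exists_ne_zero_apply_eq_zero {V : Type*} [AddCommGroup V] [Module k V] [Module.Finite k V]
    (h2 : 2 ≤ Module.finrank k V) (φ : V →ₗ[k] k) : ∃ v, v ≠ 0 ∧ φ v = 0 := by
  have h : LinearMap.ker φ ≠ ⊥ :=
    LinearMap.ker_ne_bot_of_finrank_lt (by rw [Module.finrank_self]; omega)
  obtain ⟨v, hv, hv0⟩ := Submodule.exists_mem_ne_zero_of_ne_bot h
  exact ⟨v, hv0, hv⟩

/-- The algebra is spanned by 1, the generators and ω, and `ρ` shows that the coordinates are well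
defined. In these coordinates the form τ(ax) pairs 1 with ω and the generators among themselves by
`b`, so it is nondegenerate because `b` is; a dimension count turns injectivity into an isomorphism.
-/
theorem exists_frobeniusForm {k Q Y : Type*} [Field k] [Ring Q] [Algebra k Q] [AddCommGroup Y]
    [Module k Y] [Module.Finite k Y] (b : Y ⊗[k] Y →ₗ[k] k) (g : Y →ₗ[k] Q) (ω : Q)
    (hmul : ∀ α γ, g α * g γ = b (α ⊗ₜ γ) • ω) (hgω : ∀ α, g α * ω = 0)
    (htop : ∀ N : Submodule k Q, 1 ∈ N → (∀ x, ∀ a ∈ N, g x * a ∈ N) → N = ⊤)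
    (ρ : Q →ₐ[k] Module.End k (k × Y × k)) (hρg : ∀ α, ρ (g α) = squareAct b α)
    (hρω : ∀ p, ρ ω p = (0, 0, p.1)) (hnd : ∀ α, (∀ γ, b (α ⊗ₜ γ) = 0) → α = 0) :
    Module.Finite k Q ∧ ∃ τ : Q →ₗ[k] k, τ ω = 1 ∧ τ 1 = 0 ∧ (∀ α, τ (g α) = 0) ∧
      ∃ φ : Q ≃ₗ[k] Module.Dual k Q, ∀ a x, φ a x = τ (a * x) := by
  obtain ⟨Ψ, hΨ⟩ : ∃ Ψ : k × Y × k →ₗ[k] Q, ∀ c α d,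
      Ψ (c, α, d) = algebraMap k _ c + (g α + d • ω) :=
    ⟨LinearMap.coprod (Algebra.linearMap k _)
      (LinearMap.coprod g (LinearMap.toSpanSingleton k _ ω)), fun _ _ _ => rfl⟩
  have hρΨ : ∀ p q, ρ (Ψ p) q
      = (p.1 * q.1, p.1 • q.2.1 + q.1 • p.2.1,
        p.1 * q.2.2 + b (p.2.1 ⊗ₜ q.2.1) + p.2.2 * q.1) := by
    rintro ⟨c, α, d⟩ q
    rw [hΨ, map_add, map_add, map_smul, AlgHom.commutes, hρg]
    simp only [LinearMap.add_apply, Module.algebraMap_end_apply, LinearMap.smul_apply,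
      squareAct_apply, hρω]
    ext <;> simp [add_assoc]
  -- The coefficient of ω, read off as the last coordinate of the action on (1, 0, 0).
  obtain ⟨τ, hτ⟩ : ∃ τ : Q →ₗ[k] k, ∀ a, τ a = (ρ a (1, 0, 0)).2.2 :=
    ⟨(LinearMap.snd k _ _ ∘ₗ LinearMap.snd k _ _) ∘ₗ
      LinearMap.applyₗ ((1 : k), (0 : Y), (0 : k)) ∘ₗ ρ.toLinearMap, fun _ => rfl⟩
  have hΨsurj : Function.Surjective Ψ := by
    rw [← LinearMap.range_eq_top]
    apply htop
    · exact ⟨(1, 0, 0), by rw [hΨ, map_one, map_zero, zero_smul, add_zero, add_zero]⟩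
    · rintro α _ ⟨⟨c, γ, d⟩, rfl⟩
      refine ⟨(0, c • α, b (α ⊗ₜ γ)), ?_⟩
      rw [hΨ, hΨ, mul_add, mul_add, hmul, mul_smul_comm, hgω, smul_zero, add_zero, map_zero,
        zero_add, map_smul, ← Algebra.commutes, ← Algebra.smul_def]
  have hfin : Module.Finite k Q := Module.Finite.of_surjective Ψ hΨsurj
  refine ⟨hfin, τ, by simp [hτ, hρω], by simp [hτ], fun α => by simp [hτ, hρg, squareAct_apply], ?_⟩
  let φ : Q →ₗ[k] Module.Dual k Q := (LinearMap.mul k Q).compr₂ τ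
  have hφ : ∀ a x, φ a x = τ (a * x) := fun a x => rfl
  have hinj : Function.Injective φ := by
    refine (injective_iff_map_eq_zero φ).2 fun a ha => ?_
    obtain ⟨p, rfl⟩ := hΨsurj a
    have key : ∀ q : k × Y × k, p.1 * q.2.2 + b (p.2.1 ⊗ₜ q.2.1) + p.2.2 * q.1 = 0 := by
      intro q
      have h := congrArg (fun g => g (Ψ q)) ha
      simp only [hφ, LinearMap.zero_apply] at h
      rw [hτ, map_mul, Module.End.mul_apply, hρΨ, hρΨ] at h
      simpa using h
    -- Testing against ω, against 1 and against the generators isolates the three coordinates.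
    have h1 : p.1 = 0 := by simpa using key (0, 0, 1)
    have h3 : p.2.2 = 0 := by simpa using key (1, 0, 0)
    have h4 : p.2.1 = 0 := hnd _ fun γ => by simpa [h1] using key (0, γ, 0)
    have : p = 0 := Prod.ext h1 (Prod.ext h4 h3)
    rw [this, map_zero]
  exact ⟨LinearEquiv.ofInjectiveOfFinrankEq φ hinj (Subspace.dual_finrank_eq).symm, hφ⟩

/-- In dimension at least two some γ ≠ 0 satisfies b(α, γ) = 0, and nondegeneracy gives δ with b(γ,
δ) ≠ 0. Then 0 = (αγ)δ = α(γδ) = b(γ, δ) αω. In dimension one this fails, as k[X] shows. -/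
theorem mul_eq_zero_of_form {k Q Y : Type*} [Field k] [Ring Q] [Algebra k Q] [AddCommGroup Y]
    [Module k Y] [Module.Finite k Y] (h2 : 2 ≤ Module.finrank k Y) (b : Y ⊗[k] Y →ₗ[k] k)
    (g : Y →ₗ[k] Q) (ω : Q) (hmul : ∀ α γ, g α * g γ = b (α ⊗ₜ γ) • ω)
    (hnd : ∀ α, (∀ γ, b (α ⊗ₜ γ) = 0) → α = 0) (α : Y) : g α * ω = 0 := by
  obtain ⟨γ, hγ, hαγ⟩ := exists_ne_zero_apply_eq_zero h2 (b ∘ₗ TensorProduct.mk k _ _ α)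
  obtain ⟨δ, hδ⟩ : ∃ δ, b (γ ⊗ₜ δ) ≠ 0 := by
    by_contra! h
    exact hγ (hnd γ h)
  have h := mul_assoc (g α) (g γ) (g δ)
  have hαγ' : b (α ⊗ₜ γ) = 0 := hαγ
  rw [hmul, hmul, hαγ', zero_smul, zero_mul, mul_smul_comm] at h
  exact (smul_eq_zero.1 h.symm).resolve_left hδ

theorem isFrobenius_quadraticDual [Module.Finite k (𝒜 1)] (hf : mulMap 𝒜 f = 0)
    (hker : ∀ g, mulMap 𝒜 g = 0 → g ∈ Submodule.span k {f})
    (hrank : tensorRank f = Module.finrank k (𝒜 1)) (h2 : 2 ≤ Module.finrank k (𝒜 1)) :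
    IsFrobenius (quadraticDualGrading 𝒜) ∧ gradedSup (quadraticDualGrading 𝒜) = 2 := by
  have hnd : ∀ α : Module.Dual k (𝒜 1), (∀ γ, evalAt f (α ⊗ₜ γ) = 0) → α = 0 :=
    (tensorRank_eq_iff_forall f).1 hrank
  have h2' : 2 ≤ Module.finrank k (Module.Dual k (𝒜 1)) := by
    rwa [Subspace.dual_finrank_eq]
  -- A tensor normalised against f; its class ω spans the degree-two part of the dual.
  obtain ⟨t₀, ht₀⟩ : ∃ t₀, evalAt f t₀ = 1 := by
    obtain ⟨α, hα, -⟩ := exists_ne_zero_apply_eq_zero h2' 0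
    obtain ⟨γ, hγ⟩ : ∃ γ, evalAt f (α ⊗ₜ γ) ≠ 0 := by
      by_contra! h
      exact hα (hnd α h)
    exact ⟨(evalAt f (α ⊗ₜ γ))⁻¹ • (α ⊗ₜ γ), by rw [map_smul, smul_eq_mul, inv_mul_cancel₀ hγ]⟩
  obtain ⟨ω, hω⟩ : ∃ ω, ω = QuadAlg.mk (dualRelations 𝒜) (tensorSquare k _ t₀) := ⟨_, rfl⟩
  have hmk : ∀ t, QuadAlg.mk (dualRelations 𝒜) (tensorSquare k _ t) = evalAt f t • ω := by
    intro t
    rw [hω]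
    exact mk_tensorSquare_eq_smul hker ht₀ t
  have hmul : ∀ α γ, QuadAlg.gen (dualRelations 𝒜) α * QuadAlg.gen (dualRelations 𝒜) γ
      = evalAt f (α ⊗ₜ γ) • ω := by
    intro α γ
    rw [← hmk, tensorSquare_tmul, map_mul]
    rfl
  have hgω : ∀ α, QuadAlg.gen (dualRelations 𝒜) α * ω = 0 :=
    mul_eq_zero_of_form h2' (evalAt f) (QuadAlg.gen (dualRelations 𝒜)) ω hmul hnd
  obtain ⟨ρ, hρ⟩ := exists_dualRep hf
  obtain ⟨hfin, τ, hτω, hτ1, hτg, φ, hφ⟩ := exists_frobeniusForm (evalAt f)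
    (QuadAlg.gen (dualRelations 𝒜)) ω hmul hgω (fun N h h' => QuadAlg.eq_top_of_mul_mem h h') ρ
    (fun α => by rw [← squareRep_ι, ← hρ, QuadAlg.mk_ι])
    (fun p => by rw [hω, hρ, squareRep_tensorSquare, ht₀, one_mul]) hnd
  have hdeg : ∀ m, 2 < m → quadraticDualGrading 𝒜 m = ⊥ := by
    intro m hm
    refine QuadAlg.grading_eq_bot_of_le (m := 3) hm (QuadAlg.grading_three_eq_bot ?_)
    intro α y hy
    obtain ⟨t, rfl⟩ := QuadAlg.exists_mk_tensorSquare hy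
    rw [hmk, mul_smul_comm, hgω, smul_zero]
  have hsup : gradedSup (quadraticDualGrading 𝒜) = ((2 : ℕ) : ℕ∞) := by
    refine gradedSup_eq_natCast ?_ hdeg
    intro h0
    have hmem : ω ∈ quadraticDualGrading 𝒜 2 := by
      rw [hω]
      exact QuadAlg.mk_tensorSquare_mem t₀
    rw [h0, Submodule.mem_bot] at hmem
    rw [hmem, map_zero] at hτω
    exact zero_ne_one hτω
  have hτdeg : ∀ m ≠ 2, ∀ a ∈ quadraticDualGrading 𝒜 m, τ a = 0 := by
    intro m hm a ha
    obtain rfl | rfl | h : m = 0 ∨ m = 1 ∨ 2 < m := by omega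
    · obtain ⟨c, rfl⟩ := QuadAlg.exists_algebraMap_of_mem ha
      rw [Algebra.algebraMap_eq_smul_one, map_smul, hτ1, smul_zero]
    · obtain ⟨α, rfl⟩ := QuadAlg.exists_gen_of_mem ha
      exact hτg α
    · rw [hdeg m h, Submodule.mem_bot] at ha
      rw [ha, map_zero]
  refine ⟨⟨hfin, 2, hsup, φ, ?_, ?_⟩, hsup⟩
  · intro a b x
    rw [hφ, hφ, mul_assoc]
  · intro i j hij a ha x hx
    rw [hφ]
    exact hτdeg (i + j) hij (a * x) (SetLike.mul_mem_graded ha hx)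

end DualFrobenius

/-! ### Frobenius quadratic duals come from one relation of maximal rank -/

section Evaluation

variable {k X W : Type*} [Field k] [AddCommGroup X] [Module k X] [Module.Finite k X]
  [AddCommGroup W] [Module k W]

/-- Reflexivity of the finite-dimensional space X ⊗ X, transported along the identification of its
dual with the tensor square of the dual. -/
theorem exists_evalAt_eq (l : Module.Dual k X ⊗[k] Module.Dual k X →ₗ[k] k) :
    ∃ f : X ⊗[k] X, ∀ t, evalAt f t = l t := by
  let e := TensorProduct.dualDistribEquiv k X X
  obtain ⟨f, hf⟩ := (Module.evalEquiv k (X ⊗[k] X)).surjective (l ∘ₗ e.symm.toLinearMap)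
  refine ⟨f, fun t => ?_⟩
  have h := congrArg (fun q => q (e t)) hf
  simp only [LinearMap.comp_apply, LinearEquiv.coe_coe, LinearEquiv.symm_apply_apply] at h
  exact h

/-- The double annihilator of a subspace is the subspace itself. -/
theorem mem_of_forall_evalAt {N : Submodule k (X ⊗[k] X)} {f : X ⊗[k] X}
    (h : ∀ t, (∀ g ∈ N, evalAt g t = 0) → evalAt f t = 0) : f ∈ N := by
  by_contra hn
  obtain ⟨ψ, hψ, hle⟩ := Submodule.exists_le_ker_of_notMem hn
  obtain ⟨t, rfl⟩ := (TensorProduct.dualDistribEquiv k X X).surjective ψ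
  exact hψ (h t fun g hg => hle hg)

end Evaluation

section FrobeniusDual

variable {k : Type v} {A : Type u} [Field k] [Ring A] [Algebra k A] {𝒜 : ℕ → Submodule k A}
  [GradedAlgebra 𝒜]

theorem gen_injective {f : 𝒜 1 ⊗[k] 𝒜 1} (hf : mulMap 𝒜 f = 0) :
    Function.Injective (QuadAlg.gen (dualRelations 𝒜)) := by
  refine (injective_iff_map_eq_zero _).2 fun α hα => ?_
  obtain ⟨ρ, hρ⟩ := exists_dualRep hf
  have h := hρ (TensorAlgebra.ι k α)
  rw [QuadAlg.mk_ι, hα, map_zero, squareRep_ι] at h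
  have h' := congrArg (fun q => q (1, 0, 0)) h
  simp only [squareAct_apply, one_smul, LinearMap.zero_apply] at h'
  exact (congrArg (fun q => q.2.1) h').symm

/-- The form pairs degree i with degree n - i only, so orthogonality to that component is
orthogonality to the whole algebra. -/
theorem eq_zero_of_form {Q : Type*} [Ring Q] [Algebra k Q] (𝒬 : ℕ → Submodule k Q)
    [GradedAlgebra 𝒬] {n i j : ℕ} (hij : i + j = n) (φ : Q ≃ₗ[k] Module.Dual k Q)
    (hφ : ∀ i j : ℕ, i + j ≠ n → ∀ a ∈ 𝒬 i, ∀ x ∈ 𝒬 j, φ a x = 0) {a : Q} (ha : a ∈ 𝒬 i)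
    (h : ∀ x ∈ 𝒬 j, φ a x = 0) : a = 0 := by
  apply φ.injective
  rw [map_zero]
  refine LinearMap.ext fun x => ?_
  induction x using DirectSum.Decomposition.inductionOn 𝒬 with
  | zero => simp
  | @homogeneous m x =>
    by_cases hm : m = j
    · subst hm
      exact h x x.2
    · exact hφ i m (by omega) a ha x x.2
  | add x y hx hy => rw [map_add, hx, hy, LinearMap.zero_apply, LinearMap.zero_apply,
      LinearMap.zero_apply, add_zero]

/-- If A_1 is spanned by e, a nonzero relation makes e ⊗ e a relation. Sending α to α(e)X then maps
the quadratic dual to k[X] and hits X, so a cube of a generator survives in degree three. -/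
theorem two_le_finrank_of_grading_three_eq_bot [Module.Finite k (𝒜 1)] {f : 𝒜 1 ⊗[k] 𝒜 1}
    (hf : mulMap 𝒜 f = 0) (hf0 : f ≠ 0) (h3 : quadraticDualGrading 𝒜 3 = ⊥) :
    2 ≤ Module.finrank k (𝒜 1) := by
  by_contra! hlt
  have h1 : Module.finrank k (𝒜 1) = 1 := by
    by_contra h1
    have h0 : Module.finrank k (𝒜 1) = 0 := by omega
    refine hf0 ?_
    have hs' : Subsingleton (𝒜 1 ⊗[k] 𝒜 1) :=
      Module.finrank_zero_iff (R := k).1 (by rw [Module.finrank_tensorProduct, h0])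
    exact Subsingleton.elim _ _
  obtain ⟨e, he⟩ := Module.finrank_pos_iff_exists_ne_zero.1 (by omega : 0 < Module.finrank k (𝒜 1))
  have hee : mulMap 𝒜 (e ⊗ₜ e) = 0 := by
    have h11 : Module.finrank k (𝒜 1 ⊗[k] 𝒜 1) = 1 := by
      rw [Module.finrank_tensorProduct, h1]
    obtain ⟨c, hc⟩ := (finrank_eq_one_iff_of_nonzero' f hf0).1 h11 (e ⊗ₜ e)
    rw [← hc, map_smul, hf, smul_zero]
  let G : Module.Dual k (𝒜 1) →ₗ[k] Polynomial k :=
    (LinearMap.toSpanSingleton k (Polynomial k) Polynomial.X) ∘ₗ LinearMap.applyₗ e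
  have hG : ∀ α, G α = α e • Polynomial.X := fun _ => rfl
  have hGt : ∀ t, TensorAlgebra.lift k G (tensorSquare k _ t)
      = evalAt (e ⊗ₜ e) t • (Polynomial.X * Polynomial.X : Polynomial k) := by
    intro t
    induction t using TensorProduct.induction_on with
    | zero => simp
    | tmul a b =>
      rw [tensorSquare_tmul, map_mul, TensorAlgebra.lift_ι_apply, TensorAlgebra.lift_ι_apply, hG,
        hG, evalAt_apply, TensorProduct.dualDistrib_apply, smul_mul_smul_comm]
    | add a b ha hb => rw [map_add, map_add, ha, hb, map_add, add_smul]
  obtain ⟨h, hh⟩ := QuadAlg.exists_lift (F := dualRelations 𝒜) (TensorAlgebra.lift k G)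
    (fun t ht => by
      rw [hGt, evalAt_apply, (mem_dualRelations_iff t).1 ht _ hee, zero_smul])
  obtain ⟨α, hα⟩ := Module.Projective.exists_dual_eq_one k he
  have hmem : QuadAlg.gen (dualRelations 𝒜) α ^ 3 ∈ quadraticDualGrading 𝒜 3 :=
    Submodule.pow_mem_pow _ (LinearMap.mem_range_self _ α) 3
  rw [h3, Submodule.mem_bot] at hmem
  have h' := congrArg h hmem
  rw [map_pow, map_zero, ← QuadAlg.mk_ι, hh, TensorAlgebra.lift_ι_apply, hG, hα, one_smul] at h'
  exact pow_ne_zero 3 Polynomial.X_ne_zero h'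

/-- The relation is found by duality: the functional φ(1), restricted to products of two generators,
is evaluation at some f. Nondegeneracy between degrees two and zero makes f span the relations;
between degrees one and one it gives maximal rank. -/
theorem exists_relation_of_isFrobenius [Module.Finite k (𝒜 1)] (hA : IsQuadratic 𝒜)
    (hF : IsFrobenius (quadraticDualGrading 𝒜)) (hs : gradedSup (quadraticDualGrading 𝒜) = 2) :
    2 ≤ Module.finrank k (𝒜 1) ∧ ∃ f : 𝒜 1 ⊗[k] 𝒜 1, HasPresentation 𝒜 {f} ∧
      tensorRank f = Module.finrank k (𝒜 1) := by
  obtain ⟨-, n, hn, φ, hφ, hφ0⟩ := hF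
  have hn2 : n = 2 := by
    rw [hs] at hn
    have : ((2 : ℕ) : ℕ∞) = (n : ℕ∞) := WithBot.coe_injective hn
    exact (Nat.cast_injective this).symm
  subst hn2
  have hφ1 : ∀ a x, φ a x = φ 1 (a * x) := fun a x => by rw [← hφ, one_mul]
  obtain ⟨f, hf⟩ := exists_evalAt_eq (k := k) (X := 𝒜 1)
    (φ 1 ∘ₗ (QuadAlg.mk (dualRelations 𝒜)).toLinearMap ∘ₗ tensorSquare k _)
  replace hf : ∀ t, evalAt f t = φ 1 (QuadAlg.mk (dualRelations 𝒜) (tensorSquare k _ t)) := hf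
  -- Tensors annihilating the kernel of μ vanish in the dual algebra, hence under φ(1); the double
  -- annihilator then puts f in that kernel.
  have hfμ : mulMap 𝒜 f = 0 := by
    refine LinearMap.mem_ker.1 (mem_of_forall_evalAt (N := LinearMap.ker (mulMap 𝒜)) ?_)
    intro t ht
    rw [hf, QuadAlg.mk_tensorSquare_of_mem ((mem_dualRelations_iff t).2 fun g hg => ht g hg),
      map_zero]
  -- A degree-two element only has to be tested against scalars, so φ(1) alone detects whether it
  -- vanishes.
  have hzero : ∀ t, evalAt f t = 0 → QuadAlg.mk (dualRelations 𝒜) (tensorSquare k _ t) = 0 := by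
    intro t ht
    refine eq_zero_of_form (quadraticDualGrading 𝒜) (n := 2) (i := 2) (j := 0) rfl φ hφ0
      (QuadAlg.mk_tensorSquare_mem t) ?_
    intro x hx
    obtain ⟨c, rfl⟩ := QuadAlg.exists_algebraMap_of_mem hx
    rw [hφ1, ← Algebra.commutes, ← Algebra.smul_def, map_smul, ← hf, ht, smul_zero]
  have hker : ∀ g, mulMap 𝒜 g = 0 → g ∈ Submodule.span k {f} := by
    intro g hg
    refine mem_of_forall_evalAt fun t ht => ?_
    exact evalAt_eq_zero_of_mk_eq_zero hg (hzero t (ht f (Submodule.mem_span_singleton_self f)))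
  have hrank : tensorRank f = Module.finrank k (𝒜 1) := by
    rw [tensorRank_eq_iff_forall]
    intro α hα
    apply gen_injective hfμ
    rw [map_zero]
    refine eq_zero_of_form (quadraticDualGrading 𝒜) (n := 2) (i := 1) (j := 1) rfl φ hφ0
      (QuadAlg.gen_mem α) ?_
    intro x hx
    obtain ⟨γ, rfl⟩ := QuadAlg.exists_gen_of_mem hx
    have h := hf (α ⊗ₜ γ)
    rw [evalAt_apply, hα γ, tensorSquare_tmul, map_mul] at h
    rw [hφ1]
    exact h.symm
  have hf0 : f ≠ 0 := by
    rintro rfl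
    refine ne_bot_of_gradedSup_eq (n := 2) hs ?_
    rw [eq_bot_iff]
    intro a ha
    obtain ⟨t, rfl⟩ := QuadAlg.exists_mk_tensorSquare ha
    rw [hzero t (by rw [evalAt_apply, map_zero])]
    exact Submodule.zero_mem _
  refine ⟨two_le_finrank_of_grading_three_eq_bot hfμ hf0 (eq_bot_of_gradedSup_lt ?_), f,
    hA.hasPresentation ?_ ?_, hrank⟩
  · rw [hs]
    exact WithBot.coe_lt_coe.2 (Nat.cast_lt.2 (show 2 < 3 by norm_num))
  · rintro g hg
    rw [Set.mem_singleton_iff.1 hg, canonicalMap_tensorSquare_eq_zero_iff, hfμ]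
  · exact fun g hg => hker g ((canonicalMap_tensorSquare_eq_zero_iff g).1 hg)

end FrobeniusDual

/-! ### Quadratic presentations by coefficients -/

/-- `S` is generated by the `x i` subject to the quadratic relations
`∑ i j, l s i j • (x i * x j) = 0`; the universal property is required for algebras in the
universe `w`. -/
structure QuadPres {k : Type v} {S : Type u} [Field k] [Ring S] [Algebra k S] {ι σ : Type}
    [Fintype ι] (x : ι → S) (l : σ → Matrix ι ι k) : Prop where
  adjoin : Algebra.adjoin k (Set.range x) = ⊤
  rel : ∀ s, ∑ i, ∑ j, l s i j • (x i * x j) = 0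
  lift : ∀ (B : Type w) [Ring B] [Algebra k B] (g : ι → B),
    (∀ s, ∑ i, ∑ j, l s i j • (g i * g j) = 0) → ∃ h : S →ₐ[k] B, ∀ i, h (x i) = g i

namespace QuadPres

variable {k : Type v} {S : Type u} [Field k] [Ring S] [Algebra k S] {ι σ : Type} [Fintype ι]
  {x : ι → S} {l : σ → Matrix ι ι k}

/-- Syzygies and resolutions are developed on one side only; this transfers them to the other side,
at the cost of transposing the matrices. -/
theorem op (h : QuadPres.{v, u, w} x l) :
    QuadPres.{v, u, w} (fun i => MulOpposite.op (x i)) (fun s => (l s).transpose) where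
  adjoin := by
    have h1 := congrArg Subalgebra.op h.adjoin
    rw [Subalgebra.op_adjoin, Subalgebra.op_top] at h1
    rw [← h1]
    congr 1
    ext a
    constructor
    · rintro ⟨i, rfl⟩
      exact ⟨i, rfl⟩
    · rintro ⟨i, hi⟩
      exact ⟨i, MulOpposite.unop_injective hi⟩
  rel s := by
    have h1 := congrArg MulOpposite.op (h.rel s)
    rw [Finset.sum_comm] at h1
    simpa using h1
  lift B _ _ g hg := by
    obtain ⟨q, hq⟩ := h.lift Bᵐᵒᵖ (fun i => MulOpposite.op (g i)) (fun s => by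
      have h1 := congrArg MulOpposite.op (hg s)
      rw [Finset.sum_comm] at h1
      simpa using h1)
    refine ⟨(AlgEquiv.opOp k B).symm.toAlgHom.comp (AlgHom.op q), fun i => ?_⟩
    simp [hq]

theorem induction_mul (h : QuadPres.{v, u, w} x l) {P : S → Prop} (hk : ∀ r, P (algebraMap k S r))
    (hx : ∀ i, P (x i)) (hadd : ∀ a b, P a → P b → P (a + b))
    (hmul : ∀ a b, P a → P b → P (a * b)) (a : S) : P a := by
  have ha : a ∈ Algebra.adjoin k (Set.range x) := by rw [h.adjoin]; exact Algebra.mem_top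
  induction ha using Algebra.adjoin_induction with
  | mem a ha =>
    obtain ⟨i, rfl⟩ := ha
    exact hx i
  | algebraMap r => exact hk r
  | add a b _ _ ha hb => exact hadd a b ha hb
  | mul a b _ _ ha hb => exact hmul a b ha hb

theorem rel_smul (h : QuadPres.{v, u, w} x l) {N : Type*} [AddCommGroup N] [Module S N] [Module k N]
    [IsScalarTower k S N] (s : σ) (c : N) : ∑ i, ∑ j, l s i j • ((x i * x j) • c) = 0 := by
  have h1 := congrArg (fun a => a • c) (h.rel s)
  simpa [Finset.sum_smul, smul_assoc] using h1

end QuadPres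

/-! ### The standard resolution of a left module -/

section Standard

variable {k : Type v} {S : Type u} [Field k] [Ring S] [Algebra k S] {ι σ : Type}
  (x : ι → S) (l : σ → Matrix ι ι k) (M : Type w) [AddCommGroup M] [Module k M]

/-- `a ⊗ m ↦ a * x i ⊗ m`. -/
def mulGen (i : ι) : S ⊗[k] M →ₗ[S] S ⊗[k] M :=
  TensorProduct.AlgebraTensorModule.map (LinearMap.toSpanSingleton S S (x i)) LinearMap.id

theorem mulGen_tmul (i : ι) (a : S) (m : M) : mulGen (k := k) x M i (a ⊗ₜ m) = (a * x i) ⊗ₜ m := rfl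

variable [Module S M] [IsScalarTower k S M]

/-- `a ⊗ m ↦ a ⊗ x i • m`. -/
def actGen (i : ι) : S ⊗[k] M →ₗ[S] S ⊗[k] M :=
  TensorProduct.AlgebraTensorModule.map LinearMap.id (Algebra.lsmul k k M (x i))

theorem actGen_tmul (i : ι) (a : S) (m : M) : actGen (k := k) x M i (a ⊗ₜ m) = a ⊗ₜ (x i • m) := rfl

variable [Fintype ι]

/-- The action map `S ⊗ M → M`. -/
def stdAug : S ⊗[k] M →ₗ[S] M :=
  TensorProduct.AlgebraTensorModule.lift
    (LinearMap.toSpanSingleton S (M →ₗ[k] M) LinearMap.id)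

theorem stdAug_tmul (a : S) (m : M) : stdAug (k := k) M (a ⊗ₜ m) = a • m := rfl

/-- The first differential of the standard resolution. -/
def stdD₁ : (ι → S ⊗[k] M) →ₗ[S] S ⊗[k] M :=
  ∑ i, (mulGen x M i - actGen x M i) ∘ₗ LinearMap.proj i

theorem stdD₁_apply (ξ : ι → S ⊗[k] M) :
    stdD₁ x M ξ = ∑ i, (mulGen x M i (ξ i) - actGen x M i (ξ i)) := by
  simp [stdD₁]

theorem stdAug_surjective : Function.Surjective (stdAug (k := k) (S := S) M) :=
  fun m => ⟨1 ⊗ₜ m, by rw [stdAug_tmul, one_smul]⟩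

theorem stdAug_stdD₁ (ξ : ι → S ⊗[k] M) : stdAug M (stdD₁ x M ξ) = 0 := by
  rw [stdD₁_apply, map_sum]
  refine Finset.sum_eq_zero fun i _ => ?_
  generalize ξ i = z
  induction z using TensorProduct.induction_on with
  | zero => simp
  | tmul a m => rw [mulGen_tmul, actGen_tmul, map_sub, stdAug_tmul, stdAug_tmul, mul_smul, sub_self]
  | add a b ha hb => rw [map_add, map_add, add_sub_add_comm, map_add, ha, hb, add_zero]

variable {x l M} in
-- Modulo the image every a ⊗ m equals 1 ⊗ am. For a product this follows by adding a(b ⊗ m - 1 ⊗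
-- bm) and a ⊗ bm - 1 ⊗ abm, so an induction on a reduces it to generators.
theorem exists_stdD₁_eq (h : QuadPres.{v, u, u} x l) {z : S ⊗[k] M} (hz : stdAug M z = 0) :
    ∃ ξ, stdD₁ x M ξ = z := by
  classical
  have key : ∀ a : S, ∀ m : M,
      a ⊗ₜ[k] m - (1 : S) ⊗ₜ[k] (a • m) ∈ LinearMap.range (stdD₁ (k := k) x M) := by
    intro a
    induction a using h.induction_mul with
    | hk r =>
      intro m
      rw [algebraMap_smul, TensorProduct.tmul_smul, Algebra.algebraMap_eq_smul_one,
        TensorProduct.smul_tmul', sub_self]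
      exact Submodule.zero_mem _
    | hx i =>
      intro m
      refine ⟨Pi.single i (1 ⊗ₜ m), ?_⟩
      rw [stdD₁_apply, Finset.sum_eq_single i]
      · rw [Pi.single_eq_same, mulGen_tmul, actGen_tmul, one_mul]
      · intro j _ hj
        rw [Pi.single_eq_of_ne hj, map_zero, map_zero, sub_zero]
      · simp
    | hadd a b ha hb =>
      intro m
      rw [TensorProduct.add_tmul, add_smul, TensorProduct.tmul_add, add_sub_add_comm]
      exact Submodule.add_mem _ (ha m) (hb m)
    | hmul a b ha hb =>
      intro m
      have h1 := Submodule.add_mem _ (Submodule.smul_mem _ a (hb m)) (ha (b • m))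
      rw [smul_sub, TensorProduct.smul_tmul', TensorProduct.smul_tmul', smul_eq_mul, smul_eq_mul,
        mul_one, sub_add_sub_cancel, ← mul_smul] at h1
      exact h1
  have hz' : z - (1 : S) ⊗ₜ[k] stdAug M z ∈ LinearMap.range (stdD₁ (k := k) x M) := by
    clear hz
    induction z using TensorProduct.induction_on with
    | zero => simp
    | tmul a m => exact key a m
    | add a b ha hb =>
      rw [map_add, TensorProduct.tmul_add, add_sub_add_comm]
      exact Submodule.add_mem _ ha hb
  rw [hz, TensorProduct.tmul_zero, sub_zero] at hz'
  exact hz'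

variable [Fintype σ]

/-- The second differential of the standard resolution. -/
def stdD₂ : (σ → S ⊗[k] M) →ₗ[S] (ι → S ⊗[k] M) :=
  LinearMap.pi fun j => ∑ s, (∑ i, (l s i j • mulGen x M i + l s j i • actGen x M i)) ∘ₗ
    LinearMap.proj s

theorem stdD₂_apply (η : σ → S ⊗[k] M) (j : ι) :
    stdD₂ x l M η j = ∑ s, ∑ i, (l s i j • mulGen x M i (η s) + l s j i • actGen x M i (η s)) := by
  simp [stdD₂, LinearMap.sum_apply]

variable {x l M}

/-- Exactness of the standard resolution in the middle: the cokernel `C` of the second differential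
extends to an `S`-module structure on `C × M`. -/
theorem exists_stdD₂_eq (h : QuadPres.{v, u, max u w} x l) {ξ : ι → S ⊗[k] M}
    (hξ : stdD₁ x M ξ = 0) : ∃ η, stdD₂ x l M η = ξ := by
  classical
  let R := LinearMap.range (stdD₂ x l M)
  let C := (ι → S ⊗[k] M) ⧸ R
  let e : ι → M →ₗ[k] C := fun i =>
    (R.mkQ.restrictScalars k) ∘ₗ LinearMap.single k (fun _ : ι => S ⊗[k] M) i ∘ₗ
      TensorProduct.mk k S M 1
  have he : ∀ i m, e i m = R.mkQ (Pi.single i (1 ⊗ₜ m)) := fun _ _ => rfl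
  -- The generator x i acts diagonally, with the class of 1 ⊗ m in position i as an additional
  -- off-diagonal term.
  let g : ι → Module.End k (C × M) := fun i =>
    LinearMap.prod ((Algebra.lsmul k k C (x i)) ∘ₗ LinearMap.fst k C M + e i ∘ₗ LinearMap.snd k C M)
      ((Algebra.lsmul k k M (x i)) ∘ₗ LinearMap.snd k C M)
  have hg : ∀ i p, g i p = (x i • p.1 + e i p.2, x i • p.2) := fun _ _ => rfl
  have hxe : ∀ i j m, x i • e j m + e i (x j • m)
      = R.mkQ (Pi.single j (x i ⊗ₜ m) + Pi.single i (1 ⊗ₜ (x j • m))) := by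
    intro i j m
    rw [he, he, map_add, ← map_smul, ← Pi.single_smul, TensorProduct.smul_tmul', smul_eq_mul,
      mul_one]
  have hrel : ∀ s, ∑ i, ∑ j, l s i j • (g i * g j) = 0 := by
    intro s
    refine LinearMap.ext fun p => ?_
    obtain ⟨c, m⟩ := p
    have e1 : ∀ i j, (g i * g j) (c, m)
        = ((x i * x j) • c + (x i • e j m + e i (x j • m)), (x i * x j) • m) := by
      intro i j
      rw [Module.End.mul_apply, hg, hg, smul_add, add_assoc, mul_smul, mul_smul]
    -- The off-diagonal part of the relation `s` is the class of a value of the second differential,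
    -- which is zero in C by construction.
    have e3 : ∑ i, ∑ j, l s i j • (x i • e j m + e i (x j • m)) = 0 := by
      have : ∑ i, ∑ j, l s i j • (x i • e j m + e i (x j • m))
          = R.mkQ (stdD₂ x l M (Pi.single s (1 ⊗ₜ m))) := by
        simp only [hxe]
        rw [← LinearMap.coe_restrictScalars k]
        simp only [← map_smul, ← map_sum]
        congr 1
        funext j
        rw [stdD₂_apply, Finset.sum_eq_single s]
        · simp only [Pi.single_eq_same, mulGen_tmul, actGen_tmul, one_mul, Finset.sum_apply,
            Pi.smul_apply, Pi.add_apply, smul_add, Finset.sum_add_distrib]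
          congr 1
          · refine Finset.sum_congr rfl fun i _ => ?_
            rw [Finset.sum_eq_single j]
            · rw [Pi.single_eq_same]
            · intro b _ hb
              rw [Pi.single_eq_of_ne hb.symm, smul_zero]
            · simp
          · rw [Finset.sum_comm]
            refine Finset.sum_congr rfl fun i _ => ?_
            rw [Finset.sum_eq_single j]
            · rw [Pi.single_eq_same]
            · intro b _ hb
              rw [Pi.single_eq_of_ne hb.symm, smul_zero]
            · simp
        · intro t _ ht
          rw [Pi.single_eq_of_ne ht]
          simp
        · simp
      rw [this]
      exact (Submodule.Quotient.mk_eq_zero R).2 ⟨_, rfl⟩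
    simp only [LinearMap.sum_apply, LinearMap.smul_apply, e1, LinearMap.zero_apply]
    refine Prod.ext ?_ ?_
    · simp only [Prod.fst_sum, Prod.smul_fst, Prod.fst_zero, smul_add, Finset.sum_add_distrib]
      simp only [smul_add, Finset.sum_add_distrib] at e3
      rw [h.rel_smul s c, e3, zero_add]
    · simp only [Prod.snd_sum, Prod.smul_snd, Prod.snd_zero]
      exact h.rel_smul s m
  obtain ⟨ρ, hρ⟩ := h.lift (Module.End k (C × M)) g hrel
  have hρC : ∀ a c, ρ a (c, 0) = (a • c, 0) := by
    intro a
    induction a using h.induction_mul with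
    | hk r =>
      intro c
      rw [AlgHom.commutes, Module.algebraMap_end_apply, Prod.smul_mk, smul_zero, algebraMap_smul]
    | hx i =>
      intro c
      rw [hρ, hg]
      simp
    | hadd a b ha hb =>
      intro c
      rw [map_add, LinearMap.add_apply, ha, hb, Prod.mk_add_mk, add_zero, add_smul]
    | hmul a b ha hb =>
      intro c
      rw [map_mul, Module.End.mul_apply, hb, ha, mul_smul]
  -- The map a ⊗ m ↦ a(0, m). Composed with the first differential it becomes the projection onto C,
  -- so a cycle has zero class in C.
  let θ : S ⊗[k] M →ₗ[k] C × M := TensorProduct.lift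
    (ρ.toLinearMap.compl₂ (LinearMap.inr k C M))
  have hθ : ∀ a m, θ (a ⊗ₜ m) = ρ a (0, m) := fun _ _ => rfl
  have key : ∀ i z, θ (mulGen x M i z - actGen x M i z) = (R.mkQ (Pi.single i z), 0) := by
    intro i z
    induction z using TensorProduct.induction_on with
    | zero => simp [Prod.zero_eq_mk]
    | tmul a m =>
      rw [mulGen_tmul, actGen_tmul, map_sub, hθ, hθ, map_mul, Module.End.mul_apply, hρ, hg,
        ← map_sub]
      simp only [smul_zero, zero_add, Prod.mk_sub_mk, sub_zero, sub_self]
      rw [hρC, he, ← map_smul, ← Pi.single_smul, TensorProduct.smul_tmul', smul_eq_mul, mul_one]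
    | add a b ha hb =>
      rw [map_add, map_add, add_sub_add_comm, map_add, ha, hb, Pi.single_add, map_add,
        Prod.mk_add_mk, add_zero]
  have hθξ : θ (stdD₁ x M ξ) = (R.mkQ ξ, 0) := by
    rw [stdD₁_apply, map_sum]
    simp only [key, ← LinearMap.inl_apply (R := k)]
    rw [← map_sum, ← map_sum, LinearMap.inl_apply, Finset.univ_sum_single]
    rfl
  rw [hξ, map_zero] at hθξ
  exact (Submodule.Quotient.mk_eq_zero R).1 (congrArg Prod.fst hθξ).symm

end Standard

/-! ### Projective dimension through the beginning of a resolution -/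

section ProjDim

open CategoryTheory

variable {S : Type u} [Ring S] {B₁ B₀ C : Type u} [AddCommGroup B₁] [Module S B₁]
  [AddCommGroup B₀] [Module S B₀] [AddCommGroup C] [Module S C]

theorem hasProjectiveDimensionLT_iff_ker [Module.Projective S B₀] (f : B₀ →ₗ[S] C)
    (hf : Function.Surjective f) (n : ℕ) :
    HasProjectiveDimensionLT (ModuleCat.of S C) (n + 2) ↔
      HasProjectiveDimensionLT (ModuleCat.of S (LinearMap.ker f)) (n + 1) :=
  (LinearMap.shortExact_shortComplexKer hf).hasProjectiveDimensionLT_X₃_iff n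
    ((IsProjective.iff_projective B₀).1 inferInstance)

theorem hasProjectiveDimensionLT_one_iff :
    HasProjectiveDimensionLT (ModuleCat.of S C) 1 ↔ Module.Projective S C := by
  rw [← projective_iff_hasProjectiveDimensionLT_one, ← IsProjective.iff_projective]

theorem hasProjectiveDimensionLT_two_iff [Module.Projective S B₀] (f : B₀ →ₗ[S] C)
    (hf : Function.Surjective f) :
    HasProjectiveDimensionLT (ModuleCat.of S C) 2 ↔ Module.Projective S (LinearMap.ker f) := by
  rw [hasProjectiveDimensionLT_iff_ker f hf 0, hasProjectiveDimensionLT_one_iff]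

theorem hasProjectiveDimensionLT_three_iff [Module.Projective S B₀] [Module.Projective S B₁]
    (f : B₀ →ₗ[S] C) (hf : Function.Surjective f) (d : B₁ →ₗ[S] B₀) (hd : Function.Exact d f) :
    HasProjectiveDimensionLT (ModuleCat.of S C) 3 ↔ Module.Projective S (LinearMap.ker d) := by
  have hmem : ∀ b, d b ∈ LinearMap.ker f := fun b => (hd (d b)).2 ⟨b, rfl⟩
  have hsurj : Function.Surjective (d.codRestrict (LinearMap.ker f) hmem) := by
    rintro ⟨c, hc⟩
    obtain ⟨b, rfl⟩ := (hd c).1 hc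
    exact ⟨b, rfl⟩
  rw [hasProjectiveDimensionLT_iff_ker f hf 1, hasProjectiveDimensionLT_two_iff _ hsurj,
    LinearMap.ker_codRestrict]

theorem globalDimension_le_of_forall {A : Type u} [Ring A] (n : ℕ)
    (h : ∀ (M : Type u) [AddCommGroup M] [Module Aᵐᵒᵖ M],
      HasProjectiveDimensionLT (ModuleCat.of Aᵐᵒᵖ M) (n + 1)) :
    globalDimension A ≤ ((n : ℕ∞) : WithBot ℕ∞) :=
  iSup_le fun M => (projectiveDimension_le_iff M n).2 (h M)

theorem hasProjectiveDimensionLT_of_globalDimension_le {A : Type u} [Ring A] (n : ℕ)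
    (h : globalDimension A ≤ ((n : ℕ∞) : WithBot ℕ∞)) (M : Type u) [AddCommGroup M]
    [Module Aᵐᵒᵖ M] : HasProjectiveDimensionLT (ModuleCat.of Aᵐᵒᵖ M) (n + 1) :=
  (projectiveDimension_le_iff _ n).1
    ((le_iSup (fun M : ModuleCat.{u} Aᵐᵒᵖ => projectiveDimension M) (ModuleCat.of Aᵐᵒᵖ M)).trans h)

end ProjDim

/-! ### Consequences of the standard resolution -/

section Standard

variable {k : Type v} {S : Type u} [Field k] [Ring S] [Algebra k S] {ι σ : Type} [Fintype ι]
  [Fintype σ] {x : ι → S} {l : σ → Matrix ι ι k}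

/-- The composite has three kinds of terms: a relation multiplied into S, a relation acting on M,
and mixed terms. The first two vanish; the mixed ones cancel after exchanging the summation indices.
-/
theorem stdD₁_stdD₂ {M : Type w} [AddCommGroup M] [Module S M] [Module k M] [IsScalarTower k S M]
    (h : QuadPres.{v, u, u} x l) (η : σ → S ⊗[k] M) : stdD₁ x M (stdD₂ x l M η) = 0 := by
  have key : ∀ s (z : S ⊗[k] M), ∑ j, ∑ i,
      (l s i j • mulGen x M j (mulGen x M i z) + l s j i • mulGen x M j (actGen x M i z)
        - (l s i j • actGen x M j (mulGen x M i z) + l s j i • actGen x M j (actGen x M i z)))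
        = 0 := by
    intro s z
    induction z using TensorProduct.induction_on with
    | zero => simp
    | tmul a m =>
      simp only [mulGen_tmul, actGen_tmul, Finset.sum_sub_distrib, Finset.sum_add_distrib]
      have h1 : ∑ j, ∑ i, l s i j • ((a * x i * x j) ⊗ₜ[k] m) = 0 := by
        have h0 := congrArg (fun b => a * b) (h.rel s)
        simp only [Finset.mul_sum, mul_smul_comm, mul_zero, ← mul_assoc] at h0
        rw [Finset.sum_comm]
        simp only [TensorProduct.smul_tmul', ← TensorProduct.sum_tmul, h0, TensorProduct.zero_tmul]
      have h2 : ∑ j, ∑ i, l s j i • (a ⊗ₜ[k] (x j • x i • m)) = 0 := by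
        simp only [← TensorProduct.tmul_smul, ← TensorProduct.tmul_sum, ← mul_smul]
        simp only [h.rel_smul s m, TensorProduct.tmul_zero]
      have h3 : ∑ j, ∑ i, l s j i • ((a * x j) ⊗ₜ[k] (x i • m))
          = ∑ j, ∑ i, l s i j • ((a * x i) ⊗ₜ[k] (x j • m)) := Finset.sum_comm
      rw [h1, h2, h3, zero_add, add_zero, sub_self]
    | add a b ha hb =>
      have h1 := congrArg₂ (· + ·) ha hb
      simp only [← Finset.sum_add_distrib, add_zero] at h1
      rw [← h1]
      refine Finset.sum_congr rfl fun j _ => Finset.sum_congr rfl fun i _ => ?_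
      simp only [map_add, smul_add]
      abel
  have hj : ∀ (f : S ⊗[k] M →ₗ[S] S ⊗[k] M) j, f (stdD₂ x l M η j)
      = ∑ s, ∑ i, (l s i j • f (mulGen x M i (η s)) + l s j i • f (actGen x M i (η s))) := by
    intro f j
    rw [stdD₂_apply, ← LinearMap.coe_restrictScalars k]
    simp only [map_sum, map_add, map_smul]
  rw [stdD₁_apply]
  simp only [hj, ← Finset.sum_sub_distrib]
  rw [Finset.sum_comm]
  exact Finset.sum_eq_zero fun s _ => key s (η s)

theorem QuadPres.hasProjectiveDimensionLT_three (h : QuadPres.{v, u, u} x l)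
    (hinj : ∀ (M : Type u) [AddCommGroup M] [Module S M] [Module k M] [IsScalarTower k S M],
      Function.Injective (stdD₂ x l M)) (M : Type u) [AddCommGroup M] [Module S M] :
    CategoryTheory.HasProjectiveDimensionLT (ModuleCat.of S M) 3 := by
  let _ : Module k M := Module.compHom M (algebraMap k S)
  have : IsScalarTower k S M := ⟨fun r s m => by
    rw [Algebra.smul_def, mul_smul]
    rfl⟩
  have hex : Function.Exact (stdD₁ (k := k) x M) (stdAug M) := fun z =>
    ⟨fun hz => exists_stdD₁_eq h hz, by
      rintro ⟨ξ, rfl⟩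
      exact stdAug_stdD₁ x M ξ⟩
  rw [hasProjectiveDimensionLT_three_iff (stdAug (k := k) M) (stdAug_surjective M) _ hex]
  have hrange : LinearMap.range (stdD₂ x l M) = LinearMap.ker (stdD₁ (k := k) x M) := by
    apply le_antisymm
    · rintro _ ⟨η, rfl⟩
      exact stdD₁_stdD₂ h η
    · exact fun ξ hξ => exists_stdD₂_eq h hξ
  rw [← hrange]
  exact Module.Projective.of_equiv (LinearEquiv.ofInjective _ (hinj M))

/-- Without relations the second differential has zero source, so exactness in the middle makes the
first differential injective. This excludes the absence of relations in global dimension two. -/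
theorem QuadPres.hasProjectiveDimensionLT_two [IsEmpty σ] (h : QuadPres.{v, u, u} x l) (M : Type u)
    [AddCommGroup M] [Module S M] :
    CategoryTheory.HasProjectiveDimensionLT (ModuleCat.of S M) 2 := by
  let _ : Module k M := Module.compHom M (algebraMap k S)
  have : IsScalarTower k S M := ⟨fun r s m => by
    rw [Algebra.smul_def, mul_smul]
    rfl⟩
  rw [hasProjectiveDimensionLT_two_iff (stdAug (k := k) M) (stdAug_surjective M)]
  have hrange : LinearMap.range (stdD₁ (k := k) x M) = LinearMap.ker (stdAug M) := by
    apply le_antisymm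
    · rintro _ ⟨η, rfl⟩
      exact stdAug_stdD₁ x M η
    · exact fun ξ hξ => exists_stdD₁_eq h hξ
  have hinj : Function.Injective (stdD₁ (k := k) x M) := by
    refine (injective_iff_map_eq_zero _).2 fun ξ hξ => ?_
    obtain ⟨η, rfl⟩ := exists_stdD₂_eq h hξ
    rw [Subsingleton.elim η 0, map_zero]
  rw [← hrange]
  exact Module.Projective.of_equiv (LinearEquiv.ofInjective _ hinj)

/-- Left syzygies of the generators come from the relations. -/
theorem QuadPres.exists_of_sum_mul_eq_zero (h : QuadPres.{v, u, max u v} x l) {a : ι → S}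
    (ha : ∑ i, a i * x i = 0) : ∃ z : σ → S, ∀ j, a j = ∑ s, ∑ i, l s i j • (z s * x i) := by
  -- The augmentation that kills the generators exists because the relations have no terms of lower
  -- degree. The standard complex of the resulting module k is then the complex of syzygies.
  obtain ⟨ε', hε'⟩ := h.lift (ULift.{u} k) (fun _ => 0) (fun s => by simp)
  let ε : S →ₐ[k] k := (ULift.algEquiv (R := k) (A := k)).toAlgHom.comp ε'
  have hε : ∀ i, ε (x i) = 0 := fun i => by simp [ε, hε']
  let _ : Module S k := Module.compHom k (ε : S →+* k)
  have hsm : ∀ (s : S) (r : k), s • r = ε s * r := fun _ _ => rfl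
  have : IsScalarTower k S k := ⟨fun r s m => by
    rw [hsm, hsm, map_smul, smul_mul_assoc]⟩
  obtain ⟨η, hη⟩ := exists_stdD₂_eq (M := k) (l := l) (ξ := fun i => a i ⊗ₜ (1 : k)) h (by
    rw [stdD₁_apply]
    simp only [mulGen_tmul, actGen_tmul, hsm, hε, zero_mul, TensorProduct.tmul_zero, sub_zero]
    rw [← TensorProduct.sum_tmul, ha, TensorProduct.zero_tmul])
  have hact : ∀ i (z : S ⊗[k] k), actGen (k := k) x k i z = 0 := by
    intro i z
    induction z using TensorProduct.induction_on with
    | zero => simp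
    | tmul b r => rw [actGen_tmul, hsm, hε, zero_mul, TensorProduct.tmul_zero]
    | add b c hb hc => rw [map_add, hb, hc, add_zero]
  have hmul : ∀ i (z : S ⊗[k] k), TensorProduct.rid k S (mulGen (k := k) x k i z)
      = TensorProduct.rid k S z * x i := by
    intro i z
    induction z using TensorProduct.induction_on with
    | zero => simp
    | tmul b r => rw [mulGen_tmul, TensorProduct.rid_tmul, TensorProduct.rid_tmul, smul_mul_assoc]
    | add b c hb hc => rw [map_add, map_add, hb, hc, map_add, add_mul]
  refine ⟨fun s => TensorProduct.rid k S (η s), fun j => ?_⟩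
  have h1 := congrArg (fun q => TensorProduct.rid k S (q j)) hη
  simp only [stdD₂_apply, hact, smul_zero, add_zero, map_sum, map_smul, hmul,
    TensorProduct.rid_tmul, one_smul] at h1
  exact h1.symm

end Standard

/-! ### Degree projections -/

/-- Projections onto the homogeneous components of a grading in which the `x i` have degree one. -/
structure DegreeProj {k : Type v} {S : Type u} [Field k] [Ring S] [Algebra k S] {ι : Type}
    (x : ι → S) (π : ℕ → S →ₗ[k] S) : Prop where
  succ : ∀ m s i, π (m + 1) (s * x i) = π m s * x i
  zero : ∀ s i, π 0 (s * x i) = 0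
  idem : ∀ m s, π m (π m s) = π m s
  sum : ∀ s, ∃ N, ∀ N' ≥ N, s = ∑ m ∈ Finset.range N', π m s

section Injective

variable {k : Type v} {S : Type u} [Field k] [Ring S] [Algebra k S] {ι : Type}
  {x : ι → S} {π : ℕ → S →ₗ[k] S}

theorem DegreeProj.eq_zero (hπ : DegreeProj x π) {s : S} (hs : ∀ m, π m s = 0) : s = 0 := by
  obtain ⟨N, hN⟩ := hπ.sum s
  rw [hN N le_rfl]
  exact Finset.sum_eq_zero fun m _ => hs m

theorem mulGen_injective (M : Type w) [AddCommGroup M] [Module k M] (p : ι)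
    (h : Function.Injective (LinearMap.mulRight k (x p))) :
    Function.Injective (mulGen (k := k) x M p) := by
  have e : ∀ y, mulGen (k := k) x M p y = (LinearMap.mulRight k (x p)).rTensor M y := by
    intro y
    induction y using TensorProduct.induction_on with
    | zero => simp
    | tmul a b => simp [mulGen_tmul]
    | add a b ha hb => simp only [map_add, ha, hb]
  have h1 := Module.Flat.rTensor_preserves_injective_linearMap (M := M) _ h
  intro y y' hy
  rw [e, e] at hy
  exact h1 hy

variable [Fintype ι] {L : Matrix ι ι k}

theorem DegreeProj.succ_sum (hπ : DegreeProj x π) (m : ℕ) (s : S) (c : ι → k) :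
    π (m + 1) (s * ∑ i, c i • x i) = π m s * ∑ i, c i • x i := by
  simp only [Finset.mul_sum, mul_smul_comm, map_sum, map_smul, hπ.succ]

/-- For one relation of maximal rank in at least two generators, elements of degree one are not
right zero divisors. -/
theorem eq_zero_of_mul_linear_eq_zero [DecidableEq ι]
    (h : QuadPres.{v, u, max u v} x (fun _ : Unit => L)) (hπ : DegreeProj x π) (hL : IsUnit L)
    (h2 : 2 ≤ Fintype.card ι) {c : ι → k} (hc : c ≠ 0) {w : S} (hw : w * ∑ i, c i • x i = 0) :
    w = 0 := by
  -- Induction on the degree of w, for all nonzero linear forms at once, since the form changes from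
  -- c to L d in the inductive step.
  have key : ∀ m, ∀ w, π m w = w → ∀ c : ι → k, c ≠ 0 → w * ∑ i, c i • x i = 0 → w = 0 := by
    intro m
    induction m with
    | zero =>
      intro w hm c hc hw
      obtain ⟨z, hz⟩ := h.exists_of_sum_mul_eq_zero (a := fun i => c i • w) (by
        simpa [Finset.mul_sum] using hw)
      obtain ⟨j, hj⟩ := Function.ne_iff.1 hc
      have h1 := congrArg (π 0) (hz j)
      simp only [Finset.univ_unique, Finset.sum_singleton, map_smul, map_sum, hπ.zero, smul_zero,
        Finset.sum_const_zero, hm] at h1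
      exact (smul_eq_zero.1 h1).resolve_left hj
    | succ m ih =>
      intro w hm c hc hw
      obtain ⟨z, hz⟩ := h.exists_of_sum_mul_eq_zero (a := fun i => c i • w) (by
        simpa [Finset.mul_sum] using hw)
      obtain ⟨j, hj⟩ := Function.ne_iff.1 hc
      have h1 : ∀ j, c j • w = ∑ i, L i j • (π m (z ()) * x i) := by
        intro j
        have h1 := congrArg (π (m + 1)) (hz j)
        simpa only [Finset.univ_unique, Finset.sum_singleton, map_smul, map_sum, hπ.succ, hm,
          PUnit.default_eq_unit] using h1
      -- With at least two generators some d ≠ 0 is orthogonal to c. Combining the syzygy equations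
      -- with weights d eliminates w and leaves π m z times the linear form of L d, which is nonzero
      -- because L is invertible.
      obtain ⟨d, hd, hcd⟩ := exists_ne_zero_apply_eq_zero (k := k) (V := ι → k)
        (by rwa [Module.finrank_fintype_fun_eq_card])
        (∑ j, c j • LinearMap.proj j)
      have hcd' : ∑ j, d j * c j = 0 := by
        simpa [LinearMap.sum_apply, mul_comm] using hcd
      have hLd : L.mulVec d ≠ 0 := by
        intro h0
        exact hd ((Matrix.mulVec_injective_iff_isUnit.2 hL)
          (by rw [h0, Matrix.mulVec_zero]))
      have h3 : π m (z ()) * ∑ i, (L.mulVec d) i • x i = 0 := by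
        have h4 : ∑ j, d j • (c j • w) = 0 := by
          simp only [smul_smul, ← Finset.sum_smul, hcd', zero_smul]
        simp only [h1, Finset.smul_sum] at h4
        rw [Finset.sum_comm] at h4
        simp only [Finset.mul_sum, Matrix.mulVec, dotProduct, Finset.sum_smul, mul_smul_comm]
        rw [← h4]
        refine Finset.sum_congr rfl fun i _ => ?_
        simp only [smul_smul, mul_comm]
      have h5 := ih (π m (z ())) (hπ.idem m _) _ hLd h3
      have h6 := h1 j
      simp only [h5, zero_mul, smul_zero, Finset.sum_const_zero] at h6
      exact (smul_eq_zero.1 h6).resolve_left hj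
  refine hπ.eq_zero fun m => key m _ (hπ.idem m w) c hc ?_
  rw [← hπ.succ_sum, hw, map_zero]

theorem mul_right_injective_gen [DecidableEq ι]
    (h : QuadPres.{v, u, max u v} x (fun _ : Unit => L)) (hπ : DegreeProj x π) (hL : IsUnit L)
    (h2 : 2 ≤ Fintype.card ι) (p : ι) {w : S} (hw : w * x p = 0) : w = 0 := by
  refine eq_zero_of_mul_linear_eq_zero h hπ hL h2 (c := Pi.single p 1) (by simp) ?_
  rw [Finset.sum_eq_single p]
  · simpa using hw
  · intro j _ hj
    rw [Pi.single_eq_of_ne hj, zero_smul]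
  · simp

/-- For one relation of maximal rank in at least two generators, the second differential of the
standard resolution is injective: compare components of highest degree. -/
theorem stdD₂_injective [DecidableEq ι] [Nonempty ι]
    (h : QuadPres.{v, u, max u v} x (fun _ : Unit => L)) (hπ : DegreeProj x π) (hL : IsUnit L)
    (h2 : 2 ≤ Fintype.card ι) (M : Type w) [AddCommGroup M] [Module S M] [Module k M]
    [IsScalarTower k S M] : Function.Injective (stdD₂ x (fun _ : Unit => L) M) := by
  refine (injective_iff_map_eq_zero _).2 fun η hη => ?_
  obtain ⟨p⟩ := ‹Nonempty ι›
  obtain ⟨z, hz⟩ : ∃ z, z = η () := ⟨_, rfl⟩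
  have h0 : ∀ j, ∑ i, (L i j • mulGen x M i z + L j i • actGen x M i z) = 0 := by
    intro j
    have h1 := congrFun hη j
    rw [stdD₂_apply, Finset.univ_unique, Finset.sum_singleton, PUnit.default_eq_unit, ← hz] at h1
    exact h1
  -- solve for multiplication by the generator `x p`
  have hp : mulGen x M p z = - ∑ j, L⁻¹ j p • ∑ i, L j i • actGen x M i z := by
    have h1 : ∑ j, L⁻¹ j p • ∑ i, (L i j • mulGen x M i z + L j i • actGen x M i z) = 0 := by
      simp only [h0, smul_zero, Finset.sum_const_zero]
    simp only [Finset.sum_add_distrib, smul_add] at h1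
    have h3 : ∑ j, L⁻¹ j p • ∑ i, L i j • mulGen x M i z = mulGen x M p z := by
      simp only [Finset.smul_sum, smul_smul]
      rw [Finset.sum_comm]
      simp only [← Finset.sum_smul]
      have h4 : ∀ i, ∑ j, L⁻¹ j p * L i j = (1 : Matrix ι ι k) i p := by
        intro i
        rw [← Matrix.mul_nonsing_inv L ((Matrix.isUnit_iff_isUnit_det L).1 hL), Matrix.mul_apply]
        exact Finset.sum_congr rfl fun j _ => mul_comm _ _
      simp only [h4, Matrix.one_apply, ite_smul, one_smul, zero_smul, Finset.sum_ite_eq',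
        Finset.mem_univ, if_true]
    rw [h3] at h1
    exact eq_neg_of_add_eq_zero_left h1
  let T : ℕ → S ⊗[k] M →ₗ[k] S ⊗[k] M := fun m => (π m).rTensor M
  have hTmul : ∀ m (y : S ⊗[k] M), T (m + 1) (mulGen x M p y) = mulGen x M p (T m y) := by
    intro m y
    induction y using TensorProduct.induction_on with
    | zero => simp
    | tmul a b => simp only [T, mulGen_tmul, LinearMap.rTensor_tmul, hπ.succ]
    | add a b ha hb => simp only [map_add, ha, hb]
  have hTact : ∀ m i (y : S ⊗[k] M), T m (actGen x M i y) = actGen x M i (T m y) := by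
    intro m i y
    induction y using TensorProduct.induction_on with
    | zero => simp
    | tmul a b => simp only [T, actGen_tmul, LinearMap.rTensor_tmul]
    | add a b ha hb => simp only [map_add, ha, hb]
  have hinj : Function.Injective (mulGen (k := k) x M p) := by
    have h1 : Function.Injective (LinearMap.mulRight k (x p)) :=
      (injective_iff_map_eq_zero _).2 fun w hw => mul_right_injective_gen h hπ hL h2 p hw
    exact mulGen_injective M p h1
  -- Multiplication by `x p` raises the degree by one, while the action on M preserves it. So the
  -- component in degree m, times `x p`, is a combination of actions on the component in degree m +
  -- 1.
  have hstep : ∀ m, T (m + 1) z = 0 → T m z = 0 := by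
    intro m hm
    apply hinj
    rw [← hTmul, hp, map_zero]
    simp only [map_neg, map_sum, map_smul, hTact, hm, map_zero, smul_zero, Finset.sum_const_zero,
      neg_zero]
  have hfin : ∀ y : S ⊗[k] M, ∃ N, ∀ N' ≥ N, y = ∑ m ∈ Finset.range N', T m y := by
    intro y
    induction y using TensorProduct.induction_on with
    | zero => exact ⟨0, fun _ _ => by simp⟩
    | tmul a b =>
      obtain ⟨N, hN⟩ := hπ.sum a
      refine ⟨N, fun N' hN' => ?_⟩
      simp only [T, LinearMap.rTensor_tmul, ← TensorProduct.sum_tmul, ← hN N' hN']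
    | add a b ha hb =>
      obtain ⟨N₁, h₁⟩ := ha
      obtain ⟨N₂, h₂⟩ := hb
      refine ⟨max N₁ N₂, fun N' hN' => ?_⟩
      simp only [map_add, Finset.sum_add_distrib]
      rw [← h₁ N' (le_of_max_le_left hN'), ← h₂ N' (le_of_max_le_right hN')]
  obtain ⟨N, hN⟩ := hfin z
  -- The partial sums up to N and up to N + 1 both equal z; from here `hstep` descends through all
  -- lower degrees.
  have hNz : T N z = 0 := by
    have h1 := hN (N + 1) (Nat.le_succ N)
    rw [Finset.sum_range_succ, ← hN N le_rfl] at h1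
    exact left_eq_add.1 h1
  have hall : ∀ i ≤ N, T (N - i) z = 0 := by
    intro i
    induction i with
    | zero => exact fun _ => hNz
    | succ i ih =>
      intro hi
      apply hstep
      rw [show N - (i + 1) + 1 = N - i by omega]
      exact ih (by omega)
  have hz0 : z = 0 := by
    rw [hN N le_rfl]
    refine Finset.sum_eq_zero fun m hm => ?_
    have hm' := Finset.mem_range.1 hm
    rw [show m = N - (N - m) by omega]
    exact hall _ (by omega)
  funext u
  rw [Pi.zero_apply, ← hz0, hz]

end Injective

/-! ### Homogeneous components of graded right modules -/

section Components

variable {M : Type*} [AddCommGroup M] {ℳ : ℤ → AddSubgroup M}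

/-- The projection onto a component of an internal direct sum. -/
def homComp (h : DirectSum.IsInternal ℳ) (i : ℤ) : M →+ M :=
  letI := h.chooseDecomposition
  (ℳ i).subtype.comp ((DFinsupp.evalAddMonoidHom i).comp
    (DirectSum.decomposeAddEquiv ℳ).toAddMonoidHom)

theorem homComp_mem (h : DirectSum.IsInternal ℳ) (i : ℤ) (m : M) : homComp h i m ∈ ℳ i :=
  SetLike.coe_mem _

theorem homComp_of_mem (h : DirectSum.IsInternal ℳ) {i : ℤ} {m : M} (hm : m ∈ ℳ i) :
    homComp h i m = m :=
  letI := h.chooseDecomposition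
  DirectSum.decompose_of_mem_same ℳ hm

theorem homComp_of_mem_ne (h : DirectSum.IsInternal ℳ) {i j : ℤ} {m : M} (hm : m ∈ ℳ i)
    (hij : i ≠ j) : homComp h j m = 0 :=
  letI := h.chooseDecomposition
  DirectSum.decompose_of_mem_ne ℳ hm hij

theorem induction_homogeneous (h : DirectSum.IsInternal ℳ) {p : M → Prop} (h0 : p 0)
    (hom : ∀ i, ∀ m ∈ ℳ i, p m) (add : ∀ a b, p a → p b → p (a + b)) (m : M) : p m :=
  letI := h.chooseDecomposition
  DirectSum.Decomposition.inductionOn ℳ h0 (fun {i} m => hom i m m.2) add m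

theorem exists_addHom_of_components (h : DirectSum.IsInternal ℳ) {N : Type*} [AddCommGroup N]
    (F : ℤ → M →+ N) : ∃ G : M →+ N, ∀ i, ∀ m ∈ ℳ i, G m = F i m := by
  let _ := h.chooseDecomposition
  refine ⟨(DirectSum.toAddMonoid fun i => (F i).comp (ℳ i).subtype).comp
    (DirectSum.decomposeAddEquiv ℳ).toAddMonoidHom, fun i m hm => ?_⟩
  change DirectSum.toAddMonoid _ (DirectSum.decompose ℳ m) = _
  rw [DirectSum.decompose_of_mem ℳ hm, DirectSum.toAddMonoid_of]
  rfl

end Components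

/-! ### Homogeneous components of linear maps and graded lifting -/

section GradedMaps

variable {k : Type v} {A : Type u} [Field k] [Ring A] [Algebra k A] {𝒜 : ℕ → Submodule k A}

section

variable {M N : Type*} [AddCommGroup M] [Module Aᵐᵒᵖ M] [AddCommGroup N] [Module Aᵐᵒᵖ N]
  {ℳ : ℤ → AddSubgroup M} {𝒩 : ℤ → AddSubgroup N}

theorem IsGradedModule.homComp_smul (hN : IsGradedModule 𝒜 𝒩) {p : ℕ} {a : A} (ha : a ∈ 𝒜 p)
    (q : ℤ) (n : N) : homComp hN.internal (q + p) (MulOpposite.op a • n)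
      = MulOpposite.op a • homComp hN.internal q n := by
  induction n using induction_homogeneous hN.internal with
  | h0 => simp
  | hom i n hn =>
    have h1 := hN.smul_mem p i a ha n hn
    by_cases hiq : i = q
    · subst hiq
      rw [homComp_of_mem _ h1, homComp_of_mem _ hn]
    · rw [homComp_of_mem_ne _ h1 (by omega), homComp_of_mem_ne _ hn hiq, smul_zero]
  | add a b ha hb => rw [smul_add, map_add, ha, hb, map_add, smul_add]

theorem homComp_comm (hM : DirectSum.IsInternal ℳ) (hN : DirectSum.IsInternal 𝒩) {g : M →+ N}
    (hg : ∀ i, ∀ m ∈ ℳ i, g m ∈ 𝒩 i) (i : ℤ) (m : M) :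
    homComp hN i (g m) = g (homComp hM i m) := by
  induction m using induction_homogeneous hM with
  | h0 => simp
  | hom j m hm =>
    by_cases hij : j = i
    · subst hij
      rw [homComp_of_mem _ (hg j m hm), homComp_of_mem _ hm]
    · rw [homComp_of_mem_ne _ (hg j m hm) hij, homComp_of_mem_ne _ hm hij, map_zero]
  | add a b ha hb => rw [map_add, map_add, ha, hb, map_add, map_add]

/-- The component of degree `j` of a linear map between graded modules. -/
theorem exists_component [GradedAlgebra 𝒜] (hM : IsGradedModule 𝒜 ℳ) (hN : IsGradedModule 𝒜 𝒩)
    (φ : M →ₗ[Aᵐᵒᵖ] N) (j : ℤ) : ∃ ψ : M →ₗ[Aᵐᵒᵖ] N,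
      ∀ i, ∀ m ∈ ℳ i, ψ m = homComp hN.internal (i + j) (φ m) := by
  obtain ⟨G, hG⟩ := exists_addHom_of_components hM.internal
    (fun i => (homComp hN.internal (i + j)).comp φ.toAddMonoidHom)
  replace hG : ∀ i, ∀ m ∈ ℳ i, G m = homComp hN.internal (i + j) (φ m) := hG
  have key : ∀ (a : A) (m : M), G (MulOpposite.op a • m) = MulOpposite.op a • G m := by
    intro a m
    induction m using induction_homogeneous hM.internal with
    | h0 => simp
    | hom i m hm =>
      induction a using DirectSum.Decomposition.inductionOn 𝒜 with
      | zero => simp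
      | @homogeneous p a =>
        rw [hG _ _ (hM.smul_mem p i a a.2 m hm), hG _ _ hm, map_smul,
          ← hN.homComp_smul a.2, add_right_comm]
      | add a b ha hb => rw [MulOpposite.op_add, add_smul, map_add, ha, hb, add_smul]
    | add m m' hm hm' => rw [smul_add, map_add, hm, hm', map_add, smul_add]
  exact ⟨{ G with map_smul' := fun a m => key a.unop m }, hG⟩

theorem linearMap_ext_homogeneous (hM : DirectSum.IsInternal ℳ) {φ ψ : M →ₗ[Aᵐᵒᵖ] N}
    (h : ∀ i, ∀ m ∈ ℳ i, φ m = ψ m) : φ = ψ := by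
  refine LinearMap.ext fun m => ?_
  induction m using induction_homogeneous hM with
  | h0 => simp
  | hom i m hm => exact h i m hm
  | add a b ha hb => rw [map_add, map_add, ha, hb]

theorem exists_lift_of_range_le [Module.Projective Aᵐᵒᵖ M] {Z : Type*} [AddCommGroup Z]
    [Module Aᵐᵒᵖ Z] (f : M →ₗ[Aᵐᵒᵖ] Z) (g : N →ₗ[Aᵐᵒᵖ] Z) (h : ∀ m, f m ∈ LinearMap.range g) :
    ∃ φ : M →ₗ[Aᵐᵒᵖ] N, g ∘ₗ φ = f := by
  obtain ⟨φ, hφ⟩ := Module.projective_lifting_property g.rangeRestrict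
    (f.codRestrict (LinearMap.range g) h) g.surjective_rangeRestrict
  refine ⟨φ, LinearMap.ext fun m => ?_⟩
  exact congrArg Subtype.val (LinearMap.congr_fun hφ m)

/-- Projectivity gives a lift without regard to degrees. Its component of degree zero is still a
lift, because `f` and `g` preserve degrees. -/
theorem exists_gradedLift [GradedAlgebra 𝒜] [Module.Projective Aᵐᵒᵖ M] {Z : Type*}
    [AddCommGroup Z] [Module Aᵐᵒᵖ Z] {𝒵 : ℤ → AddSubgroup Z} (hM : IsGradedModule 𝒜 ℳ)
    (hN : IsGradedModule 𝒜 𝒩) (hZ : IsGradedModule 𝒜 𝒵) (f : M →ₗ[Aᵐᵒᵖ] Z) (g : N →ₗ[Aᵐᵒᵖ] Z)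
    (hf : ∀ i, ∀ m ∈ ℳ i, f m ∈ 𝒵 i) (hg : ∀ i, ∀ m ∈ 𝒩 i, g m ∈ 𝒵 i)
    (h : ∀ m, f m ∈ LinearMap.range g) :
    ∃ φ : M →ₗ[Aᵐᵒᵖ] N, g ∘ₗ φ = f ∧ ∀ i, ∀ m ∈ ℳ i, φ m ∈ 𝒩 i := by
  obtain ⟨φ, hφ⟩ := exists_lift_of_range_le f g h
  obtain ⟨ψ, hψ⟩ := exists_component hM hN φ 0
  refine ⟨ψ, linearMap_ext_homogeneous hM.internal fun i m hm => ?_, fun i m hm => ?_⟩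
  · rw [LinearMap.comp_apply, hψ i m hm, add_zero]
    have h1 := homComp_comm hN.internal hZ.internal (g := g.toAddMonoidHom) hg i (φ m)
    simp only [LinearMap.toAddMonoidHom_coe] at h1
    rw [← h1, ← LinearMap.comp_apply, hφ, homComp_of_mem _ (hf i m hm)]
  · rw [hψ i m hm]
    have h1 := homComp_mem hN.internal (i + 0) (φ m)
    rwa [add_zero] at h1 ⊢

end

variable {L M N : Type u} [AddCommGroup L] [Module Aᵐᵒᵖ L] [AddCommGroup M] [Module Aᵐᵒᵖ M]
  [AddCommGroup N] [Module Aᵐᵒᵖ N] [Module k N] [SMulCommClass Aᵐᵒᵖ k N]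
  {ℒ : ℤ → AddSubgroup L} {ℳ : ℤ → AddSubgroup M} {𝒩 : ℤ → Submodule k N}

/-- A map of degree `j` that factors through a map of degree zero factors through it in degree
`j`. -/
theorem exists_gradedHom_of_factor [GradedAlgebra 𝒜] (hL : IsGradedModule 𝒜 ℒ)
    (hM : IsGradedModule 𝒜 ℳ) (hN : IsGradedModule 𝒜 fun j => (𝒩 j).toAddSubgroup)
    (d : L →ₗ[Aᵐᵒᵖ] M) (hd : ∀ i, ∀ m ∈ ℒ i, d m ∈ ℳ i) {j : ℤ} {φ : L →ₗ[Aᵐᵒᵖ] N}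
    (hφ : φ ∈ gradedHom ℒ 𝒩 j) (ψ : M →ₗ[Aᵐᵒᵖ] N) (h : ψ ∘ₗ d = φ) :
    ∃ ψ' ∈ gradedHom ℳ 𝒩 j, ψ' ∘ₗ d = φ := by
  obtain ⟨ψ', hψ'⟩ := exists_component hM hN ψ j
  refine ⟨ψ', fun i m hm => ?_, linearMap_ext_homogeneous hL.internal fun i m hm => ?_⟩
  · rw [hψ' i m hm]
    exact homComp_mem hN.internal (i + j) (ψ m)
  · rw [LinearMap.comp_apply, hψ' i _ (hd i m hm), ← LinearMap.comp_apply, h]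
    exact homComp_of_mem hN.internal (hφ i m hm)

end GradedMaps

/-! ### Comparison of resolutions -/

section Comparison

variable {k : Type v} {A : Type u} [Field k] [Ring A] [Algebra k A] {𝒜 : ℕ → Submodule k A}
  [GradedAlgebra 𝒜] {M N : Type u} [AddCommGroup M] [Module Aᵐᵒᵖ M] {ℳ : ℤ → AddSubgroup M}
  [AddCommGroup N] [Module Aᵐᵒᵖ N] [Module k N] [SMulCommClass Aᵐᵒᵖ k N]
  {𝒩 : ℤ → Submodule k N}

/-- If the resolution `Q` has length two, maps out of `Q.X 2` give classes in `Ext²` computed by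
any other resolution `P`, and only coboundaries give the zero class. -/
theorem exists_gradedHom_to_ext (hM : IsGradedModule 𝒜 ℳ)
    (hN : IsGradedModule 𝒜 fun j => (𝒩 j).toAddSubgroup) (P Q : GradedProjectiveResolution 𝒜 ℳ)
    (hQ : Function.Injective (Q.d 1)) (j : ℤ) :
    ∃ T : gradedHom (Q.deg 2) 𝒩 j →ₗ[k] P.ext 𝒩 2 j, ∀ φ, T φ = 0 →
      ∃ ψ ∈ gradedHom (Q.deg 1) 𝒩 j, ψ ∘ₗ Q.d 1 = φ.1 := by
  have := P.projective
  have := Q.projective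
  have hPd : ∀ n p, P.d n (P.d (n + 1) p) = 0 := fun n p => (P.exact_succ n).apply_apply_eq_zero p
  have hQd : ∀ n p, Q.d n (Q.d (n + 1) p) = 0 := fun n p => (Q.exact_succ n).apply_apply_eq_zero p
  have hPε : ∀ p, P.ε (P.d 0 p) = 0 := fun p => P.exact_zero.apply_apply_eq_zero p
  have hQε : ∀ p, Q.ε (Q.d 0 p) = 0 := fun p => Q.exact_zero.apply_apply_eq_zero p
  -- the comparison map from `P` to `Q`
  obtain ⟨α₀, hα₀, gα₀⟩ := exists_gradedLift (P.isGradedModule 0) (Q.isGradedModule 0) hM P.ε Q.ε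
    P.ε_mem Q.ε_mem (fun m => Q.ε_surjective _)
  obtain ⟨α₁, hα₁, gα₁⟩ := exists_gradedLift (P.isGradedModule 1) (Q.isGradedModule 1)
    (Q.isGradedModule 0) (α₀ ∘ₗ P.d 0) (Q.d 0) (fun i m hm => gα₀ i _ (P.d_mem 0 i m hm))
    (Q.d_mem 0) (fun m => (Q.exact_zero _).1 (by
      rw [LinearMap.comp_apply, ← LinearMap.comp_apply Q.ε, hα₀, hPε]))
  obtain ⟨α₂, hα₂, gα₂⟩ := exists_gradedLift (P.isGradedModule 2) (Q.isGradedModule 2)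
    (Q.isGradedModule 1) (α₁ ∘ₗ P.d 1) (Q.d 1) (fun i m hm => gα₁ i _ (P.d_mem 1 i m hm))
    (Q.d_mem 1) (fun m => (Q.exact_succ 0 _).1 (by
      rw [LinearMap.comp_apply, ← LinearMap.comp_apply (Q.d 0), hα₁, LinearMap.comp_apply, hPd,
        map_zero]))
  -- the comparison map from `Q` to `P`
  obtain ⟨β₀, hβ₀⟩ := exists_lift_of_range_le Q.ε P.ε (fun m => P.ε_surjective _)
  obtain ⟨β₁, hβ₁⟩ := exists_lift_of_range_le (β₀ ∘ₗ Q.d 0) (P.d 0) (fun m =>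
    (P.exact_zero _).1 (by rw [LinearMap.comp_apply, ← LinearMap.comp_apply P.ε, hβ₀, hQε]))
  obtain ⟨β₂, hβ₂⟩ := exists_lift_of_range_le (β₁ ∘ₗ Q.d 1) (P.d 1) (fun m =>
    (P.exact_succ 0 _).1 (by
      rw [LinearMap.comp_apply, ← LinearMap.comp_apply (P.d 0), hβ₁, LinearMap.comp_apply, hQd,
        map_zero]))
  -- the homotopy
  have eα₀ : ∀ p, Q.ε (α₀ p) = P.ε p := LinearMap.congr_fun hα₀
  have eα₁ : ∀ p, Q.d 0 (α₁ p) = α₀ (P.d 0 p) := LinearMap.congr_fun hα₁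
  have eα₂ : ∀ p, Q.d 1 (α₂ p) = α₁ (P.d 1 p) := LinearMap.congr_fun hα₂
  have eβ₀ : ∀ p, P.ε (β₀ p) = Q.ε p := LinearMap.congr_fun hβ₀
  have eβ₁ : ∀ p, P.d 0 (β₁ p) = β₀ (Q.d 0 p) := LinearMap.congr_fun hβ₁
  have eβ₂ : ∀ p, P.d 1 (β₂ p) = β₁ (Q.d 1 p) := LinearMap.congr_fun hβ₂
  obtain ⟨s₀, hs₀⟩ := exists_lift_of_range_le (α₀ ∘ₗ β₀ - LinearMap.id) (Q.d 0) (fun m =>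
    (Q.exact_zero _).1 (by simp [eα₀, eβ₀]))
  have es₀ : ∀ p, Q.d 0 (s₀ p) = α₀ (β₀ p) - p := LinearMap.congr_fun hs₀
  obtain ⟨s₁, hs₁⟩ := exists_lift_of_range_le (α₁ ∘ₗ β₁ - LinearMap.id - s₀ ∘ₗ Q.d 0) (Q.d 1)
    (fun m => (Q.exact_succ 0 _).1 (by simp [eα₁, eβ₁, es₀]))
  have es₁ : ∀ p, Q.d 1 (s₁ p) = α₁ (β₁ p) - p - s₀ (Q.d 0 p) := LinearMap.congr_fun hs₁
  -- Because `Q` stops in degree two, the homotopy relation at the top has a single correction term.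
  have key : ∀ p, α₂ (β₂ p) = p + s₁ (Q.d 1 p) := by
    intro p
    apply hQ
    rw [map_add, eα₂, eβ₂, es₁, hQd, map_zero]
    abel
  have hcoc : ∀ φ : gradedHom (Q.deg 2) 𝒩 j,
      φ.1 ∘ₗ α₂ ∈ P.cocycles 𝒩 2 j := by
    intro φ
    refine ⟨fun i m hm => φ.2 i _ (gα₂ i m hm), ?_⟩
    rw [SetLike.mem_coe, LinearMap.mem_ker]
    refine LinearMap.ext fun p => ?_
    have h0 : α₂ (P.d 2 p) = 0 := by
      apply hQ
      rw [eα₂, hPd, map_zero, map_zero]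
    change φ.1 (α₂ (P.d 2 p)) = 0
    rw [h0, map_zero]
  let T₀ : gradedHom (Q.deg 2) 𝒩 j →ₗ[k] P.cocycles 𝒩 2 j :=
    (precomp k N α₂ ∘ₗ (gradedHom (Q.deg 2) 𝒩 j).subtype).codRestrict _ hcoc
  refine ⟨(Submodule.mkQ _) ∘ₗ T₀, fun φ hφ => ?_⟩
  have hmem : T₀ φ ∈ (P.coboundaries 𝒩 2 j).submoduleOf (P.cocycles 𝒩 2 j) :=
    (Submodule.Quotient.mk_eq_zero _).1 hφ
  obtain ⟨ψ, -, hψ⟩ : (φ.1 ∘ₗ α₂) ∈ P.coboundaries 𝒩 2 j := hmem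
  have eψ : ∀ p, ψ (P.d 1 p) = φ.1 (α₂ p) := LinearMap.congr_fun hψ
  -- The maps β and s need not respect degrees; the factorization they produce is made homogeneous
  -- only here, by passing to a component.
  refine exists_gradedHom_of_factor (Q.isGradedModule 2) (Q.isGradedModule 1) hN (Q.d 1)
    (Q.d_mem 1) φ.2 (ψ ∘ₗ β₁ - φ.1 ∘ₗ s₁) (LinearMap.ext fun p => ?_)
  change ψ (β₁ (Q.d 1 p)) - φ.1 (s₁ (Q.d 1 p)) = φ.1 p
  rw [← eβ₂, eψ, key, map_add, add_sub_cancel_right]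

end Comparison

/-! ### The algebra of a connected grading as a graded module -/

section Connected

variable {k : Type v} {A : Type u} [Field k] [Ring A] [Algebra k A] (𝒜 : ℕ → Submodule k A)

theorem intGrading_of_neg {j : ℤ} (hj : j < 0) : intGrading 𝒜 j = ⊥ := by
  obtain ⟨n, rfl⟩ := Int.eq_negSucc_of_lt_zero hj
  rfl

variable [GradedAlgebra 𝒜]

theorem intGrading_mul_mem {i : ℤ} {p : ℕ} {a b : A} (ha : a ∈ intGrading 𝒜 i) (hb : b ∈ 𝒜 p) :
    a * b ∈ intGrading 𝒜 (i + p) := by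
  rcases i with n | n
  · exact SetLike.mul_mem_graded (A := 𝒜) ha hb
  · have h0 : a = 0 := ha
    rw [h0, zero_mul]
    exact Submodule.zero_mem _

theorem mul_intGrading_mem {i : ℤ} {p : ℕ} {a b : A} (ha : a ∈ 𝒜 p) (hb : b ∈ intGrading 𝒜 i) :
    a * b ∈ intGrading 𝒜 (p + i) := by
  rcases i with n | n
  · exact SetLike.mul_mem_graded (A := 𝒜) ha hb
  · have h0 : b = 0 := hb
    rw [h0, mul_zero]
    exact Submodule.zero_mem _

/-- A family of subgroups with projections onto its members is an internal decomposition. -/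
theorem isInternal_of_decompose {M : Type*} [AddCommGroup M] {ℳ : ℤ → AddSubgroup M}
    (F : ℤ → M →+ M) (hF : ∀ i m, F i m ∈ ℳ i) (hFm : ∀ i, ∀ m ∈ ℳ i, F i m = m)
    (hFn : ∀ i j, i ≠ j → ∀ m ∈ ℳ i, F j m = 0)
    (hs : ∀ m, ∃ t : Finset ℤ, m = ∑ i ∈ t, F i m) : DirectSum.IsInternal ℳ := by
  classical
  constructor
  · refine (injective_iff_map_eq_zero _).2 fun z hz => ?_
    have key : ∀ j (z : ⨁ i, ℳ i), F j (DirectSum.coeAddMonoidHom ℳ z) = z j := by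
      intro j z
      induction z using DirectSum.induction_on with
      | zero => simp
      | of i m =>
        rw [DirectSum.coeAddMonoidHom_of]
        by_cases hij : i = j
        · subst hij
          rw [hFm _ _ m.2, DirectSum.of_eq_same]
        · rw [hFn _ _ hij _ m.2, DirectSum.of_eq_of_ne _ _ _ (Ne.symm hij), ZeroMemClass.coe_zero]
      | add a b ha hb => rw [map_add, map_add, ha, hb, DirectSum.add_apply, AddMemClass.coe_add]
    refine DFinsupp.ext fun j => Subtype.ext ?_
    rw [← key, hz, map_zero]
    rfl
  · intro m
    obtain ⟨t, ht⟩ := hs m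
    refine ⟨∑ i ∈ t, DirectSum.of (fun i => ℳ i) i ⟨F i m, hF i m⟩, ?_⟩
    rw [map_sum]
    simp only [DirectSum.coeAddMonoidHom_of]
    exact ht.symm

/-- The projections onto the components of `intGrading`. -/
def intProj : ℤ → A →ₗ[k] A
  | Int.ofNat n => GradedAlgebra.proj 𝒜 n
  | Int.negSucc _ => 0

theorem intProj_mem (i : ℤ) (a : A) : intProj 𝒜 i a ∈ intGrading 𝒜 i := by
  rcases i with n | n
  · exact SetLike.coe_mem _
  · exact Submodule.zero_mem _

theorem intProj_of_mem (i : ℤ) {a : A} (ha : a ∈ intGrading 𝒜 i) : intProj 𝒜 i a = a := by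
  rcases i with n | n
  · exact DirectSum.decompose_of_mem_same 𝒜 ha
  · have h0 : a = 0 := ha
    rw [h0, map_zero]

theorem intProj_of_mem_ne {i j : ℤ} (hij : i ≠ j) {a : A} (ha : a ∈ intGrading 𝒜 i) :
    intProj 𝒜 j a = 0 := by
  rcases i with n | n
  · rcases j with m | m
    · exact DirectSum.decompose_of_mem_ne 𝒜 ha (fun h => hij (congrArg Int.ofNat h))
    · rfl
  · have h0 : a = 0 := ha
    rw [h0, map_zero]

theorem exists_sum_proj (a : A) :
    ∃ N, ∀ N' ≥ N, a = ∑ m ∈ Finset.range N', GradedAlgebra.proj 𝒜 m a := by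
  classical
  refine ⟨(DirectSum.decompose 𝒜 a).support.sup id + 1, fun N' hN' => ?_⟩
  conv_lhs => rw [← DirectSum.sum_support_decompose 𝒜 a]
  refine Finset.sum_subset (fun i hi => ?_) fun i _ hi => ?_
  · have := Finset.le_sup (f := id) hi
    simp only [id] at this
    exact Finset.mem_range.2 (by omega)
  · rw [DFinsupp.notMem_support_iff] at hi
    rw [hi, ZeroMemClass.coe_zero]

variable (r : ℕ)

/-- The free module of rank `r` with generators in degree `s`. -/
def shiftDeg (s : ℤ) (j : ℤ) : AddSubgroup (Fin r → A) where
  carrier := {a | ∀ p, a p ∈ intGrading 𝒜 (j - s)}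
  add_mem' ha hb p := Submodule.add_mem _ (ha p) (hb p)
  zero_mem' _ := Submodule.zero_mem _
  neg_mem' ha p := Submodule.neg_mem _ (ha p)

theorem isGradedModule_shiftDeg (s : ℤ) : IsGradedModule 𝒜 (shiftDeg 𝒜 r s) where
  internal := by
    refine isInternal_of_decompose
      (fun i => (LinearMap.compLeft (intProj 𝒜 (i - s)) (Fin r)).toAddMonoidHom)
      (fun i m _ => intProj_mem 𝒜 _ _) (fun i m hm => funext fun p => intProj_of_mem 𝒜 _ (hm p))
      (fun i j hij m hm => funext fun p => intProj_of_mem_ne 𝒜 (by omega) (hm p)) (fun m => ?_)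
    choose N hN using fun p => exists_sum_proj 𝒜 (m p)
    refine ⟨(Finset.range (Finset.univ.sup N)).image (fun q : ℕ => (q : ℤ) + s), funext fun p => ?_⟩
    rw [Finset.sum_image (fun a _ b _ h => by simpa using h), Finset.sum_apply]
    have h1 := hN p (Finset.univ.sup N) (Finset.le_sup (Finset.mem_univ p))
    refine h1.trans (Finset.sum_congr rfl fun q _ => ?_)
    simp only [add_sub_cancel_right]
    rfl
  smul_mem i j a ha m hm p := by
    have h1 := intGrading_mul_mem 𝒜 (hm p) ha
    rw [show j - s + i = j + i - s by ring] at h1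
    exact h1

theorem isGradedModule_intGrading :
    IsGradedModule 𝒜 fun j => (intGrading 𝒜 j).toAddSubgroup where
  internal := by
    refine isInternal_of_decompose (fun i => (intProj 𝒜 i).toAddMonoidHom)
      (fun i m => intProj_mem 𝒜 _ _) (fun i m hm => intProj_of_mem 𝒜 _ hm)
      (fun i j hij m hm => intProj_of_mem_ne 𝒜 hij hm) (fun m => ?_)
    obtain ⟨N, hN⟩ := exists_sum_proj 𝒜 m
    refine ⟨(Finset.range N).image (fun q : ℕ => (q : ℤ)), ?_⟩
    rw [Finset.sum_image (fun a _ b _ h => by simpa using h)]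
    exact hN N le_rfl
  smul_mem i j a ha m hm := intGrading_mul_mem 𝒜 hm ha

theorem isGradedModule_residue : IsGradedModule 𝒜 (residueGrading 𝒜) where
  internal := by
    refine isInternal_of_decompose (fun i => if i = 0 then AddMonoidHom.id _ else 0)
      (fun i m => ?_) (fun i m hm => ?_) (fun i j hij m hm => ?_) (fun m => ⟨{0}, by simp⟩)
    · by_cases hi : i = 0 <;> simp [residueGrading, hi]
    · by_cases hi : i = 0
      · simp [hi]
      · simp only [residueGrading, hi, if_false, AddSubgroup.mem_bot] at hm
        simp [hm]
    · by_cases hi : i = 0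
      · simp [show j ≠ 0 by omega]
      · simp only [residueGrading, hi, if_false, AddSubgroup.mem_bot] at hm
        simp [hm]
  smul_mem i j a ha m hm := by
    by_cases hij : j + i = 0
    · simp [residueGrading, hij]
    · by_cases hj : j = 0
      · subst hj
        obtain ⟨b, rfl⟩ := Submodule.Quotient.mk_surjective _ m
        -- Elements of positive degree act by zero; the degree is positive since j + i ≠ 0 and j =
        -- 0.
        have h0 : (Submodule.Quotient.mk (b * a) : residue 𝒜) = 0 := by
          rw [Submodule.Quotient.mk_eq_zero]
          change GradedRing.projZeroRingHom 𝒜 (b * a) = 0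
          rw [map_mul]
          have h1 : GradedRing.projZeroRingHom 𝒜 a = 0 :=
            DirectSum.decompose_of_mem_ne 𝒜 ha (by omega)
          rw [h1, mul_zero]
        change (Submodule.Quotient.mk (b * a) : residue 𝒜) ∈ _
        rw [h0]
        exact AddSubgroup.zero_mem _
      · simp only [residueGrading, hj, if_false, AddSubgroup.mem_bot] at hm
        rw [hm, smul_zero]
        exact AddSubgroup.zero_mem _

end Connected

/-! ### Linear resolutions of length two -/

section FreeModules

variable {A : Type u} [Ring A]

instance free_mulOpposite_self : Module.Free Aᵐᵒᵖ A :=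
  Module.Free.of_equiv (LinearEquiv.ofBijective (LinearMap.toSpanSingleton Aᵐᵒᵖ A 1)
    ⟨fun a b h => by
      have h1 : a • (1 : A) = b • (1 : A) := h
      rw [← MulOpposite.op_unop a, ← MulOpposite.op_unop b, op_smul_eq_mul, op_smul_eq_mul,
        one_mul, one_mul] at h1
      exact MulOpposite.unop_injective h1,
    fun a => ⟨MulOpposite.op a, by
      rw [LinearMap.toSpanSingleton_apply, op_smul_eq_mul, one_mul]⟩⟩)

/-- Left multiplication by a matrix, as a map of right modules. -/
def matMap {r s : ℕ} (m : Fin r → Fin s → A) : (Fin s → A) →ₗ[Aᵐᵒᵖ] (Fin r → A) where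
  toFun a p := ∑ q, m p q * a q
  map_add' a b := funext fun p => by simp [mul_add, Finset.sum_add_distrib]
  map_smul' c a := funext fun p => by
    rw [← MulOpposite.op_unop c]
    simp [Finset.sum_mul, mul_assoc]

theorem matMap_apply {r s : ℕ} (m : Fin r → Fin s → A) (a : Fin s → A) (p : Fin r) :
    matMap m a p = ∑ q, m p q * a q := rfl

theorem linearMap_apply_eq_sum {r : ℕ} (φ : (Fin r → A) →ₗ[Aᵐᵒᵖ] A) (a : Fin r → A) :
    φ a = ∑ p, φ (Pi.single p 1) * a p := by
  have h1 : a = ∑ p, MulOpposite.op (a p) • (Pi.single p 1 : Fin r → A) := by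
    conv_lhs => rw [← Finset.univ_sum_single a]
    refine Finset.sum_congr rfl fun p _ => ?_
    rw [← Pi.single_smul, op_smul_eq_mul, one_mul]
  conv_lhs => rw [h1]
  simp only [map_sum, map_smul, op_smul_eq_mul]

end FreeModules

section LinearResolution

variable {k : Type v} {A : Type u} [Field k] [Ring A] [Algebra k A]

/-- The beginning of a resolution of the right module `A / A_+`: `A_+` is generated by the `x j`,
and the relations between the `x j` are generated by the `y s`. -/
structure LinPres (𝒜 : ℕ → Submodule k A) [GradedAlgebra 𝒜] {n t : ℕ} (x : Fin n → A)
    (y : Fin t → Fin n → A) : Prop where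
  x_mem : ∀ j, x j ∈ 𝒜 1
  y_mem : ∀ s j, y s j ∈ 𝒜 1
  rel : ∀ s, ∑ j, x j * y s j = 0
  gen : ∀ a, GradedRing.projZeroRingHom 𝒜 a = 0 → ∃ c : Fin n → A, a = ∑ j, x j * c j
  syz : ∀ a : Fin n → A, ∑ j, x j * a j = 0 → ∃ z : Fin t → A, ∀ j, a j = ∑ s, y s j * z s

/-- The syzygies of the right module `A / A_+`: in addition, the `y s` are independent. -/
structure LinSyz (𝒜 : ℕ → Submodule k A) [GradedAlgebra 𝒜] {n t : ℕ} (x : Fin n → A)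
    (y : Fin t → Fin n → A) : Prop extends LinPres 𝒜 x y where
  inj : ∀ z : Fin t → A, (∀ j, ∑ s, y s j * z s = 0) → z = 0

/-- The ranks of the free modules in a linear resolution of length two. -/
def linRank (n t : ℕ) : ℕ → ℕ
  | 0 => 1
  | 1 => n
  | 2 => t
  | _ + 3 => 0

/-- The matrices of a linear resolution of length two. -/
def linMat {n t : ℕ} (x : Fin n → A) (y : Fin t → Fin n → A) :
    ∀ i, Fin (linRank n t i) → Fin (linRank n t (i + 1)) → A
  | 0 => fun _ j => x j
  | 1 => fun j s => y s j
  | _ + 2 => fun _ _ => 0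

variable {𝒜 : ℕ → Submodule k A} [GradedAlgebra 𝒜] {n t : ℕ} {x : Fin n → A}
  {y : Fin t → Fin n → A}

theorem matMap_mem {r r' : ℕ} (m : Fin r → Fin r' → A) (hm : ∀ p q, m p q ∈ 𝒜 1) (s : ℤ) (j : ℤ)
    {a : Fin r' → A} (ha : a ∈ shiftDeg 𝒜 r' (s + 1) j) : matMap m a ∈ shiftDeg 𝒜 r s j := by
  intro p
  rw [matMap_apply]
  refine (intGrading 𝒜 (j - s)).sum_mem fun q _ => ?_
  have h1 := mul_intGrading_mem 𝒜 (hm p q) (ha q)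
  rw [show ((1 : ℕ) : ℤ) + (j - (s + 1)) = j - s by push_cast; ring] at h1
  exact h1

variable (𝒜) in
/-- The augmentation of a linear resolution. -/
def linAug : (Fin 1 → A) →ₗ[Aᵐᵒᵖ] residue 𝒜 :=
  (plusPart 𝒜).mkQ ∘ₗ LinearMap.proj 0

theorem linAug_apply (a : Fin 1 → A) : linAug 𝒜 a = Submodule.Quotient.mk (a 0) := rfl

theorem linAug_surjective : Function.Surjective (linAug 𝒜) := fun b => by
  obtain ⟨a, rfl⟩ := Submodule.Quotient.mk_surjective _ b
  exact ⟨fun _ => a, rfl⟩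

theorem mem_plusPart_iff (a : A) : a ∈ plusPart 𝒜 ↔ GradedRing.projZeroRingHom 𝒜 a = 0 := Iff.rfl

theorem projZero_of_mem {p : ℕ} (hp : p ≠ 0) {a : A} (ha : a ∈ 𝒜 p) :
    GradedRing.projZeroRingHom 𝒜 a = 0 :=
  DirectSum.decompose_of_mem_ne 𝒜 ha hp

theorem linAug_eq_zero_iff (a : Fin 1 → A) :
    linAug 𝒜 a = 0 ↔ GradedRing.projZeroRingHom 𝒜 (a 0) = 0 := by
  rw [linAug_apply, Submodule.Quotient.mk_eq_zero, mem_plusPart_iff]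

theorem linAug_exact (h : LinPres 𝒜 x y) :
    Function.Exact (matMap (linMat x y 0)) (linAug 𝒜) := by
  intro a
  refine (linAug_eq_zero_iff a).trans ?_
  constructor
  · intro ha
    obtain ⟨c, hc⟩ := h.gen _ ha
    refine ⟨c, funext fun p => ?_⟩
    have hp : p = (0 : Fin 1) := Subsingleton.elim (α := Fin 1) p 0
    rw [hp]
    exact hc.symm
  · rintro ⟨c, rfl⟩
    change GradedRing.projZeroRingHom 𝒜 (∑ j, x j * c j) = 0
    rw [map_sum]
    refine Finset.sum_eq_zero fun j _ => ?_
    rw [map_mul, projZero_of_mem one_ne_zero (h.x_mem j), zero_mul]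

theorem linD_exact_one (h : LinPres 𝒜 x y) :
    Function.Exact (matMap (linMat x y 1)) (matMap (linMat x y 0)) := by
  intro a
  constructor
  · intro ha
    obtain ⟨z, hz⟩ := h.syz a (congrFun ha (0 : Fin 1))
    exact ⟨z, funext fun j => (hz j).symm⟩
  · rintro ⟨z, rfl⟩
    funext p
    change ∑ j, x j * ∑ s, y s j * z s = 0
    simp only [Finset.mul_sum, ← mul_assoc]
    rw [Finset.sum_comm]
    simp only [← Finset.sum_mul, h.rel, zero_mul, Finset.sum_const_zero]

theorem linD_injective (h : LinSyz 𝒜 x y) : Function.Injective (matMap (linMat x y 1)) :=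
  (injective_iff_map_eq_zero _).2 fun z hz => h.inj z fun j => congrFun hz j

/-- The linear resolution of the right module `A / A_+` given by its syzygies. -/
def linearResolution (h : LinSyz 𝒜 x y) : GradedProjectiveResolution 𝒜 (residueGrading 𝒜) where
  X i := Fin (linRank n t i) → A
  deg i := shiftDeg 𝒜 (linRank n t i) i
  isGradedModule i := isGradedModule_shiftDeg 𝒜 _ _
  projective i := inferInstance
  d i := matMap (linMat x y i)
  d_mem i j a ha := by
    refine matMap_mem _ (fun p q => ?_) i j (by exact_mod_cast ha)
    match i with
    | 0 => exact h.x_mem q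
    | 1 => exact h.y_mem q p
    | _ + 2 => exact Submodule.zero_mem _
  ε := linAug 𝒜
  ε_mem j a ha := by
    by_cases hj : j = 0
    · simp [residueGrading, hj]
    · have h0 : linAug 𝒜 a = 0 := by
        refine (linAug_eq_zero_iff a).2 ?_
        have h1 : a (0 : Fin 1) ∈ intGrading 𝒜 (j - ((0 : ℕ) : ℤ)) := ha (0 : Fin 1)
        rw [Nat.cast_zero, sub_zero] at h1
        have h2 := intProj_of_mem_ne 𝒜 (j := 0) hj h1
        exact h2
      exact h0 ▸ AddSubgroup.zero_mem _
  ε_surjective := linAug_surjective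
  exact_zero := linAug_exact h.toLinPres
  exact_succ i := by
    match i with
    | 0 => exact linD_exact_one h.toLinPres
    | 1 =>
      intro z
      constructor
      · intro hz
        have h0 : z = 0 := linD_injective h (hz.trans (map_zero _).symm)
        exact ⟨0, by rw [h0, map_zero]⟩
      · rintro ⟨a, rfl⟩
        have h0 : a = 0 := funext fun p : Fin 0 => p.elim0
        rw [h0, map_zero, map_zero]
    | i + 2 =>
      intro z
      have h0 : z = 0 := funext fun p : Fin 0 => p.elim0
      rw [h0]
      exact ⟨fun _ => ⟨0, map_zero _⟩, fun _ => map_zero _⟩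

end LinearResolution

/-! ### Syzygies from a quadratic presentation -/

section Connected

variable {k : Type v} {A : Type u} [Field k] [Ring A] [Algebra k A] {𝒜 : ℕ → Submodule k A}

/-- The left-handed description of syzygies, applied to the opposite presentation. -/
theorem QuadPres.op_exists {n t : ℕ} {x : Fin n → A} {l : Fin t → Matrix (Fin n) (Fin n) k}
    (h : QuadPres.{v, u, max u v} x l) {a : Fin n → A} (ha : ∑ i, x i * a i = 0) :
    ∃ z : Fin t → A, ∀ j, a j = ∑ s, (∑ i, l s j i • x i) * z s := by
  obtain ⟨z, hz⟩ := h.op.exists_of_sum_mul_eq_zero (a := fun i => MulOpposite.op (a i)) (by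
    simp only [← MulOpposite.op_mul, ← Finset.op_sum, ha, MulOpposite.op_zero])
  refine ⟨fun s => (z s).unop, fun j => ?_⟩
  have h1 := congrArg MulOpposite.unop (hz j)
  simp only [MulOpposite.unop_op, Finset.unop_sum, MulOpposite.unop_smul,
    MulOpposite.unop_mul, Matrix.transpose_apply] at h1
  simp only [Finset.sum_mul, smul_mul_assoc]
  exact h1

/-- Passage to coordinates. The family `f` need only consist of relations and span `F`, so it can be
a basis of all relations or one relation alone. -/
theorem HasPresentation.quadPres {F : Set (𝒜 1 ⊗[k] 𝒜 1)} (hF : HasPresentation 𝒜 F)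
    {σ ι : Type} [Fintype ι] (b : Module.Basis ι k (𝒜 1)) (f : σ → 𝒜 1 ⊗[k] 𝒜 1)
    (hf : ∀ s, canonicalMap 𝒜 (tensorSquare k (𝒜 1) (f s)) = 0)
    (hF' : F ⊆ Submodule.span k (Set.range f)) :
    QuadPres.{v, u, w} (fun i => (b i : A)) (fun s => coeffMatrix b (f s)) where
  adjoin := by
    rw [eq_top_iff]
    intro a _
    obtain ⟨t, rfl⟩ := hF.1 a
    induction t using TensorAlgebra.induction with
    | algebraMap r => rw [AlgHom.commutes]; exact Subalgebra.algebraMap_mem _ r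
    | ι v =>
      have h1 : canonicalMap 𝒜 (TensorAlgebra.ι k v) = ∑ i, b.repr v i • (b i : A) := by
        rw [canonicalMap, TensorAlgebra.lift_ι_apply]
        have h2 := congrArg (𝒜 1).subtype (b.sum_repr v)
        simp only [map_sum, map_smul, Submodule.subtype_apply] at h2
        exact h2.symm
      rw [h1]
      exact Subalgebra.sum_mem _ fun i _ => Subalgebra.smul_mem _
        (Algebra.subset_adjoin (Set.mem_range_self i)) _
    | mul a b ha hb => rw [map_mul]; exact Subalgebra.mul_mem _ (ha trivial) (hb trivial)
    | add a b ha hb => rw [map_add]; exact Subalgebra.add_mem _ (ha trivial) (hb trivial)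
  rel s := by
    have h1 := hf s
    rw [sum_coeffMatrix b (f s)] at h1
    simpa [tensorSquare_tmul, canonicalMap] using h1
  lift B _ _ g hg := by
    have key : ∀ s, TensorAlgebra.lift k (b.constr k g) (tensorSquare k (𝒜 1) (f s)) = 0 := by
      intro s
      rw [sum_coeffMatrix b (f s)]
      simpa only [tensorSquare_tmul, map_sum, map_smul, map_mul, TensorAlgebra.lift_ι_apply,
        Module.Basis.constr_basis] using hg s
    obtain ⟨h, hh⟩ := hF.exists_lift (b.constr k g) (fun f' hf' => by
      have h1 := hF' hf'
      clear hf'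
      induction h1 using Submodule.span_induction with
      | mem x hx =>
        obtain ⟨s, rfl⟩ := hx
        exact key s
      | zero => simp
      | add x y _ _ hx hy => rw [map_add, map_add, hx, hy, add_zero]
      | smul c x _ hx => rw [map_smul, map_smul, hx, smul_zero])
    exact ⟨h, fun i => by rw [hh, Module.Basis.constr_basis]⟩

variable [GradedAlgebra 𝒜]

theorem degreeProj {ι : Type} (x : ι → A) (hx : ∀ i, x i ∈ 𝒜 1) :
    DegreeProj x (fun m => GradedAlgebra.proj 𝒜 m) where
  succ m s i := DirectSum.coe_decompose_mul_add_of_right_mem 𝒜 (hx i)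
  zero s i := DirectSum.coe_decompose_mul_of_right_mem_of_not_le 𝒜 (hx i) (by omega)
  idem m s := DirectSum.decompose_of_mem_same 𝒜 (SetLike.coe_mem _)
  sum s := exists_sum_proj 𝒜 s

theorem degreeProj_op {ι : Type} (x : ι → A) (hx : ∀ i, x i ∈ 𝒜 1) :
    DegreeProj (fun i => MulOpposite.op (x i)) (fun m =>
      (MulOpposite.opLinearEquiv k).toLinearMap ∘ₗ GradedAlgebra.proj 𝒜 m ∘ₗ
        (MulOpposite.opLinearEquiv k).symm.toLinearMap) where
  succ m s i := by
    have h1 := DirectSum.coe_decompose_mul_add_of_left_mem 𝒜 (j := m) (b := s.unop) (hx i)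
    rw [add_comm] at h1
    exact congrArg MulOpposite.op h1
  zero s i := by
    have h1 := DirectSum.coe_decompose_mul_of_left_mem_of_not_le 𝒜 (n := 0) (b := s.unop) (hx i)
      (by omega)
    exact congrArg MulOpposite.op h1
  idem m s := congrArg MulOpposite.op
    (DirectSum.decompose_of_mem_same 𝒜 (SetLike.coe_mem _))
  sum s := by
    obtain ⟨N, hN⟩ := exists_sum_proj 𝒜 s.unop
    refine ⟨N, fun N' hN' => ?_⟩
    have h1 := congrArg MulOpposite.op (hN N' hN')
    rw [Finset.op_sum] at h1
    exact h1

end Connected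

/-! ### Global dimension two from a relation of maximal rank -/

/-- By exactness `d` maps onto the projective module ker e, so it has a section σ there; the
retraction onto ker d is id - σd. -/
theorem exists_retraction_ker {S B C D : Type*} [Ring S] [AddCommGroup B] [Module S B]
    [AddCommGroup C] [Module S C] [AddCommGroup D] [Module S D] (d : B →ₗ[S] C) (e : C →ₗ[S] D)
    (h : Function.Exact d e) (hproj : Module.Projective S (LinearMap.ker e)) :
    ∃ p : B →ₗ[S] B, (∀ b, d (p b) = 0) ∧ ∀ b, d b = 0 → p b = b := by
  have hmem : ∀ b, d b ∈ LinearMap.ker e := fun b => (h _).2 ⟨b, rfl⟩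
  obtain ⟨σ, hσ⟩ := Module.projective_lifting_property (d.codRestrict (LinearMap.ker e) hmem)
    LinearMap.id (by
      rintro ⟨c, hc⟩
      obtain ⟨b, rfl⟩ := (h c).1 hc
      exact ⟨b, rfl⟩)
  have hσ' : ∀ c, d (σ c) = c.1 := fun c => congrArg Subtype.val (LinearMap.congr_fun hσ c)
  refine ⟨LinearMap.id - σ ∘ₗ d.codRestrict (LinearMap.ker e) hmem, fun b => ?_, fun b hb => ?_⟩
  · rw [LinearMap.sub_apply, LinearMap.comp_apply, map_sub, hσ']
    exact sub_self _
  · have h1 : d.codRestrict (LinearMap.ker e) hmem b = 0 := Subtype.ext hb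
    rw [LinearMap.sub_apply, LinearMap.comp_apply, h1, map_zero, sub_zero, LinearMap.id_apply]

section LinearSyzygies

variable {k : Type v} {A : Type u} [Field k] [Ring A] [Algebra k A] {𝒜 : ℕ → Submodule k A}
  {n : ℕ} {x : Fin n → A}

theorem QuadPres.exists_eq_add_sum_mul {σ : Type} {l : σ → Matrix (Fin n) (Fin n) k}
    (h : QuadPres.{v, u, w} x l) (a : A) :
    ∃ (r : k) (c : Fin n → A), a = algebraMap k A r + ∑ j, x j * c j := by
  induction a using h.induction_mul with
  | hk r => exact ⟨r, 0, by simp⟩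
  | hx i => exact ⟨0, Pi.single i 1, by simp [Pi.single_apply]⟩
  | hadd a b ha hb =>
    obtain ⟨r, c, rfl⟩ := ha
    obtain ⟨r', c', rfl⟩ := hb
    refine ⟨r + r', c + c', ?_⟩
    simp only [map_add, Pi.add_apply, mul_add, Finset.sum_add_distrib]
    abel
  | hmul a b ha hb =>
    obtain ⟨r, c, rfl⟩ := ha
    obtain ⟨r', c', rfl⟩ := hb
    have h1 : ∑ j, x j * (algebraMap k A r * c' j) = algebraMap k A r * ∑ j, x j * c' j := by
      simp only [Finset.mul_sum, ← mul_assoc, Algebra.commutes r (x _)]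
    refine ⟨r * r', fun j => algebraMap k A r * c' j +
      c j * (algebraMap k A r' + ∑ i, x i * c' i), ?_⟩
    generalize hb : algebraMap k A r' + ∑ i, x i * c' i = b
    have h2 : ∑ j, x j * (c j * b) = (∑ j, x j * c j) * b := by
      simp only [Finset.sum_mul, mul_assoc]
    simp only [mul_add, Finset.sum_add_distrib]
    rw [h1, h2, add_mul, ← hb, mul_add, map_mul, add_assoc]

variable [GradedAlgebra 𝒜]

theorem projZero_algebraMap (r : k) :
    GradedRing.projZeroRingHom 𝒜 (algebraMap k A r) = algebraMap k A r :=
  DirectSum.decompose_of_mem_same 𝒜 (SetLike.algebraMap_mem_graded 𝒜 r)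

theorem projZero_sum_mul_right (hx : ∀ j, x j ∈ 𝒜 1) (c : Fin n → A) :
    GradedRing.projZeroRingHom 𝒜 (∑ j, x j * c j) = 0 := by
  rw [map_sum]
  refine Finset.sum_eq_zero fun j _ => ?_
  rw [map_mul, projZero_of_mem one_ne_zero (hx j), zero_mul]

theorem projZero_sum_mul_left (hx : ∀ j, x j ∈ 𝒜 1) (c : Fin n → A) :
    GradedRing.projZeroRingHom 𝒜 (∑ j, c j * x j) = 0 := by
  rw [map_sum]
  refine Finset.sum_eq_zero fun j _ => ?_
  rw [map_mul, projZero_of_mem one_ne_zero (hx j), mul_zero]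

theorem QuadPres.exists_sum_mul_right {σ : Type} {l : σ → Matrix (Fin n) (Fin n) k}
    (h : QuadPres.{v, u, w} x l) (hx : ∀ j, x j ∈ 𝒜 1) {a : A}
    (ha : GradedRing.projZeroRingHom 𝒜 a = 0) : ∃ c : Fin n → A, a = ∑ j, x j * c j := by
  obtain ⟨r, c, rfl⟩ := h.exists_eq_add_sum_mul a
  rw [map_add, projZero_sum_mul_right hx, add_zero, projZero_algebraMap] at ha
  exact ⟨c, by rw [ha, zero_add]⟩

theorem QuadPres.exists_sum_mul_left {σ : Type} {l : σ → Matrix (Fin n) (Fin n) k}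
    (h : QuadPres.{v, u, w} x l) (hx : ∀ j, x j ∈ 𝒜 1) {a : A}
    (ha : GradedRing.projZeroRingHom 𝒜 a = 0) : ∃ c : Fin n → A, a = ∑ j, c j * x j := by
  obtain ⟨r, c, hc⟩ := h.op.exists_eq_add_sum_mul (MulOpposite.op a)
  have h1 := congrArg MulOpposite.unop hc
  simp only [MulOpposite.unop_op, MulOpposite.unop_add, Finset.unop_sum, MulOpposite.unop_mul,
    MulOpposite.algebraMap_apply] at h1
  rw [h1, map_add, projZero_sum_mul_left hx, add_zero, projZero_algebraMap] at ha
  exact ⟨fun j => (c j).unop, by rw [h1, ha, zero_add]⟩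

/-- The linear forms `∑ i, l s j i • x i`, the coefficients of `x j` in the relations. -/
def linForm {σ : Type} (x : Fin n → A) (l : σ → Matrix (Fin n) (Fin n) k) (s : σ) (j : Fin n) : A :=
  ∑ i, l s j i • x i

theorem QuadPres.linPres {t : ℕ} {l : Fin t → Matrix (Fin n) (Fin n) k}
    (h : QuadPres.{v, u, max u v} x l) (hx : ∀ j, x j ∈ 𝒜 1) : LinPres 𝒜 x (linForm x l) where
  x_mem := hx
  y_mem s j := Submodule.sum_mem _ fun i _ => Submodule.smul_mem _ _ (hx i)
  rel s := by
    simpa only [linForm, Finset.mul_sum, mul_smul_comm] using h.rel s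
  gen a ha := h.exists_sum_mul_right hx ha
  syz a ha := h.op_exists ha

/-- One coordinate suffices: a row of the invertible matrix L is a nonzero linear form, and the
statement on zero divisors holds for the opposite algebra too. -/
theorem linForm_mul_injective {L : Matrix (Fin n) (Fin n) k}
    (h : QuadPres.{v, u, max u v} x (fun _ : Unit => L)) (hx : ∀ j, x j ∈ 𝒜 1) (hL : IsUnit L)
    (hn : 2 ≤ n) (z : Fin 1 → A)
    (hz : ∀ j, ∑ s, linForm x (fun _ : Fin 1 => L) s j * z s = 0) : z = 0 := by
  have hL' : IsUnit L.transpose := (Matrix.isUnit_transpose L).2 hL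
  have h1 : MulOpposite.op (z 0) = 0 := by
    refine eq_zero_of_mul_linear_eq_zero h.op (degreeProj_op x hx) hL' (by simpa using hn)
      (c := L ⟨0, by omega⟩) (fun h0 => ?_) ?_
    · have h2 := (Matrix.isUnit_iff_isUnit_det L).1 hL
      rw [Matrix.det_eq_zero_of_row_eq_zero (⟨0, by omega⟩ : Fin n) (congrFun h0)] at h2
      exact not_isUnit_zero h2
    · have h2 := congrArg MulOpposite.op (hz ⟨0, by omega⟩)
      rw [Fin.sum_univ_one, MulOpposite.op_mul, linForm, Finset.op_sum] at h2
      exact h2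
  funext s
  rw [Subsingleton.elim s 0]
  exact MulOpposite.op_injective h1

variable {t : ℕ} {y : Fin t → Fin n → A}

/-- Minimality obstructs splitting: a left inverse would write 1 as a combination of the entries of
y, which have degree one, while 1 has degree zero. -/
theorem linD_split (h : LinSyz 𝒜 x y) (φ : (Fin n → A) →ₗ[Aᵐᵒᵖ] (Fin t → A))
    (hφ : φ ∘ₗ matMap (linMat x y 1) = LinearMap.id) (ht : 0 < t) : (1 : A) = 0 := by
  have h1 := congrFun (LinearMap.congr_fun hφ (Pi.single ⟨0, ht⟩ 1)) ⟨0, ht⟩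
  replace h1 := h1.trans (Pi.single_eq_same (M := fun _ : Fin t => A) ⟨0, ht⟩ 1)
  have h3 : ∀ j, matMap (linMat x y 1) (Pi.single (⟨0, ht⟩ : Fin t) 1) j = y ⟨0, ht⟩ j := by
    intro j
    change ∑ s, y s j * (Pi.single (⟨0, ht⟩ : Fin t) 1 : Fin t → A) s = _
    rw [Finset.sum_eq_single ⟨0, ht⟩, Pi.single_eq_same, mul_one]
    · intro s _ hs
      rw [Pi.single_eq_of_ne hs, mul_zero]
    · simp
  have h4 := projZero_sum_mul_left (h.y_mem ⟨0, ht⟩)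
    (fun p => (LinearMap.proj (⟨0, ht⟩ : Fin t) ∘ₗ φ) (Pi.single p 1))
  have h5 : (1 : A) = ∑ p, (LinearMap.proj (⟨0, ht⟩ : Fin t) ∘ₗ φ) (Pi.single p 1) * y ⟨0, ht⟩ p :=
    h1.symm.trans ((linearMap_apply_eq_sum (LinearMap.proj (⟨0, ht⟩ : Fin t) ∘ₗ φ) _).trans
      (Finset.sum_congr rfl fun p _ => congrArg _ (h3 p)))
  rw [← h5, map_one] at h4
  exact h4

/-- If k had projective dimension at most one, A_+ would be projective, the kernel of A^n → A would
be a direct summand, and the injective second differential would split, contrary to `linD_split`. -/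
theorem two_le_globalDimension [Nontrivial A] (h : LinSyz 𝒜 x y) (ht : 0 < t) :
    2 ≤ globalDimension A := by
  refine le_trans ?_ (le_iSup (fun M : ModuleCat.{u} Aᵐᵒᵖ =>
    CategoryTheory.projectiveDimension M) (ModuleCat.of Aᵐᵒᵖ (residue 𝒜)))
  refine (CategoryTheory.projectiveDimension_ge_iff _ 2).2 fun hpd => ?_
  have hproj := (hasProjectiveDimensionLT_two_iff (linAug 𝒜)
    (linearResolution h).ε_surjective).1 hpd
  obtain ⟨p, hp0, hp⟩ := exists_retraction_ker _ _ (linAug_exact h.toLinPres) hproj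
  obtain ⟨φ, hφ⟩ := exists_lift_of_range_le p (matMap (linMat x y 1)) fun m =>
    (linD_exact_one h.toLinPres _).1 (hp0 m)
  refine one_ne_zero (linD_split h φ (LinearMap.ext fun z => linD_injective h ?_) ht)
  exact (LinearMap.congr_fun hφ (matMap (linMat x y 1) z)).trans
    (hp _ ((linD_exact_one h.toLinPres _).2 ⟨z, rfl⟩))

theorem globalDimension_le_two {L : Matrix (Fin n) (Fin n) k}
    (h : QuadPres.{v, u, max u v} x (fun _ : Unit => L))
    (h' : QuadPres.{v, u, u} x (fun _ : Unit => L)) (hx : ∀ j, x j ∈ 𝒜 1) (hL : IsUnit L)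
    (hn : 2 ≤ n) : globalDimension A ≤ 2 := by
  have : Nonempty (Fin n) := ⟨⟨0, by omega⟩⟩
  refine globalDimension_le_of_forall 2 fun M _ _ => ?_
  refine h'.op.hasProjectiveDimensionLT_three (fun N _ _ _ _ => ?_) M
  exact stdD₂_injective h.op (degreeProj_op x hx) ((Matrix.isUnit_transpose L).2 hL)
    (by simpa using hn) N

end LinearSyzygies

/-! ### The Gorenstein property from a relation of maximal rank -/

section Gorenstein

variable {k : Type v} {A : Type u} [Field k] [Ring A] [Algebra k A] {𝒜 : ℕ → Submodule k A}

theorem GradedProjectiveResolution.subsingleton_ext {M N : Type u} [AddCommGroup M]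
    [Module Aᵐᵒᵖ M] {ℳ : ℤ → AddSubgroup M} [AddCommGroup N] [Module Aᵐᵒᵖ N] [Module k N]
    [SMulCommClass Aᵐᵒᵖ k N] (P : GradedProjectiveResolution 𝒜 ℳ) (𝒩 : ℤ → Submodule k N)
    (i : ℕ) (j : ℤ) (h : ∀ φ ∈ P.cocycles 𝒩 i j, φ ∈ P.coboundaries 𝒩 i j) :
    Subsingleton (P.ext 𝒩 i j) := by
  refine subsingleton_of_forall_eq 0 fun z => ?_
  obtain ⟨φ, rfl⟩ := Submodule.Quotient.mk_surjective _ z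
  exact (Submodule.Quotient.mk_eq_zero _).2 (h φ φ.2)

/-- The linear form on a free module with given coefficients. -/
def rowMap {r : ℕ} (c : Fin r → A) : (Fin r → A) →ₗ[Aᵐᵒᵖ] A :=
  LinearMap.proj 0 ∘ₗ matMap (fun _ : Fin 1 => c)

theorem rowMap_apply {r : ℕ} (c a : Fin r → A) : rowMap c a = ∑ p, c p * a p := rfl

theorem rowMap_single {r : ℕ} (c : Fin r → A) (p : Fin r) : rowMap c (Pi.single p 1) = c p := by
  rw [rowMap_apply, Finset.sum_eq_single p, Pi.single_eq_same, mul_one]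
  · intro q _ hq
    rw [Pi.single_eq_of_ne hq, mul_zero]
  · simp

theorem linearMap_eq_rowMap {r : ℕ} (φ : (Fin r → A) →ₗ[Aᵐᵒᵖ] A) :
    φ = rowMap fun p => φ (Pi.single p 1) :=
  LinearMap.ext fun a => linearMap_apply_eq_sum φ a

theorem rowMap_injective {r : ℕ} : Function.Injective (rowMap (A := A) (r := r)) := by
  intro c d h
  funext p
  rw [← rowMap_single c, h, rowMap_single]

theorem rowMap_zero {r : ℕ} : rowMap (0 : Fin r → A) = 0 :=
  LinearMap.ext fun a => by simp [rowMap_apply]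

theorem rowMap_eq_zero {r : ℕ} {c : Fin r → A} (h : rowMap c = 0) (p : Fin r) : c p = 0 := by
  rw [← rowMap_single c, h, LinearMap.zero_apply]

theorem rowMap_comp_matMap {r s : ℕ} (c : Fin r → A) (m : Fin r → Fin s → A) :
    rowMap c ∘ₗ matMap m = rowMap fun q => ∑ p, c p * m p q := by
  refine LinearMap.ext fun a => ?_
  rw [LinearMap.comp_apply, rowMap_apply, rowMap_apply]
  simp only [matMap_apply, Finset.mul_sum, Finset.sum_mul, mul_assoc]
  exact Finset.sum_comm

variable [GradedAlgebra 𝒜]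

theorem projZero_of_mem_intGrading {j : ℤ} (hj : j ≠ 0) {a : A} (ha : a ∈ intGrading 𝒜 j) :
    GradedRing.projZeroRingHom 𝒜 a = 0 :=
  intProj_of_mem_ne 𝒜 (j := 0) hj ha

theorem rowMap_mem_gradedHom_iff {r : ℕ} (s j : ℤ) (c : Fin r → A) :
    rowMap c ∈ gradedHom (shiftDeg 𝒜 r s) (intGrading 𝒜) j ↔ ∀ p, c p ∈ intGrading 𝒜 (s + j) := by
  constructor
  · intro h p
    have h1 := h s (Pi.single p 1) (fun q => by
      rw [sub_self]
      by_cases hq : q = p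
      · subst hq
        rw [Pi.single_eq_same]
        exact SetLike.one_mem_graded 𝒜
      · rw [Pi.single_eq_of_ne hq]
        exact Submodule.zero_mem _)
    rwa [rowMap_single] at h1
  · intro h i a ha
    rw [rowMap_apply]
    refine Submodule.sum_mem _ fun p _ => ?_
    have h1 := h p
    by_cases hj : s + j < 0
    · rw [intGrading_of_neg 𝒜 hj, Submodule.mem_bot] at h1
      rw [h1, zero_mul]
      exact Submodule.zero_mem _
    · obtain ⟨m, hm⟩ := Int.eq_ofNat_of_zero_le (not_lt.1 hj)
      rw [hm] at h1
      have h2 := mul_intGrading_mem 𝒜 h1 (ha p)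
      rwa [show (m : ℤ) + (i - s) = i + j by omega] at h2

variable {n t : ℕ} {x : Fin n → A} {y : Fin t → Fin n → A}

theorem rowMap_comp_linD_zero (c : Fin 1 → A) :
    rowMap c ∘ₗ matMap (linMat x y 0) = rowMap (r := n) fun p => c 0 * x p := by
  refine (rowMap_comp_matMap (r := 1) (s := n) c (linMat x y 0)).trans ?_
  congr 1
  funext q
  exact Fin.sum_univ_one _

theorem rowMap_comp_linD_one (c : Fin n → A) :
    rowMap c ∘ₗ matMap (linMat x y 1) = rowMap (r := t) fun s => ∑ j, c j * y s j :=
  rowMap_comp_matMap (r := n) (s := t) c (linMat x y 1)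

/-- To exhibit a coboundary it is enough to factor the morphism through the differential, ignoring
degrees. -/
theorem linearResolution_factor (h : LinSyz 𝒜 x y) {i : ℕ} {j : ℤ}
    {φ : (Fin (linRank n t (i + 1)) → A) →ₗ[Aᵐᵒᵖ] A}
    (hφ : φ ∈ gradedHom ((linearResolution h).deg (i + 1)) (intGrading 𝒜) j)
    (ψ : (Fin (linRank n t i) → A) →ₗ[Aᵐᵒᵖ] A) (hψ : ψ ∘ₗ matMap (linMat x y i) = φ) :
    φ ∈ (linearResolution h).coboundaries (intGrading 𝒜) (i + 1) j := by
  obtain ⟨ψ', h1, h2⟩ := exists_gradedHom_of_factor ((linearResolution h).isGradedModule (i + 1))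
    ((linearResolution h).isGradedModule i) (isGradedModule_intGrading 𝒜)
    ((linearResolution h).d i) ((linearResolution h).d_mem i) hφ ψ hψ
  exact ⟨ψ', h1, h2⟩

variable {L : Matrix (Fin n) (Fin n) k}

theorem sum_mul_linForm (c : Fin n → A) :
    ∑ j, c j * linForm x (fun _ : Fin 1 => L) 0 j = ∑ i, (∑ j, L j i • c j) * x i := by
  simp only [linForm, Finset.mul_sum, Finset.sum_mul, mul_smul_comm, smul_mul_assoc]
  exact Finset.sum_comm

theorem matrix_smul_injective (hL : IsUnit L) {c d : Fin n → A}
    (h : ∀ i, ∑ j, L j i • c j = ∑ j, L j i • d j) : c = d := by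
  have key : ∀ (e : Fin n → A) q, ∑ i, L⁻¹ i q • ∑ j, L j i • e j = e q := by
    intro e q
    simp only [Finset.smul_sum, smul_smul]
    rw [Finset.sum_comm]
    simp only [← Finset.sum_smul]
    have h4 : ∀ j, ∑ i, L⁻¹ i q * L j i = (1 : Matrix (Fin n) (Fin n) k) j q := by
      intro i
      rw [← Matrix.mul_nonsing_inv L ((Matrix.isUnit_iff_isUnit_det L).1 hL), Matrix.mul_apply]
      exact Finset.sum_congr rfl fun j _ => mul_comm _ _
    simp only [h4, Matrix.one_apply, ite_smul, one_smul, zero_smul, Finset.sum_ite_eq',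
      Finset.mem_univ, if_true]
  funext q
  rw [← key c, ← key d]
  simp only [h]

theorem matrix_smul_surjective (hL : IsUnit L) (c : Fin n → A) :
    ∃ d : Fin n → A, ∀ i, ∑ j, L j i • d j = c i := by
  refine ⟨fun j => ∑ i, L⁻¹ i j • c i, fun q => ?_⟩
  simp only [Finset.smul_sum, smul_smul]
  rw [Finset.sum_comm]
  simp only [← Finset.sum_smul]
  have h4 : ∀ i, ∑ j, L j q * L⁻¹ i j = (1 : Matrix (Fin n) (Fin n) k) i q := by
    intro i
    rw [← Matrix.nonsing_inv_mul L ((Matrix.isUnit_iff_isUnit_det L).1 hL), Matrix.mul_apply]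
    exact Finset.sum_congr rfl fun j _ => mul_comm _ _
  simp only [h4, Matrix.one_apply, ite_smul, one_smul, zero_smul, Finset.sum_ite_eq',
    Finset.mem_univ, if_true]

/-- The vanishing part of the computation of `Ext_A(k, A)`. -/
theorem subsingleton_linearResolution_ext
    (hq : QuadPres.{v, u, max u v} x (fun _ : Unit => L)) (hL : IsUnit L) (hn : 2 ≤ n)
    (h : LinSyz 𝒜 x (linForm x (fun _ : Fin 1 => L))) (i : ℕ) (j : ℤ) (hij : i = 2 → j ≠ -2) :
    Subsingleton ((linearResolution h).ext (intGrading 𝒜) i j) := by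
  refine (linearResolution h).subsingleton_ext _ i j fun φ hφ => ?_
  match i with
  | 0 =>
    obtain ⟨c, rfl⟩ : ∃ c : Fin 1 → A, φ = rowMap (r := 1) c := ⟨_, linearMap_eq_rowMap (r := 1) φ⟩
    have h3 := rowMap_eq_zero ((rowMap_comp_linD_zero c).symm.trans hφ.2) ⟨0, by omega⟩
    have h4 := mul_right_injective_gen hq (degreeProj x h.x_mem) hL (by simpa using hn) _ h3
    have h5 : c = 0 := funext fun p => by rw [Subsingleton.elim p 0, h4, Pi.zero_apply]
    rw [h5, rowMap_zero]
    exact Submodule.zero_mem _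
  | 1 =>
    obtain ⟨c, rfl⟩ : ∃ c : Fin n → A, φ = rowMap (r := n) c := ⟨_, linearMap_eq_rowMap (r := n) φ⟩
    -- After the change of coordinates by L the cocycle condition is a left syzygy of the
    -- generators, so it is a multiple z of the relation; cancelling L gives c j = z x j, the
    -- coboundary of z.
    have h3 := rowMap_eq_zero ((rowMap_comp_linD_one (x := x) c).symm.trans hφ.2) 0
    rw [sum_mul_linForm] at h3
    obtain ⟨z, hz⟩ := hq.exists_of_sum_mul_eq_zero h3
    have h4 : c = fun j => z () * x j := matrix_smul_injective hL fun i => by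
      rw [hz i, Finset.univ_unique, Finset.sum_singleton]
    refine linearResolution_factor h hφ.1 (rowMap (r := 1) fun _ => z ()) ?_
    rw [h4]
    exact rowMap_comp_linD_zero _
  | 2 =>
    obtain ⟨c, rfl⟩ : ∃ c : Fin 1 → A, φ = rowMap (r := 1) c := ⟨_, linearMap_eq_rowMap (r := 1) φ⟩
    have h1 := (rowMap_mem_gradedHom_iff (r := 1) 2 j c).1 hφ.1 0
    -- Outside internal degree -2 the coefficient lies in A_+, the left ideal generated by the x j;
    -- inverting L turns such an expression into a coboundary.
    obtain ⟨d, hd⟩ := hq.exists_sum_mul_left h.x_mem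
      (projZero_of_mem_intGrading (by have := hij rfl; omega) h1)
    obtain ⟨e, he⟩ := matrix_smul_surjective hL d
    refine linearResolution_factor h hφ.1 (rowMap (r := n) e) ?_
    refine (rowMap_comp_linD_one _).trans ?_
    congr 1
    funext p
    rw [Subsingleton.elim p 0, sum_mul_linForm, hd]
    simp only [he]
  | i + 3 =>
    have h0 : φ = 0 := LinearMap.ext fun a => by
      have h1 : a = 0 := funext fun p : Fin 0 => p.elim0
      rw [h1, map_zero, map_zero]
    rw [h0]
    exact Submodule.zero_mem _

/-- The surviving class is that of 1: morphisms of degree -2 from the last term A(-2) to A form A_0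
= k, and none is a nonzero coboundary. -/
theorem isGorenstein_of_linSyz (hA : IsConnected 𝒜)
    (hq : QuadPres.{v, u, max u v} x (fun _ : Unit => L)) (hL : IsUnit L) (hn : 2 ≤ n)
    (h : LinSyz 𝒜 x (linForm x (fun _ : Fin 1 => L))) : IsGorenstein 𝒜 := by
  classical
  have : Nontrivial A := by
    have := hA.bijective.1.nontrivial
    exact ((𝒜 0).subtype_injective).nontrivial
  have hone : (1 : A) ∈ 𝒜 0 := SetLike.one_mem_graded 𝒜
  have hco : rowMap (r := 1) (fun _ : Fin 1 => (1 : A)) ∈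
      (linearResolution h).cocycles (intGrading 𝒜) 2 (-2) := by
    refine ⟨(rowMap_mem_gradedHom_iff (r := 1) 2 (-2) _).2 fun _ => hone, ?_⟩
    refine LinearMap.ext fun a => ?_
    have h1 : a = 0 := funext fun p : Fin 0 => p.elim0
    rw [h1, map_zero, map_zero]
  let ω : (linearResolution h).ext (intGrading 𝒜) 2 (-2) := Submodule.Quotient.mk ⟨_, hco⟩
  have hω : ω ≠ 0 := by
    intro h0
    have h0' : (⟨_, hco⟩ : (linearResolution h).cocycles (intGrading 𝒜) 2 (-2)) ∈
        ((linearResolution h).coboundaries (intGrading 𝒜) 2 (-2)).submoduleOf _ :=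
      (Submodule.Quotient.mk_eq_zero _).1 h0
    obtain ⟨ψ, hψ, hψ'⟩ := h0'
    obtain ⟨c, rfl⟩ : ∃ c : Fin n → A, ψ = rowMap (r := n) c := ⟨_, linearMap_eq_rowMap (r := n) ψ⟩
    -- Generators of degree one would be sent to degree -1, where A is zero.
    have h1 : ∀ p, c p = 0 := (rowMap_mem_gradedHom_iff (r := n) 1 (-2) c).1 hψ
    have h2 := congrFun (rowMap_injective ((rowMap_comp_linD_one (x := x) c).symm.trans hψ')) 0
    simp only [h1, zero_mul, Finset.sum_const_zero] at h2
    exact zero_ne_one h2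
  have hspan : ∀ z : (linearResolution h).ext (intGrading 𝒜) 2 (-2), ∃ r : k, r • ω = z := by
    intro z
    obtain ⟨⟨φ, hφ⟩, rfl⟩ := Submodule.Quotient.mk_surjective _ z
    obtain ⟨c, rfl⟩ : ∃ c : Fin 1 → A, φ = rowMap (r := 1) c := ⟨_, linearMap_eq_rowMap (r := 1) φ⟩
    have h1 : c 0 ∈ 𝒜 0 := (rowMap_mem_gradedHom_iff (r := 1) 2 (-2) c).1 hφ.1 0
    obtain ⟨r, hr⟩ := hA.bijective.2 ⟨c 0, h1⟩
    refine ⟨r, congrArg (Submodule.Quotient.mk) (Subtype.ext (LinearMap.ext fun a => ?_))⟩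
    change r • ∑ p : Fin 1, (1 : A) * a p = ∑ p : Fin 1, c p * a p
    have h2 : algebraMap k A r = c 0 := congrArg Subtype.val hr
    rw [Fin.sum_univ_one, Fin.sum_univ_one, one_mul, Algebra.smul_def, h2]
  refine ⟨linearResolution h, ?_⟩
  refine (finrank_eq_one_iff_of_nonzero' (DirectSum.lof k (ℕ × ℤ)
    (fun p => (linearResolution h).ext (intGrading 𝒜) p.1 p.2) (2, -2) ω) ?_).2 fun w => ?_
  · intro h0
    refine hω ?_
    have h1 := congrArg (fun w => w (2, -2)) h0
    simpa [DirectSum.lof_apply] using h1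
  · obtain ⟨r, hr⟩ := hspan (w (2, -2))
    refine ⟨r, DFinsupp.ext fun p => ?_⟩
    by_cases hp : p = (2, -2)
    · subst hp
      rw [← map_smul, hr]
      exact DirectSum.lof_apply k _ _
    · have := subsingleton_linearResolution_ext hq hL hn h p.1 p.2 (fun h1 h2 =>
        hp (Prod.ext h1 h2))
      exact Subsingleton.elim _ _

end Gorenstein

/-! ### The relations of a Gorenstein algebra of global dimension two -/

section Converse

variable {k : Type v} {A : Type u} [Field k] [Ring A] [Algebra k A] {𝒜 : ℕ → Submodule k A}
  [GradedAlgebra 𝒜]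

theorem proj_mul_eq_zero {m : ℕ} {w z : A} (hw : GradedRing.projZeroRingHom 𝒜 w = 0)
    (hz : ∀ i < m, GradedAlgebra.proj 𝒜 i z = 0) : GradedAlgebra.proj 𝒜 m (w * z) = 0 := by
  obtain ⟨N, hN⟩ := exists_sum_proj 𝒜 w
  rw [hN N le_rfl, Finset.sum_mul, map_sum]
  refine Finset.sum_eq_zero fun i _ => ?_
  have hi : GradedAlgebra.proj 𝒜 i w ∈ 𝒜 i := SetLike.coe_mem _
  by_cases him : i ≤ m
  · have h1 : GradedAlgebra.proj 𝒜 m (GradedAlgebra.proj 𝒜 i w * z)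
        = GradedAlgebra.proj 𝒜 i w * GradedAlgebra.proj 𝒜 (m - i) z :=
      DirectSum.coe_decompose_mul_of_left_mem_of_le 𝒜 hi him
    rw [h1]
    rcases Nat.eq_zero_or_pos i with rfl | hpos
    · have h2 : GradedAlgebra.proj 𝒜 0 w = 0 := hw
      rw [h2, zero_mul]
    · rw [hz _ (by omega), mul_zero]
  · exact DirectSum.coe_decompose_mul_of_left_mem_of_not_le 𝒜 hi him

/-- A graded Nakayama argument: W has no part of degree zero, so the component of z in each degree
is determined by components in strictly lower degrees. -/
theorem eq_zero_of_eq_sum_mul {t : ℕ} {z : Fin t → A} (W : Fin t → Fin t → A)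
    (hW : ∀ s q, GradedRing.projZeroRingHom 𝒜 (W s q) = 0) (hz : ∀ s, z s = ∑ q, W s q * z q) :
    z = 0 := by
  have key : ∀ m s, GradedAlgebra.proj 𝒜 m (z s) = 0 := by
    intro m
    induction m using Nat.strong_induction_on with
    | _ m ih =>
      intro s
      rw [hz s, map_sum]
      exact Finset.sum_eq_zero fun q _ => proj_mul_eq_zero (hW s q) fun i hi => ih i hi q
  funext s
  obtain ⟨N, hN⟩ := exists_sum_proj 𝒜 (z s)
  rw [hN N le_rfl]
  exact Finset.sum_eq_zero fun m _ => key m s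

theorem IsConnected.exists_algebraMap (hA : IsConnected 𝒜) {a : A} (ha : a ∈ 𝒜 0) :
    ∃ r : k, algebraMap k A r = a := by
  obtain ⟨r, hr⟩ := hA.bijective.2 ⟨a, ha⟩
  exact ⟨r, congrArg Subtype.val hr⟩

theorem IsConnected.nontrivial (hA : IsConnected 𝒜) : Nontrivial A := by
  have := hA.bijective.1.nontrivial
  exact ((𝒜 0).subtype_injective).nontrivial

variable {n t : ℕ} {x : Fin n → A} {y : Fin t → Fin n → A}

/-- If the kernel of `A^n → A` is projective, its minimal generators are independent. -/
theorem LinPres.linSyz (hA : IsConnected 𝒜) (h : LinPres 𝒜 x y)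
    (hy : ∀ c : Fin t → k, (∀ j, ∑ s, c s • y s j = 0) → c = 0)
    (hproj : Module.Projective Aᵐᵒᵖ (LinearMap.ker (matMap (linMat x y 0)))) :
    LinSyz 𝒜 x y := by
  refine { h with inj := fun z hz => ?_ }
  -- The degree-one part of the equation involves only the constant terms of z, and these vanish
  -- because the y s are linearly independent over k.
  have hconst : ∀ z : Fin t → A, (∀ j, ∑ s, y s j * z s = 0) →
      ∀ s, GradedRing.projZeroRingHom 𝒜 (z s) = 0 := by
    intro z hz
    choose c hc using fun s => hA.exists_algebraMap
      (SetLike.coe_mem (DirectSum.decompose 𝒜 (z s) 0))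
    have h1 := hy c fun j => by
      have h2 := congrArg (GradedAlgebra.proj 𝒜 1) (hz j)
      rw [map_sum, map_zero] at h2
      refine (Finset.sum_congr rfl fun s _ => ?_).trans h2
      rw [Algebra.smul_def, Algebra.commutes, hc]
      exact (DirectSum.coe_decompose_mul_add_of_left_mem 𝒜 (j := 0) (h.y_mem s j)).symm
    intro s
    change ((DirectSum.decompose 𝒜 (z s) 0 : 𝒜 0) : A) = 0
    rw [← hc, h1, Pi.zero_apply, map_zero]
  obtain ⟨p, hp0, hpz⟩ : ∃ p : (Fin t → A) →ₗ[Aᵐᵒᵖ] (Fin t → A),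
      (∀ b, matMap (linMat x y 1) (p b) = 0) ∧ ∀ b, matMap (linMat x y 1) b = 0 → p b = b :=
    exists_retraction_ker _ _ (linD_exact_one h) hproj
  -- The retraction p onto the kernel has columns in the kernel, so its matrix has entries in A_+;
  -- since p fixes z, Nakayama applies.
  refine eq_zero_of_eq_sum_mul (fun s q => p (Pi.single q 1) s)
    (fun s q => hconst _ (congrFun (hp0 _)) s) fun s => ?_
  have h1 := linearMap_apply_eq_sum (LinearMap.proj s ∘ₗ p) z
  rw [LinearMap.comp_apply, hpz z (funext hz)] at h1
  exact h1

/-- For the relations of a Gorenstein algebra, the module `Ext²(k, A)` gives the number and the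
rank of the relations. -/
theorem exists_of_isGorenstein (hA : IsConnected 𝒜) (hG : IsGorenstein 𝒜) (h : LinSyz 𝒜 x y)
    (ht : 0 < t) : ∃ ht1 : t = 1, ∀ v ∈ 𝒜 1, ∃ c : Fin n → k,
      ∑ j, c j • y (Fin.cast ht1.symm 0) j = v := by
  classical
  obtain ⟨P, hP⟩ := hG
  have : Nontrivial A := hA.nontrivial
  have hfin : Module.Finite k (⨁ p : ℕ × ℤ, P.ext (intGrading 𝒜) p.1 p.2) :=
    Module.finite_of_finrank_pos (by omega)
  have key := exists_gradedHom_to_ext (isGradedModule_residue 𝒜) (isGradedModule_intGrading 𝒜) P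
    (linearResolution h) (linD_injective h)
  obtain ⟨T, hT⟩ := key (-2)
  obtain ⟨T', hT'⟩ := key (-1)
  -- scalars give morphisms of degree `-2`, none of which is a coboundary
  let E : (Fin t → k) →ₗ[k] gradedHom ((linearResolution h).deg 2) (intGrading 𝒜) (-2) :=
    { toFun := fun c => ⟨rowMap (r := t) fun s => algebraMap k A (c s),
        (rowMap_mem_gradedHom_iff (r := t) 2 (-2) _).2 fun s =>
          SetLike.algebraMap_mem_graded 𝒜 (c s)⟩
      map_add' := fun c c' => Subtype.ext <| LinearMap.ext fun a => by
        change ∑ p : Fin t, algebraMap k A (c p + c' p) * a p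
          = ∑ p : Fin t, algebraMap k A (c p) * a p + ∑ p : Fin t, algebraMap k A (c' p) * a p
        simp only [map_add, add_mul, Finset.sum_add_distrib]
      map_smul' := fun r c => Subtype.ext <| LinearMap.ext fun a => by
        change ∑ p : Fin t, algebraMap k A (r * c p) * a p
          = r • ∑ p : Fin t, algebraMap k A (c p) * a p
        simp only [map_mul, mul_assoc, Algebra.smul_def, Finset.mul_sum] }
  let Λ : (Fin t → k) →ₗ[k] ⨁ p : ℕ × ℤ, P.ext (intGrading 𝒜) p.1 p.2 :=
    DirectSum.lof k (ℕ × ℤ) (fun p => P.ext (intGrading 𝒜) p.1 p.2) (2, -2) ∘ₗ T ∘ₗ E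
  have hlof : ∀ p : ℕ × ℤ, Function.Injective
      (DirectSum.lof k (ℕ × ℤ) (fun p => P.ext (intGrading 𝒜) p.1 p.2) p) :=
    fun p => DirectSum.of_injective p
  have hE : ∀ c, Λ c = 0 → c = 0 := by
    intro c hc
    have h1 : T (E c) = 0 := hlof (2, -2) (hc.trans (map_zero _).symm)
    obtain ⟨ψ, hψ, hψ'⟩ := hT _ h1
    obtain ⟨d, rfl⟩ : ∃ d : Fin n → A, ψ = rowMap (r := n) d := ⟨_, linearMap_eq_rowMap (r := n) ψ⟩
    have h2 : ∀ p, d p = 0 := (rowMap_mem_gradedHom_iff (r := n) 1 (-2) d).1 hψ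
    have h3 := rowMap_injective ((rowMap_comp_linD_one (x := x) d).symm.trans hψ')
    funext s
    have h4 := congrFun h3 s
    simp only [h2, zero_mul, Finset.sum_const_zero] at h4
    exact (algebraMap k A).injective (h4.symm.trans (map_zero _).symm)
  -- An injection of k^t into a one-dimensional space, together with t > 0.
  have ht1 : t = 1 := by
    have h1 := LinearMap.finrank_le_finrank_of_injective ((injective_iff_map_eq_zero Λ).2 hE)
    rw [Module.finrank_fin_fun, hP] at h1
    omega
  subst ht1
  refine ⟨rfl, fun v hv => ?_⟩
  -- a morphism of degree `-1` is a coboundary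
  have hΛ : Λ 1 ≠ 0 := fun h0 => one_ne_zero (hE 1 h0)
  have hmem : rowMap (r := 1) (fun _ => v) ∈
      gradedHom ((linearResolution h).deg 2) (intGrading 𝒜) (-1) :=
    (rowMap_mem_gradedHom_iff (r := 1) 2 (-1) _).2 fun _ => hv
  obtain ⟨r, hr⟩ := (finrank_eq_one_iff_of_nonzero' _ hΛ).1 hP
    (DirectSum.lof k (ℕ × ℤ) (fun p => P.ext (intGrading 𝒜) p.1 p.2) (2, -1) (T' ⟨_, hmem⟩))
  -- The total Ext is already spanned by a class in bidegree (2, -2), which leaves nothing in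
  -- bidegree (2, -1).
  have h0 : T' ⟨_, hmem⟩ = 0 := by
    have h1 := congrArg (fun w => w (2, -1)) hr
    have h2 : Λ 1 (2, -1) = 0 := DirectSum.of_eq_of_ne (2, -2) (2, -1) _ (by simp)
    have h3 : (r • Λ 1) (2, -1) = r • (Λ 1 (2, -1)) := rfl
    rw [h3, h2, smul_zero] at h1
    exact (h1.trans (DirectSum.lof_apply k _ _)).symm
  obtain ⟨ψ, hψ, hψ'⟩ := hT' _ h0
  obtain ⟨d, rfl⟩ : ∃ d : Fin n → A, ψ = rowMap (r := n) d := ⟨_, linearMap_eq_rowMap (r := n) ψ⟩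
  -- Generators of degree one are mapped in degree -1 to A_0, so the coefficients of ψ are scalars.
  choose c hc using fun p =>
    hA.exists_algebraMap ((rowMap_mem_gradedHom_iff (r := n) 1 (-1) d).1 hψ p)
  have h3 := congrFun (rowMap_injective ((rowMap_comp_linD_one (x := x) d).symm.trans hψ')) 0
  refine ⟨c, Eq.trans (Finset.sum_congr rfl fun j _ => ?_) h3⟩
  rw [Algebra.smul_def, hc]
  rfl

end Converse

/-! ### Coefficient matrices of the relations and the Gorenstein case -/

section Relations

variable {k : Type v} {A : Type u} [Field k] [Ring A] [Algebra k A] {𝒜 : ℕ → Submodule k A}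

theorem coeffMatrix_sum_smul {X : Type w} [AddCommGroup X] [Module k X] {ι σ : Type*} [Fintype σ]
    (b : Module.Basis ι k X) (f : σ → X ⊗[k] X) (c : σ → k) (i j : ι) :
    coeffMatrix b (∑ s, c s • f s) i j = ∑ s, c s * coeffMatrix b (f s) i j := by
  simp [coeffMatrix]

theorem eq_zero_of_coeffMatrix {X : Type w} [AddCommGroup X] [Module k X] {ι : Type*}
    (b : Module.Basis ι k X) {f : X ⊗[k] X} (h : ∀ i j, coeffMatrix b f i j = 0) : f = 0 :=
  (b.tensorProduct b).ext_elem fun p => by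
    rw [map_zero, Finsupp.zero_apply]
    exact h p.1 p.2

theorem eq_zero_of_sum_coeffMatrix {X : Type w} [AddCommGroup X] [Module k X] {ι σ : Type*}
    [Fintype σ] (b : Module.Basis ι k X) {f : σ → X ⊗[k] X} (hf : LinearIndependent k f)
    {c : σ → k} (h : ∀ i j, ∑ s, c s * coeffMatrix b (f s) i j = 0) : c = 0 :=
  funext (Fintype.linearIndependent_iff.1 hf c (eq_zero_of_coeffMatrix b fun i j => by
    rw [coeffMatrix_sum_smul, h]))

theorem linForm_independent {n t : ℕ} (b : Module.Basis (Fin n) k (𝒜 1))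
    {f : Fin t → 𝒜 1 ⊗[k] 𝒜 1} (hf : LinearIndependent k f) (c : Fin t → k)
    (hc : ∀ j, ∑ s, c s • linForm (fun i => (b i : A)) (fun s => coeffMatrix b (f s)) s j = 0) :
    c = 0 := by
  refine eq_zero_of_sum_coeffMatrix b hf fun j i => ?_
  have h1 : ∑ i, (∑ s, c s * coeffMatrix b (f s) j i) • b i = 0 := by
    apply Subtype.ext
    have h2 := hc j
    simp only [linForm, Finset.smul_sum, smul_smul] at h2
    rw [Finset.sum_comm] at h2
    simp only [← Finset.sum_smul] at h2
    have h3 := map_sum (𝒜 1).subtype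
      (fun i => (∑ s, c s * coeffMatrix b (f s) j i) • b i) Finset.univ
    exact h3.trans h2
  exact Fintype.linearIndependent_iff.1 b.linearIndependent _ h1 i

variable [GradedAlgebra 𝒜]

/-- A quadratic Gorenstein algebra of global dimension two has one relation, of maximal rank, in
at least two generators. -/
theorem relation_of_isGorenstein {n t : ℕ} (hA : IsConnected 𝒜) (hQ : IsQuadratic 𝒜)
    (hG : IsGorenstein 𝒜) (hgd : globalDimension A = 2) (b : Module.Basis (Fin n) k (𝒜 1))
    (f : Fin t → 𝒜 1 ⊗[k] 𝒜 1) (hf : LinearIndependent k f)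
    (hspan : ∀ g, canonicalMap 𝒜 (tensorSquare k (𝒜 1) g) = 0 ↔
      g ∈ Submodule.span k (Set.range f)) :
    2 ≤ n ∧ ∃ f : 𝒜 1 ⊗[k] 𝒜 1, HasPresentation 𝒜 {f} ∧ IsUnit (coeffMatrix b f) := by
  have hfs : ∀ s, canonicalMap 𝒜 (tensorSquare k (𝒜 1) (f s)) = 0 := fun s =>
    (hspan _).2 (Submodule.subset_span ⟨s, rfl⟩)
  have hq := HasPresentation.quadPres.{v, u, max u v} hQ b f hfs fun g hg => (hspan g).1 hg
  have hq' := HasPresentation.quadPres.{v, u, u} hQ b f hfs fun g hg => (hspan g).1 hg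
  have : Nontrivial A := hA.nontrivial
  have ht : 0 < t := by
    refine Nat.pos_of_ne_zero fun h0 => ?_
    subst h0
    have h1 : globalDimension A ≤ ((1 : ℕ) : ℕ∞) :=
      globalDimension_le_of_forall 1 fun M _ _ => hq'.op.hasProjectiveDimensionLT_two M
    rw [hgd] at h1
    exact absurd h1 (by decide)
  have hpres := hq.linPres (𝒜 := 𝒜) fun j => (b j).2
  have h3 := hasProjectiveDimensionLT_of_globalDimension_le 2 hgd.le (residue 𝒜)
  have hsyz := hpres.linSyz hA (linForm_independent b hf)
    ((hasProjectiveDimensionLT_three_iff (linAug 𝒜) linAug_surjective _ (linAug_exact hpres)).1 h3)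
  obtain ⟨rfl, hv⟩ := exists_of_isGorenstein hA hG hsyz ht
  refine ⟨?_, f 0, hQ.hasPresentation ?_ ?_, ?_⟩
  -- Too few generators contradict injectivity of the second differential: with none, its target is
  -- zero and it kills 1; with one, it is multiplication by a multiple of x, and the relation makes
  -- it kill x.
  · by_contra hn
    have h01 : n = 0 ∨ n = 1 := by omega
    rcases h01 with rfl | rfl
    · have h4 := hsyz.inj (fun _ => 1) fun j => j.elim0
      exact one_ne_zero (congrFun h4 0)
    · have h4 := hsyz.inj (fun _ => (b 0 : A)) fun j => by
        have h5 := hsyz.rel 0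
        simp only [Finset.univ_unique, Finset.sum_singleton, linForm] at h5 ⊢
        rw [Subsingleton.elim j 0, smul_mul_assoc, ← mul_smul_comm]
        exact h5
      exact b.ne_zero 0 (Subtype.ext (congrFun h4 0))
  · intro g hg
    rw [Set.mem_singleton_iff.1 hg]
    exact hfs 0
  · intro g hg
    have h4 := (hspan g).1 hg
    rwa [Set.range_unique] at h4
  -- That every element of A_1 is a combination of the coefficients of the relation means that the
  -- row space of the matrix is everything.
  · rw [← Matrix.vecMul_surjective_iff_isUnit]
    intro w
    obtain ⟨c, hc⟩ := hv _ (∑ i, w i • b i).2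
    refine ⟨c, b.equivFun.symm.injective (Subtype.ext ?_)⟩
    rw [b.equivFun_symm_apply, b.equivFun_symm_apply, ← hc]
    refine (map_sum (𝒜 1).subtype _ _).trans ?_
    simp only [linForm, Finset.smul_sum, smul_smul]
    rw [Finset.sum_comm]
    simp only [← Finset.sum_smul]
    rfl

end Relations

/-! ### Coordinate-free form of the equivalence of 1 and 3 -/

section Equivalence

variable {k : Type v} {A : Type u} [Field k] [Ring A] [Algebra k A] {𝒜 : ℕ → Submodule k A}

theorem exists_basis_submodule {X : Type w} [AddCommGroup X] [Module k X] [Module.Finite k X]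
    (K : Submodule k X) : ∃ (t : ℕ) (f : Fin t → X), LinearIndependent k f ∧
      ∀ g, g ∈ K ↔ g ∈ Submodule.span k (Set.range f) := by
  refine ⟨_, fun s => (Module.finBasis k K s : X),
    (Module.finBasis k K).linearIndependent.map' K.subtype K.ker_subtype, fun g => ?_⟩
  have h1 : Submodule.span k (Set.range fun s => (Module.finBasis k K s : X)) = K := by
    have h2 := congrArg (Submodule.map K.subtype) (Module.finBasis k K).span_eq
    rw [Submodule.map_span, Submodule.map_top, K.range_subtype, ← Set.range_comp] at h2
    exact h2
  rw [h1]

theorem exists_basis_ker {X W : Type*} [AddCommGroup X] [Module k X] [Module.Finite k X]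
    [AddCommGroup W] [Module k W] (φ : X ⊗[k] X →ₗ[k] W) :
    ∃ (t : ℕ) (f : Fin t → X ⊗[k] X), LinearIndependent k f ∧
      ∀ g, φ g = 0 ↔ g ∈ Submodule.span k (Set.range f) :=
  exists_basis_submodule (LinearMap.ker φ)

variable [GradedAlgebra 𝒜]

theorem exists_relation_of_isGorenstein (hA : IsConnected 𝒜) [Module.Finite k (𝒜 1)]
    (hQ : IsQuadratic 𝒜) (hG : IsGorenstein 𝒜) (hgd : globalDimension A = 2) :
    2 ≤ Module.finrank k (𝒜 1) ∧ ∃ f : 𝒜 1 ⊗[k] 𝒜 1, HasPresentation 𝒜 {f} ∧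
      tensorRank f = Module.finrank k (𝒜 1) := by
  obtain ⟨t, f, hf, hspan⟩ := exists_basis_ker (mulMap 𝒜)
  obtain ⟨h2, f, hF, hu⟩ := relation_of_isGorenstein hA hQ hG hgd (Module.finBasis k (𝒜 1)) f hf
    fun g => by rw [canonicalMap_tensorSquare_eq_zero_iff, hspan]
  exact ⟨h2, f, hF, (tensorRank_eq_iff_isUnit _ f).2 hu⟩

theorem isGorenstein_of_hasPresentation (hA : IsConnected 𝒜) [Module.Finite k (𝒜 1)]
    {f : 𝒜 1 ⊗[k] 𝒜 1} (hF : HasPresentation 𝒜 {f})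
    (hrank : tensorRank f = Module.finrank k (𝒜 1)) (h2 : 2 ≤ Module.finrank k (𝒜 1)) :
    IsGorenstein 𝒜 ∧ globalDimension A = 2 := by
  have hL := (tensorRank_eq_iff_isUnit (Module.finBasis k (𝒜 1)) f).1 hrank
  have hf : canonicalMap 𝒜 (tensorSquare k (𝒜 1) f) = 0 := hF.apply_eq_zero rfl
  have hx : ∀ j, (Module.finBasis k (𝒜 1) j : A) ∈ 𝒜 1 := fun j => SetLike.coe_mem _
  have hq := HasPresentation.quadPres.{v, u, max u v} (σ := Unit) hF (Module.finBasis k (𝒜 1))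
    (fun _ => f) (fun _ => hf) (by simp)
  have hq' := HasPresentation.quadPres.{v, u, u} (σ := Unit) hF (Module.finBasis k (𝒜 1))
    (fun _ => f) (fun _ => hf) (by simp)
  have hq1 := HasPresentation.quadPres.{v, u, max u v} (σ := Fin 1) hF (Module.finBasis k (𝒜 1))
    (fun _ => f) (fun _ => hf) (by simp)
  have hsyz : LinSyz 𝒜 _ _ := ⟨hq1.linPres hx, linForm_mul_injective hq hx hL h2⟩
  have : Nontrivial A := hA.nontrivial
  exact ⟨isGorenstein_of_linSyz hA hq hL h2 hsyz,
    le_antisymm (globalDimension_le_two hq hq' hx hL h2) (two_le_globalDimension hsyz one_pos)⟩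

end Equivalence

end

end GradedGor

theorem mainTheorem6 {k : Type*} {A : Type*} [Field k] [Ring A] [Algebra k A]
    (𝒜 : ℕ → Submodule k A) [GradedAlgebra 𝒜] (hA : GradedGor.IsConnected 𝒜) :
    List.TFAE [
      GradedGor.IsQuadratic 𝒜 ∧ GradedGor.IsGorenstein 𝒜 ∧ GradedGor.globalDimension A = 2,
      GradedGor.IsQuadratic 𝒜 ∧ GradedGor.IsFrobenius (GradedGor.quadraticDualGrading 𝒜) ∧
        GradedGor.gradedSup (GradedGor.quadraticDualGrading 𝒜) = 2,
      haveI := hA.finite 1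
      2 ≤ Module.finrank k (𝒜 1) ∧
        ∃ f : TensorProduct k (𝒜 1) (𝒜 1), GradedGor.HasPresentation 𝒜 {f} ∧
          GradedGor.tensorRank f = Module.finrank k (𝒜 1)] := by
  have := hA.finite 1
  tfae_have 1 → 3 := fun ⟨hQ, hG, hgd⟩ => GradedGor.exists_relation_of_isGorenstein hA hQ hG hgd
  tfae_have 3 → 1 := fun ⟨h2, _, hF, hrank⟩ =>
    ⟨hF.isQuadratic, GradedGor.isGorenstein_of_hasPresentation hA hF hrank h2⟩
  tfae_have 3 → 2 := fun ⟨h2, f, hF, hrank⟩ =>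
    ⟨hF.isQuadratic, GradedGor.isFrobenius_quadraticDual
      ((GradedGor.canonicalMap_tensorSquare_eq_zero_iff f).1 (hF.apply_eq_zero rfl))
      (fun g hg => hF.mem_span_of_singleton
        ((GradedGor.canonicalMap_tensorSquare_eq_zero_iff g).2 hg)) hrank h2⟩
  tfae_have 2 → 3 := fun ⟨hQ, hF, hs⟩ => GradedGor.exists_relation_of_isFrobenius hQ hF hs
  tfae_finish
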